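/- Let $\alpha\in\mathbb R$, $\alpha\neq 0$, $\mathbb N=\{0,1,2,\dots\}$, and suppose that either $\lambda=\alpha$ and $\alpha\notin\mathbb N$, or $\lambda=1$ and $\alpha^{-1}\notin\mathbb N$. **The Lie superalgebra.** Let $D_\alpha$ be the Jordan superalgebra with even basis $e_1,e_2$, odd basis $\xi,\eta$ and the supercommutative product $e_ie_i=e_i$, $e_1e_2=0$, $e_i\xi=\tfrac12\xi$, $e_i\eta=\tfrac12\eta$, $\xi\eta=e_1+\alpha e_2$. Let $L_a$ be multiplication by $a$, $\mathfrak{str}(D_\alpha)=\{L_a\}\oplus\mathrm{Der}(D_\alpha)$ (all superderivations), and let $\mathfrak g=\mathrm{TKK}(D_\alpha)=D_\alpha^-\oplus\mathfrak{str}(D_\alpha)\oplus D_\alpha^+$ be the Tits–Kantor–Koecher Lie superalgebra, with $[D^\pm_\alpha,D^\pm_\alpha]=0$, $[x,u]=2L_{xu}+2[L_x,L_u]$ for $x\in D_\alpha^+,u\in D_\alpha^-$, and $T=L_a+I$ (with $I$ a derivation) acting on $D_\alpha^+$ by $T$ and on $D_\alpha^-$ by $-L_a+I$. The scalars are extended to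 $\mathbb C$. Write $e$ and $f$ for the unit $e_1+e_2$ regarded in $D_\alpha^+$ and in $D_\alpha^-$, and let $c=\exp(\tfrac{i}{2}\mathrm{ad} f)\exp(i\,\mathrm{ad}\, e)$ be the Cayley transform. **The representations.** On superfunctions in even coordinates $x_1,x_2$ and odd coordinates $x_3,x_4$, with (left) partial derivatives $\partial_i$, the Bessel operators are $$\mathcal B_\lambda(x_1)=(-\lambda+x_1\partial_1+x_3\partial_3+x_4\partial_4)\partial_1-2\alpha x_2\partial_3\partial_4,$$ $$\mathcal B_\lambda(x_2)=(-\tfrac{\lambda}{\alpha}+x_2\partial_2+x_3\partial_3+x_4\partial_4)\partial_2-2x_1\partial_3\partial_4,$$ $$\mathcal B_\lambda(x_3)=(-2\lambda+2x_1\partial_1+2\alpha x_2\partial_2+2(1+\alpha)x_3\partial_3)\partial_4+x_3\partial_1\partial_2,$$ $$\mathcal B_\lambda(x_4)=(2\lambda-2x_1\partial_1-2\alpha x_2\partial_2-2(1+\alpha)x_4\partial_4)\partial_3+x_4\partial_1\partial_2 .$$ Let $u_1,\dots,u_4$ be the basis $e_1,e_2,\xi,\eta$ of $D_\alpha$. Define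 $\pi_\lambda(u_i)=-2i\,x_i$ for $u_i\in D_\alpha^-$; $\pi_\lambda(u_i)=-\tfrac i2\mathcal B_\lambda(x_i)$ for $u_i\in D_\alpha^+$; and, for $T\in\mathfrak{str}(D_\alpha)$, $\pi_\lambda(T)=\lambda(T)+\sum_{i,j}T^-_{ij}x_i\partial_j$, where $T^-$ is the matrix of the action of $T$ on $D_\alpha^-$ and $\lambda(\cdot)$ is the linear form with $\lambda(2L_{e_1})=\lambda$, $\lambda(2L_{e_2})=\lambda/\alpha$ that vanishes on $L_\xi,L_\eta$ and on derivations. Let $\mathcal I_\lambda$ be the ideal generated by $2x_1x_2+x_3x_4,\ x_2^2,\ x_2x_3,\ x_2x_4$ if $\lambda=\alpha$, and by $2\alpha x_1x_2+x_3x_4,\ x_1^2,\ x_1x_3,\ x_1x_4$ if $\lambda=1$ (in the superpolynomials or in the smooth superfunctions, according to the context); it is invariant under $\pi_\lambda$. *Schrödinger model:* $W_\lambda=\mathcal P(\mathbb R^{2|2})\,e^{-2(x_1+x_2)}\bmod\mathcal I_\lambda$, a subspace of the complex-valued smooth superfunctions on $\mathbb R^{2|2}$ modulo $\mathcal I_\lambda$,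 with the action $\pi_\lambda$. *Fock model:* $F_\lambda=U(\mathfrak g)\,1\bmod\mathcal I_\lambda\subseteq\mathcal P(\mathbb C^{2|2})/\mathcal I_\lambda$, with the action $\rho_\lambda=\pi_\lambda\circ c$. **The Segal–Bargmann transform.** For superpolynomials let $\langle p,q\rangle_{\mathcal B}=p(\mathcal B_\lambda)\bar q\,|_{0}$, where $p(\mathcal B_\lambda)$ is obtained by replacing the coordinates by the Bessel operators and $\bar q$ by conjugating the coefficients; it is extended to a second argument that depends on a further variable. Put $z|w=z_1w_1+\alpha z_2w_2-\tfrac12z_3w_4+\tfrac12z_4w_3$, and $$\mathbb I_\lambda(z,w)=\sum_{k\ge0}\frac{\Gamma(-\mu)}{k!\,\Gamma(k-\mu)}\,\bigl(\beta\,(z|\overline w)\bigr)^k,$$ with $(\mu,\beta)=(\alpha,1)$ if $\lambda=\alpha$ and $(\mu,\beta)=(\alpha^{-1},\alpha^{-1})$ if $\lambda=1$. For $f\in\mathcal P(\mathbb R^{2|2})e^{-2(x_1+x_2)}$ put $$\pi_\lambda(C)f=e^{x_1+x_2}\exp\bigl(\tfrac12(\mathcal B_\lambda(x_1)+\mathcal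 B_\lambda(x_2))\bigr)f,$$ where the exponential is the pointwise limit as $t\uparrow\tfrac12$ of the sum of the series $\sum_k\frac{t^k}{k!}(\mathcal B_\lambda(x_1)+\mathcal B_\lambda(x_2))^kf$, which converges for $0<t<\tfrac12$. Finally put $$(\mathrm{SB}\,f)(z)=\langle(\pi_\lambda(C)f)(x),\mathbb I_\lambda(x,z)\rangle_{\mathcal B}\bmod\mathcal I_\lambda ,$$ the product being taken in the variable $x$ and termwise in $k$. **Theorem.** For every $f\in\mathcal P(\mathbb R^{2|2})e^{-2(x_1+x_2)}$ the superfunction $\pi_\lambda(C)f$ is defined and is a superpolynomial. The class $\mathrm{SB}\,f$ depends only on the class of $f$ in $W_\lambda$ and lies in $F_\lambda$. The resulting linear map $\mathrm{SB}:W_\lambda\to F_\lambda$ satisfies $$\mathrm{SB}\circ\pi_\lambda(X)=\rho_\lambda(X)\circ\mathrm{SB}\qquad\text{for all }X\in\mathfrak g,$$ and it is bijective and preserves parity; thus it is an isomorphism of $\mathfrak g$-modules from $W_\lambda$ onto $F_\lambda$. -/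

import Mathlib

open Filter Topology

noncomputable section

namespace D21

/-! ### Superfunctions -/

/-- Superfunctions with even part in a commutative algebra `R` and odd coordinates
`θ 0, …, θ (n - 1)`, that is `R ⊗ Λ(θ)`. The function `f` stands for
`∑ S, f S * θ_S`, where `θ_S` is the product of the `θ i`, `i ∈ S`, in increasing order. -/
abbrev SF (R : Type) (n : ℕ) : Type := Finset (Fin n) → R

section Operators

variable {R : Type} [CommRing R] [Algebra ℂ R] {n : ℕ}

/-- An operator on the even part, acting on all components. -/
def evenOp (T : R →ₗ[ℂ] R) : Module.End ℂ (SF R n) where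
  toFun f S := T (f S)
  map_add' f g := by funext S; simp
  map_smul' c f := by funext S; simp

/-- The sign that arises when `θ i` moves past the factors `θ j` of `θ_S` with `j < i`. -/
def thetaSign (i : Fin n) (S : Finset (Fin n)) : ℂ := (-1) ^ (S.filter (· < i)).card

/-- Left multiplication by the odd coordinate `θ i`. -/
def thetaMul (i : Fin n) : Module.End ℂ (SF R n) where
  toFun f S := if i ∈ S then thetaSign i S • f (S.erase i) else 0
  map_add' f g := by funext S; by_cases h : i ∈ S <;> simp [h]
  map_smul' c f := by
    funext S
    by_cases h : i ∈ S
    · simp only [Pi.smul_apply, if_pos h, RingHom.id_apply, smul_comm c]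
    · simp [h]

/-- The left derivative with respect to the odd coordinate `θ i`. -/
def thetaDer (i : Fin n) : Module.End ℂ (SF R n) where
  toFun f S := if i ∈ S then 0 else thetaSign i S • f (insert i S)
  map_add' f g := by funext S; by_cases h : i ∈ S <;> simp [h]
  map_smul' c f := by
    funext S
    by_cases h : i ∈ S
    · simp [h]
    · simp only [Pi.smul_apply, if_neg h, RingHom.id_apply, smul_comm c]

end Operators

/-- A `2|2`-block of coordinates on a space of superfunctions: the operators of multiplication by
the coordinates `x₁, x₂` (even), `x₃, x₄` (odd), here indexed by `0, 1, 2, 3`, and the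
corresponding partial derivatives. -/
structure Coords (A : Type) [AddCommGroup A] [Module ℂ A] where
  x : Fin 4 → Module.End ℂ A
  d : Fin 4 → Module.End ℂ A

/-- The block with even coordinates `X 0, X 1 ∈ R`, even derivations `D 0, D 1` and odd
coordinates `θ (o 0), θ (o 1)`. -/
def sfCoords {R : Type} [CommRing R] [Algebra ℂ R] {n : ℕ} (X : Fin 2 → R)
    (D : Fin 2 → Derivation ℂ R R) (o : Fin 2 → Fin n) : Coords (SF R n) where
  x := ![evenOp (LinearMap.mulLeft ℂ (X 0)), evenOp (LinearMap.mulLeft ℂ (X 1)),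
    thetaMul (o 0), thetaMul (o 1)]
  d := ![evenOp (D 0).toLinearMap, evenOp (D 1).toLinearMap, thetaDer (o 0), thetaDer (o 1)]

/-- The superpolynomials `P(ℂ^{m|n})`. -/
abbrev Poly (m n : ℕ) : Type := SF (MvPolynomial (Fin m) ℂ) n

/-- The algebra of smooth complex-valued functions on `ℝ²`. -/
def smoothAlg : Subalgebra ℂ ((Fin 2 → ℝ) → ℂ) where
  carrier := {f | ContDiff ℝ (⊤ : ℕ∞) f}
  mul_mem' {f g} hf hg := by
    have hf' : ContDiff ℝ (⊤ : ℕ∞) f := hf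
    have hg' : ContDiff ℝ (⊤ : ℕ∞) g := hg
    exact hf'.mul hg'
  add_mem' {f g} hf hg := by
    have hf' : ContDiff ℝ (⊤ : ℕ∞) f := hf
    have hg' : ContDiff ℝ (⊤ : ℕ∞) g := hg
    exact hf'.add hg'
  algebraMap_mem' c := by
    have h : ContDiff ℝ (⊤ : ℕ∞) (fun _ : Fin 2 → ℝ => c) := contDiff_const
    exact h

/-- The smooth superfunctions on `ℝ^{2|2}`. -/
abbrev Smooth : Type := SF smoothAlg 2

/-- The coordinate functions on `ℝ²`. -/
def smoothX (i : Fin 2) : smoothAlg :=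
  ⟨fun x => ((x i : ℝ) : ℂ), by
    have h : ContDiff ℝ (⊤ : ℕ∞) (fun x : Fin 2 → ℝ => ((x i : ℝ) : ℂ)) :=
      Complex.ofRealCLM.contDiff.comp (contDiff_apply ℝ ℝ i)
    exact h⟩

/-- The partial derivatives on smooth functions on `ℝ²`. -/
def smoothD (i : Fin 2) : Derivation ℂ smoothAlg smoothAlg :=
  Derivation.mk'
    { toFun := fun f => ⟨fun x => fderiv ℝ (f : (Fin 2 → ℝ) → ℂ) x (Pi.single i 1), by
        have hf : ContDiff ℝ (⊤ : ℕ∞) (f : (Fin 2 → ℝ) → ℂ) := f.2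
        have h : ContDiff ℝ (⊤ : ℕ∞)
            (fun x => fderiv ℝ (f : (Fin 2 → ℝ) → ℂ) x (Pi.single i 1)) :=
          (hf.fderiv_right (m := (⊤ : ℕ∞)) (by simp)).clm_apply contDiff_const
        exact h⟩
      map_add' := fun f g => by
        have hf : ContDiff ℝ (⊤ : ℕ∞) (f : (Fin 2 → ℝ) → ℂ) := f.2
        have hg : ContDiff ℝ (⊤ : ℕ∞) (g : (Fin 2 → ℝ) → ℂ) := g.2
        ext x
        have h := fderiv_add (hf.differentiable (by simp) x) (hg.differentiable (by simp) x)
        simp [h]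
      map_smul' := fun c f => by
        have hf : ContDiff ℝ (⊤ : ℕ∞) (f : (Fin 2 → ℝ) → ℂ) := f.2
        ext x
        have h := fderiv_const_smul (hf.differentiable (by simp) x) c
        simp [h] }
    (fun f g => by
      have hf : ContDiff ℝ (⊤ : ℕ∞) (f : (Fin 2 → ℝ) → ℂ) := f.2
      have hg : ContDiff ℝ (⊤ : ℕ∞) (g : (Fin 2 → ℝ) → ℂ) := g.2
      ext x
      have h := fderiv_mul (hf.differentiable (by simp) x) (hg.differentiable (by simp) x)
      simp [h])

/-- The coordinates on `P(ℂ^{2|2})`. -/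
def polyCoords : Coords (Poly 2 2) := sfCoords MvPolynomial.X MvPolynomial.pderiv id

/-- The coordinates on the smooth superfunctions on `ℝ^{2|2}`. -/
def smoothCoords : Coords Smooth := sfCoords smoothX smoothD id

/-- The first block `x` of coordinates on `P(ℂ^{4|4})`, the superpolynomials in `(x, z)`. -/
def jointX : Coords (Poly 4 4) :=
  sfCoords (fun i => MvPolynomial.X (Fin.castAdd 2 i))
    (fun i => MvPolynomial.pderiv (Fin.castAdd 2 i)) (Fin.castAdd 2)

/-- The second block `z` of coordinates on `P(ℂ^{4|4})`. -/
def jointZ : Coords (Poly 4 4) :=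
  sfCoords (fun i => MvPolynomial.X (Fin.natAdd 2 i))
    (fun i => MvPolynomial.pderiv (Fin.natAdd 2 i)) (Fin.natAdd 2)

/-! ### The Jordan superalgebra and its TKK algebra -/

/-- The underlying space of the (complexified) Jordan superalgebra `D_α`; the basis
`e₁, e₂ | ξ, η` has the indices `0, 1 | 2, 3`. -/
abbrev Jor : Type := Fin 4 → ℂ

/-- The product of `D_α`: `eᵢ eᵢ = eᵢ`, `e₁ e₂ = 0`, `eᵢ ξ = ξ / 2`, `eᵢ η = η / 2`,
`ξ η = e₁ + α e₂`, extended supercommutatively. -/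
def jmul (α : ℝ) : Jor →ₗ[ℂ] Jor →ₗ[ℂ] Jor :=
  LinearMap.mk₂ ℂ
    (fun a b => ![a 0 * b 0 + (a 2 * b 3 - a 3 * b 2),
      a 1 * b 1 + α * (a 2 * b 3 - a 3 * b 2),
      ((a 0 + a 1) * b 2 + a 2 * (b 0 + b 1)) / 2,
      ((a 0 + a 1) * b 3 + a 3 * (b 0 + b 1)) / 2])
    (fun a a' b => by ext i; fin_cases i <;> simp <;> ring)
    (fun c a b => by ext i; fin_cases i <;> simp <;> ring)
    (fun a b b' => by ext i; fin_cases i <;> simp <;> ring)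
    (fun c a b => by ext i; fin_cases i <;> simp <;> ring)

/-- The unit `e₁ + e₂` of `D_α`. -/
def jone : Jor := ![1, 1, 0, 0]

/-- The parity involution of `D_α`. -/
def jpar : Jor →ₗ[ℂ] Jor := Matrix.toLin' (Matrix.diagonal ![1, 1, -1, -1])

/-- The even superderivations of `D_α`. -/
def derEven (α : ℝ) : Submodule ℂ (Module.End ℂ Jor) where
  carrier := {D | (∀ a, jpar (D (jpar a)) = D a) ∧
    ∀ a b, D (jmul α a b) = jmul α (D a) b + jmul α a (D b)}
  add_mem' h h' := ⟨fun a => by simp [h.1 a, h'.1 a], fun a b => by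
    simp [h.2 a b, h'.2 a b]; abel⟩
  zero_mem' := by simp
  smul_mem' c D h := ⟨fun a => by simp [h.1 a], fun a b => by simp [h.2 a b]⟩

/-- The odd superderivations of `D_α`: `D(ab) = D(a) b + (-1)^{|a|} a D(b)`. -/
def derOdd (α : ℝ) : Submodule ℂ (Module.End ℂ Jor) where
  carrier := {D | (∀ a, jpar (D (jpar a)) = -D a) ∧
    ∀ a b, D (jmul α a b) = jmul α (D a) b + jmul α (jpar a) (D b)}
  add_mem' h h' := ⟨fun a => by simp [h.1 a, h'.1 a]; abel, fun a b => by
    simp [h.2 a b, h'.2 a b]; abel⟩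
  zero_mem' := by simp
  smul_mem' c D h := ⟨fun a => by simp [h.1 a], fun a b => by simp [h.2 a b]⟩

/-- The structure algebra `str(D_α) = {L_a} ⊕ Der(D_α)`. -/
def str (α : ℝ) : Submodule ℂ (Module.End ℂ Jor) :=
  LinearMap.range (jmul α) ⊔ (derEven α ⊔ derOdd α)

/-- Triples `(u, T, x)` with `u ∈ D_α⁻`, `T ∈ End(D_α)`, `x ∈ D_α⁺`. -/
abbrev Triple : Type := Jor × Module.End ℂ Jor × Jor

/-- The space of the Lie superalgebra `𝔤 = D_α⁻ ⊕ str(D_α) ⊕ D_α⁺`, complexified. -/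
def tkk (α : ℝ) : Submodule ℂ Triple :=
  (⊤ : Submodule ℂ Jor).prod ((str α).prod ⊤)

/-- The action of `T = L_a + I` in `str(D_α)` on `D_α⁻`, namely `-L_a + I`; here `a = T(1)`. -/
def lowerAct (α : ℝ) (T : Module.End ℂ Jor) : Module.End ℂ Jor :=
  T - (2 : ℂ) • jmul α (T jone)

/-- The bracket on homogeneous elements `X`, `Y`, with `s = (-1)^{|X||Y|}`. -/
def bracketAux (α : ℝ) (s : ℂ) (X Y : Triple) : Triple :=
  let L := jmul α
  ⟨lowerAct α X.2.1 Y.1 - s • lowerAct α Y.2.1 X.1,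
    (X.2.1 * Y.2.1 - s • (Y.2.1 * X.2.1))
      + (2 : ℂ) • (L (L X.2.2 Y.1) + (L X.2.2 * L Y.1 - s • (L Y.1 * L X.2.2)))
      - (2 * s) • (L (L Y.2.2 X.1) + (L Y.2.2 * L X.1 - s • (L X.1 * L Y.2.2))),
    X.2.1 Y.2.2 - s • Y.2.1 X.2.2⟩

/-- The parity involution on triples. -/
def tpar (X : Triple) : Triple := ⟨jpar X.1, jpar * X.2.1 * jpar, jpar X.2.2⟩

/-- The even part of a triple. -/
def evenPart (X : Triple) : Triple := (2⁻¹ : ℂ) • (X + tpar X)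
/-- The odd part of a triple. -/
def oddPart (X : Triple) : Triple := (2⁻¹ : ℂ) • (X - tpar X)

/-- The Lie superbracket of the TKK algebra. -/
def bracket (α : ℝ) (X Y : Triple) : Triple :=
  bracketAux α 1 (evenPart X) (evenPart Y) + bracketAux α 1 (evenPart X) (oddPart Y)
    + bracketAux α 1 (oddPart X) (evenPart Y) + bracketAux α (-1) (oddPart X) (oddPart Y)

/-- The element `e = e₁ + e₂` of `D_α⁺`. -/
def eElt : Triple := ⟨0, 0, jone⟩
/-- The element `f = f₁ + f₂` of `D_α⁻`. -/
def fElt : Triple := ⟨jone, 0, 0⟩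

/-- `exp (t ad Z)` for `Z` in `D_α⁻` or `D_α⁺`, where `(ad Z)³ = 0`. -/
def expAd (α : ℝ) (t : ℂ) (Z X : Triple) : Triple :=
  ∑ k ∈ Finset.range 3, (t ^ k / (k.factorial : ℂ)) • (bracket α Z)^[k] X

/-- The Cayley transform `c = exp (i/2 ad f) exp (i ad e)`. -/
def cayley (α : ℝ) (X : Triple) : Triple :=
  expAd α (Complex.I / 2) fElt (expAd α Complex.I eElt X)

/-! ### The polynomial realisation -/

section Realisation

variable {A : Type} [AddCommGroup A] [Module ℂ A]

/-- The Bessel operators `B_λ(x₁), …, B_λ(x₄)`. -/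
def bessel (c : Coords A) (α lam : ℝ) : Fin 4 → Module.End ℂ A :=
  let x := c.x
  let d := c.d
  let a : ℂ := α
  let l : ℂ := lam
  ![(-l • 1 + x 0 * d 0 + x 2 * d 2 + x 3 * d 3) * d 0 - (2 * a) • (x 1 * d 2 * d 3),
    (-(l / a) • 1 + x 1 * d 1 + x 2 * d 2 + x 3 * d 3) * d 1 - (2 : ℂ) • (x 0 * d 2 * d 3),
    (-(2 * l) • 1 + (2 : ℂ) • (x 0 * d 0) + (2 * a) • (x 1 * d 1)
      + (2 * (1 + a)) • (x 2 * d 2)) * d 3 + x 2 * d 0 * d 1,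
    ((2 * l) • 1 - (2 : ℂ) • (x 0 * d 0) - (2 * a) • (x 1 * d 1)
      - (2 * (1 + a)) • (x 3 * d 3)) * d 2 + x 3 * d 0 * d 1]

/-- The character of `str(D_α)` with `2 L_{e₁} ↦ λ`, `2 L_{e₂} ↦ λ / α`, which vanishes on
`L_ξ`, `L_η` and on derivations. -/
def character (α lam : ℝ) (T : Module.End ℂ Jor) : ℂ :=
  (T jone 0 * lam + T jone 1 * (lam / α)) / 2

/-- The operator `π_λ(u, T, x)`: multiplication by `-2i u` for `u ∈ D_α⁻`, the operator
`λ(T) + ∑ⱼ [T, fⱼ] ∂ⱼ` for `T ∈ str(D_α)`, and `-(i/2) B_λ(x)` for `x ∈ D_α⁺`. -/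
def schrPi (c : Coords A) (α lam : ℝ) (X : Triple) : Module.End ℂ A :=
  (∑ i, (-2 * Complex.I * X.1 i) • c.x i)
    + (character α lam X.2.1 • 1
      + ∑ j, ∑ i, (lowerAct α X.2.1 (Pi.single j 1) i) • (c.x i * c.d j))
    + ∑ i, (-(Complex.I / 2) * X.2.2 i) • bessel c α lam i

open Classical in
/-- The left multiplications by the generators of `V_λ`: these are `2 x₁ x₂ + x₃ x₄`, `x₂²`,
`x₂ x₃`, `x₂ x₄` for `λ = α`, and `2 α x₁ x₂ + x₃ x₄`, `x₁²`, `x₁ x₃`, `x₁ x₄` for `λ = 1`. -/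
def vGen (c : Coords A) (α lam : ℝ) : Fin 4 → Module.End ℂ A :=
  if lam = α then
    ![(2 : ℂ) • (c.x 0 * c.x 1) + c.x 2 * c.x 3, c.x 1 * c.x 1, c.x 1 * c.x 2, c.x 1 * c.x 3]
  else
    ![(2 * (α : ℂ)) • (c.x 0 * c.x 1) + c.x 2 * c.x 3, c.x 0 * c.x 0, c.x 0 * c.x 2,
      c.x 0 * c.x 3]

/-- The ideal `I_λ` generated by `V_λ`, that is the sum of the ideals of multiples of the four
generators. -/
def idealI (c : Coords A) (α lam : ℝ) : Submodule ℂ A := ⨆ j, LinearMap.range (vGen c α lam j)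

end Realisation

set_option linter.unusedSimpArgs false
set_option linter.unusedSectionVars false
set_option linter.unnecessarySeqFocus false

/-! ### Invariance of the ideal `I_λ` -/

section Invariance

variable {R : Type} [CommRing R] [Algebra ℂ R]

lemma two_alg : algebraMap ℂ R 2 = 2 := map_ofNat _ 2

lemma der_two (E : Derivation ℂ R R) : E 2 = 0 := by
  rw [← two_alg (R := R)]; exact E.map_algebraMap 2

lemma finset_cases (S : Finset (Fin 2)) : S = ∅ ∨ S = {0} ∨ S = {1} ∨ S = {0, 1} := by
  revert S; decide

lemma sf_ext {f g : SF R 2} (h : f ∅ = g ∅) (h0 : f {0} = g {0}) (h1 : f {1} = g {1})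
    (h2 : f {0, 1} = g {0, 1}) : f = g := by
  funext S
  rcases finset_cases S with rfl | rfl | rfl | rfl <;> assumption

@[simp] lemma evenOp_apply {n : ℕ} (T : R →ₗ[ℂ] R) (f : SF R n) (S : Finset (Fin n)) :
    evenOp T f S = T (f S) := rfl

variable (f : SF R 2)

@[simp] lemma mul0_a : thetaMul 0 f ∅ = 0 := by simp [thetaMul]
@[simp] lemma mul0_b : thetaMul 0 f {0} = f ∅ := by
  simp [thetaMul, thetaSign, Finset.filter_eq']
@[simp] lemma mul0_c : thetaMul 0 f {1} = 0 := by simp [thetaMul]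
@[simp] lemma mul0_d : thetaMul 0 f {0, 1} = f {1} := by
  have h : ({0, 1} : Finset (Fin 2)).erase 0 = {1} := by decide
  simp [thetaMul, thetaSign, Finset.filter_eq', h]
@[simp] lemma mul1_a : thetaMul 1 f ∅ = 0 := by simp [thetaMul]
@[simp] lemma mul1_b : thetaMul 1 f {0} = 0 := by simp [thetaMul]
@[simp] lemma mul1_c : thetaMul 1 f {1} = f ∅ := by
  simp [thetaMul, thetaSign, Finset.filter_eq']
@[simp] lemma mul1_d : thetaMul 1 f {0, 1} = - f {0} := by
  have h : ({0, 1} : Finset (Fin 2)).erase 1 = {0} := by decide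
  simp [thetaMul, thetaSign, Finset.filter_eq', h]
@[simp] lemma der0_a : thetaDer 0 f ∅ = f {0} := by simp [thetaDer, thetaSign]
@[simp] lemma der0_b : thetaDer 0 f {0} = 0 := by simp [thetaDer]
@[simp] lemma der0_c : thetaDer 0 f {1} = f {0, 1} := by
  simp [thetaDer, thetaSign]
@[simp] lemma der0_d : thetaDer 0 f {0, 1} = 0 := by simp [thetaDer]
@[simp] lemma der1_a : thetaDer 1 f ∅ = f {1} := by simp [thetaDer, thetaSign]
@[simp] lemma der1_b : thetaDer 1 f {0} = - f {0, 1} := by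
  have h : insert 1 ({0} : Finset (Fin 2)) = {0, 1} := by decide
  simp [thetaDer, thetaSign, Finset.filter_eq', h]
@[simp] lemma der1_c : thetaDer 1 f {1} = 0 := by simp [thetaDer]
@[simp] lemma der1_d : thetaDer 1 f {0, 1} = 0 := by simp [thetaDer]

variable {f}

/-- The normal form of the elements of the ideal generated by `2 κ x₁ x₂ + x₃ x₄`, `y²`,
`y x₃`, `y x₄`. -/
def IsNormal (X : Fin 2 → R) (κ y : R) (f : SF R 2) : Prop :=
  ∃ a b c : R, f ∅ = 2 * κ * X 0 * X 1 * f {0, 1} + y * y * c ∧ f {0} = y * a ∧ f {1} = y * b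

lemma IsNormal.add {X : Fin 2 → R} {κ y : R} {f g : SF R 2} (hf : IsNormal X κ y f)
    (hg : IsNormal X κ y g) : IsNormal X κ y (f + g) := by
  obtain ⟨a, b, c, h, h0, h1⟩ := hf
  obtain ⟨a', b', c', h', h0', h1'⟩ := hg
  refine ⟨a + a', b + b', c + c', ?_, ?_, ?_⟩ <;> simp [h, h0, h1, h', h0', h1'] <;> ring

lemma IsNormal.smul {X : Fin 2 → R} {κ y : R} {f : SF R 2} (t : ℂ) (hf : IsNormal X κ y f) :
    IsNormal X κ y (t • f) := by
  obtain ⟨a, b, c, h, h0, h1⟩ := hf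
  refine ⟨t • a, t • b, t • c, ?_, ?_, ?_⟩ <;> simp [h, h0, h1, Algebra.smul_def, two_alg] <;> ring

/-- The submodule of elements in normal form. -/
def normalSub (X : Fin 2 → R) (κ y : R) : Submodule ℂ (SF R 2) where
  carrier := {f | IsNormal X κ y f}
  add_mem' h h' := h.add h'
  zero_mem' := ⟨0, 0, 0, by simp, by simp, by simp⟩
  smul_mem' t _ h := h.smul t

variable (X : Fin 2 → R) (D : Fin 2 → Derivation ℂ R R)

lemma idealI_alpha (α : ℝ) : idealI (sfCoords X D (id : Fin 2 → Fin 2)) α α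
    = normalSub X 1 (X 1) := by
  apply le_antisymm
  · refine iSup_le fun j => ?_
    rintro _ ⟨g, rfl⟩
    fin_cases j
    · refine ⟨2 * X 0 * g {0}, 2 * X 0 * g {1}, - 4 * X 0 * X 0 * g {0, 1}, ?_, ?_, ?_⟩ <;>
        simp [vGen, sfCoords, Algebra.smul_def, two_alg] <;> ring
    · refine ⟨X 1 * g {0}, X 1 * g {1}, g ∅ - 2 * X 0 * X 1 * g {0, 1}, ?_, ?_, ?_⟩ <;>
        simp [vGen, sfCoords, Algebra.smul_def, two_alg] <;> ring
    · refine ⟨g ∅, 0, - 2 * X 0 * g {1}, ?_, ?_, ?_⟩ <;>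
        simp [vGen, sfCoords, Algebra.smul_def, two_alg] <;> ring
    · refine ⟨0, g ∅, 2 * X 0 * g {0}, ?_, ?_, ?_⟩ <;>
        simp [vGen, sfCoords, Algebra.smul_def, two_alg] <;> ring
  · rintro f ⟨a, b, c, h, h0, h1⟩
    have key : f = vGen (sfCoords X D (id : Fin 2 → Fin 2)) α α 0 (Pi.single ∅ (f {0, 1}))
        + vGen (sfCoords X D (id : Fin 2 → Fin 2)) α α 1 (Pi.single ∅ c)
        + vGen (sfCoords X D (id : Fin 2 → Fin 2)) α α 2 (Pi.single ∅ a)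
        + vGen (sfCoords X D (id : Fin 2 → Fin 2)) α α 3 (Pi.single ∅ b) := by
      apply sf_ext <;> simp [vGen, sfCoords, Algebra.smul_def, two_alg, h, h0, h1] <;> ring
    rw [key]
    have hm : ∀ j g, vGen (sfCoords X D (id : Fin 2 → Fin 2)) α α j g ∈
        idealI (sfCoords X D (id : Fin 2 → Fin 2)) α α := fun j g =>
      Submodule.mem_iSup_of_mem j ⟨g, rfl⟩
    exact add_mem (add_mem (add_mem (hm _ _) (hm _ _)) (hm _ _)) (hm _ _)

lemma idealI_one {α : ℝ} (hα : (1 : ℝ) ≠ α) :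
    idealI (sfCoords X D (id : Fin 2 → Fin 2)) α 1
      = normalSub X (algebraMap ℂ R α) (X 0) := by
  apply le_antisymm
  · refine iSup_le fun j => ?_
    rintro _ ⟨g, rfl⟩
    fin_cases j
    · refine ⟨2 * algebraMap ℂ R α * X 1 * g {0}, 2 * algebraMap ℂ R α * X 1 * g {1},
        - 4 * algebraMap ℂ R α * algebraMap ℂ R α * X 1 * X 1 * g {0, 1}, ?_, ?_, ?_⟩ <;>
        simp [vGen, sfCoords, Algebra.smul_def, two_alg, hα] <;> ring
    · refine ⟨X 0 * g {0}, X 0 * g {1}, g ∅ - 2 * algebraMap ℂ R α * X 0 * X 1 * g {0, 1},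
        ?_, ?_, ?_⟩ <;> simp [vGen, sfCoords, Algebra.smul_def, two_alg, hα] <;> ring
    · refine ⟨g ∅, 0, - 2 * algebraMap ℂ R α * X 1 * g {1}, ?_, ?_, ?_⟩ <;>
        simp [vGen, sfCoords, Algebra.smul_def, two_alg, hα] <;> ring
    · refine ⟨0, g ∅, 2 * algebraMap ℂ R α * X 1 * g {0}, ?_, ?_, ?_⟩ <;>
        simp [vGen, sfCoords, Algebra.smul_def, two_alg, hα] <;> ring
  · rintro f ⟨a, b, c, h, h0, h1⟩
    have key : f = vGen (sfCoords X D (id : Fin 2 → Fin 2)) α 1 0 (Pi.single ∅ (f {0, 1}))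
        + vGen (sfCoords X D (id : Fin 2 → Fin 2)) α 1 1 (Pi.single ∅ c)
        + vGen (sfCoords X D (id : Fin 2 → Fin 2)) α 1 2 (Pi.single ∅ a)
        + vGen (sfCoords X D (id : Fin 2 → Fin 2)) α 1 3 (Pi.single ∅ b) := by
      apply sf_ext <;> simp [vGen, sfCoords, Algebra.smul_def, two_alg, h, h0, h1, hα] <;> ring
    rw [key]
    have hm : ∀ j g, vGen (sfCoords X D (id : Fin 2 → Fin 2)) α 1 j g ∈
        idealI (sfCoords X D (id : Fin 2 → Fin 2)) α 1 := fun j g =>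
      Submodule.mem_iSup_of_mem j ⟨g, rfl⟩
    exact add_mem (add_mem (add_mem (hm _ _) (hm _ _)) (hm _ _)) (hm _ _)


variable {X D}

/-- The operator `∑ Mᵢⱼ xᵢ ∂ⱼ`. -/
def vectorField {A : Type} [AddCommGroup A] [Module ℂ A] (c : Coords A)
    (M : Fin 4 → Fin 4 → ℂ) : Module.End ℂ A :=
  ∑ j, ∑ i, M i j • (c.x i * c.d j)

/-- The form of the matrices by which `str(D_α)` acts on `D_α⁻`. -/
def strMatrix (α : ℝ) (a : Fin 4 → ℂ) (p q r s t : ℂ) : Fin 4 → Fin 4 → ℂ :=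
  ![![-a 0, 0, a 3 + 2 * q, -a 2 - 2 * p],
    ![0, -a 1, α * a 3 - 2 * α * q, -(α * a 2) + 2 * α * p],
    ![-(a 2 / 2) + p, -(a 2 / 2) - p, -((a 0 + a 1) / 2) + r, t],
    ![-(a 3 / 2) + q, -(a 3 / 2) - q, s, -((a 0 + a 1) / 2) - r]]

set_option maxHeartbeats 1000000 in
lemma vectorField_alpha (hX : ∀ i j, D i (X j) = if i = j then 1 else 0)
    {α : ℝ} {a : Fin 4 → ℂ} {p q r s t : ℂ}
    {f : SF R 2} (hf : IsNormal X 1 (X 1) f) : IsNormal X 1 (X 1)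
      (vectorField (sfCoords X D (id : Fin 2 → Fin 2)) (strMatrix α a p q r s t) f) := by
  obtain ⟨u, v, w, h, h0, h1⟩ := hf
  set m := algebraMap ℂ R with hm
  set M := strMatrix α a p q r s t with hM
  have r1 : m (M 0 2) + 2 * m (M 3 1) = 0 := by
    have e : M 0 2 + 2 * M 3 1 = 0 := by rw [hM]; simp [strMatrix]; ring
    rw [← two_alg (R := R), ← map_mul, ← map_add, e, map_zero]
  have r2 : m (M 0 3) - 2 * m (M 2 1) = 0 := by
    have e : M 0 3 - 2 * M 2 1 = 0 := by rw [hM]; simp [strMatrix]; ring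
    rw [← two_alg (R := R), ← map_mul, ← map_sub, e, map_zero]
  have r3 : m (M 2 2) + m (M 3 3) = m (M 0 0) + m (M 1 1) := by
    rw [← map_add, ← map_add, hM]; simp only [strMatrix]; congr 1; simp; ring
  have r4 : m (M 0 1) = 0 := by simp [hM, strMatrix]
  have r5 : m (M 1 0) = 0 := by simp [hM, strMatrix]
  clear_value M
  refine ⟨m (M 0 0) * X 0 * D 0 u + m (M 1 1) * (u + X 1 * D 1 u) + m (M 2 2) * u
      + m (M 2 3) * v + m (M 2 0) * (2 * f {0, 1} + 2 * X 0 * D 0 (f {0, 1}) + X 1 * D 0 w)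
      + m (M 2 1) * (2 * X 0 * D 1 (f {0, 1}) + 2 * w + X 1 * D 1 w) - m (M 1 3) * f {0, 1},
    m (M 0 0) * X 0 * D 0 v + m (M 1 1) * (v + X 1 * D 1 v) + m (M 3 3) * v
      + m (M 3 2) * u + m (M 3 0) * (2 * f {0, 1} + 2 * X 0 * D 0 (f {0, 1}) + X 1 * D 0 w)
      + m (M 3 1) * (2 * X 0 * D 1 (f {0, 1}) + 2 * w + X 1 * D 1 w) + m (M 1 2) * f {0, 1},
    m (M 0 0) * X 0 * D 0 w + m (M 1 1) * (2 * w + X 1 * D 1 w) + m (M 1 2) * u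
      + m (M 1 3) * v - 2 * X 0 * (m (M 2 0) * D 0 v + m (M 2 1) * D 1 v - m (M 3 0) * D 0 u
        - m (M 3 1) * D 1 u), ?_, ?_, ?_⟩
  · simp [vectorField, sfCoords, Algebra.smul_def, ← hm, Fin.sum_univ_four, h, h0, h1, hX, der_two, r4, r5]
    linear_combination (X 0 * X 1 * u) * r1 + (X 0 * X 1 * v) * r2
      - (2 * X 0 * X 1 * f {0, 1}) * r3
  · simp [vectorField, sfCoords, Algebra.smul_def, ← hm, Fin.sum_univ_four, h, h0, h1, hX, der_two, r4, r5]
    linear_combination - (X 0 * f {0, 1}) * r2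
  · simp [vectorField, sfCoords, Algebra.smul_def, ← hm, Fin.sum_univ_four, h, h0, h1, hX, der_two, r4, r5]
    linear_combination (X 0 * f {0, 1}) * r1

set_option maxHeartbeats 1000000 in
lemma vectorField_one (hX : ∀ i j, D i (X j) = if i = j then 1 else 0)
    {α : ℝ} {a : Fin 4 → ℂ} {p q r s t : ℂ}
    {f : SF R 2} (hf : IsNormal X (algebraMap ℂ R α) (X 0) f) :
    IsNormal X (algebraMap ℂ R α) (X 0)
      (vectorField (sfCoords X D (id : Fin 2 → Fin 2)) (strMatrix α a p q r s t) f) := by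
  obtain ⟨u, v, w, h, h0, h1⟩ := hf
  set m := algebraMap ℂ R with hm
  set M := strMatrix α a p q r s t with hM
  set k := m (α : ℂ) with hk
  have r1 : m (M 1 2) + 2 * k * m (M 3 0) = 0 := by
    have e : M 1 2 + 2 * α * M 3 0 = 0 := by rw [hM]; simp [strMatrix]; ring
    rw [← two_alg (R := R), hk, ← map_mul, ← map_mul, ← map_add, e, map_zero]
  have r2 : m (M 1 3) - 2 * k * m (M 2 0) = 0 := by
    have e : M 1 3 - 2 * α * M 2 0 = 0 := by rw [hM]; simp [strMatrix]; ring
    rw [← two_alg (R := R), hk, ← map_mul, ← map_mul, ← map_sub, e, map_zero]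
  have r3 : m (M 2 2) + m (M 3 3) = m (M 0 0) + m (M 1 1) := by
    rw [← map_add, ← map_add, hM]; simp only [strMatrix]; congr 1; simp; ring
  have r4 : m (M 0 1) = 0 := by simp [hM, strMatrix]
  have r5 : m (M 1 0) = 0 := by simp [hM, strMatrix]
  have hDk : ∀ i, D i k = 0 := fun i => by rw [hk, hm]; simp
  clear_value M k
  refine ⟨m (M 0 0) * (u + X 0 * D 0 u) + m (M 1 1) * X 1 * D 1 u + m (M 2 2) * u
      + m (M 2 3) * v + m (M 2 0) * (2 * k * X 1 * D 0 (f {0, 1}) + 2 * w + X 0 * D 0 w)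
      + m (M 2 1) * (2 * k * f {0, 1} + 2 * k * X 1 * D 1 (f {0, 1}) + X 0 * D 1 w)
      - m (M 0 3) * f {0, 1},
    m (M 0 0) * (v + X 0 * D 0 v) + m (M 1 1) * X 1 * D 1 v + m (M 3 3) * v
      + m (M 3 2) * u + m (M 3 0) * (2 * k * X 1 * D 0 (f {0, 1}) + 2 * w + X 0 * D 0 w)
      + m (M 3 1) * (2 * k * f {0, 1} + 2 * k * X 1 * D 1 (f {0, 1}) + X 0 * D 1 w)
      + m (M 0 2) * f {0, 1},
    m (M 0 0) * (2 * w + X 0 * D 0 w) + m (M 1 1) * X 1 * D 1 w + m (M 0 2) * u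
      + m (M 0 3) * v - 2 * k * X 1 * (m (M 2 0) * D 0 v + m (M 2 1) * D 1 v - m (M 3 0) * D 0 u
        - m (M 3 1) * D 1 u), ?_, ?_, ?_⟩
  · simp [vectorField, sfCoords, Algebra.smul_def, ← hm, Fin.sum_univ_four, h, h0, h1, hX, der_two, r4, r5,
      hDk]
    linear_combination (X 0 * X 1 * u) * r1 + (X 0 * X 1 * v) * r2
      - (2 * k * X 0 * X 1 * f {0, 1}) * r3
  · simp [vectorField, sfCoords, Algebra.smul_def, ← hm, Fin.sum_univ_four, h, h0, h1, hX, der_two, r4, r5,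
      hDk]
    linear_combination - (X 1 * f {0, 1}) * r2
  · simp [vectorField, sfCoords, Algebra.smul_def, ← hm, Fin.sum_univ_four, h, h0, h1, hX, der_two, r4, r5,
      hDk]
    linear_combination (X 1 * f {0, 1}) * r1

lemma bessel_alpha (hX : ∀ i j, D i (X j) = if i = j then 1 else 0)
    {α : ℝ} (hα : α ≠ 0) {f : SF R 2} (hf : IsNormal X 1 (X 1) f) (i : Fin 4) :
    IsNormal X 1 (X 1) (bessel (sfCoords X D (id : Fin 2 → Fin 2)) α α i f) := by
  obtain ⟨u, v, w, h, h0, h1⟩ := hf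
  have hα' : (α : ℂ) / α = 1 := div_self (by exact_mod_cast hα)
  set k := algebraMap ℂ R (α : ℂ) with hk
  have hDk : ∀ i, D i k = 0 := fun i => by rw [hk]; simp
  set g := f {0, 1} with hg
  fin_cases i
  · refine ⟨(1 - k) * D 0 u + X 0 * D 0 (D 0 u), (1 - k) * D 0 v + X 0 * D 0 (D 0 v),
      - k * D 0 w + X 0 * D 0 (D 0 w), ?_, ?_, ?_⟩ <;>
    simp [bessel, sfCoords, Algebra.smul_def, two_alg, ← hk, h, h0, h1, hX, der_two, hDk, ← hg] <;> ring
  · refine ⟨2 * D 1 u + X 1 * D 1 (D 1 u), 2 * D 1 v + X 1 * D 1 (D 1 v),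
      3 * D 1 w + X 1 * D 1 (D 1 w), ?_, ?_, ?_⟩ <;>
    simp [bessel, sfCoords, Algebra.smul_def, two_alg, ← hk, h, h0, h1, hX, der_two, hDk, ← hg, hα'] <;>
    ring
  · refine ⟨- 2 * k * D 1 g + 2 * D 1 g + 2 * X 0 * D 0 (D 1 g) + 2 * D 0 w + X 1 * D 0 (D 1 w), 0,
      2 * k * D 1 v - 2 * X 0 * D 0 (D 1 v), ?_, ?_, ?_⟩ <;>
    simp [bessel, sfCoords, Algebra.smul_def, two_alg, ← hk, h, h0, h1, hX, der_two, hDk, ← hg] <;> ring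
  · refine ⟨0, - 2 * k * D 1 g + 2 * D 1 g + 2 * X 0 * D 0 (D 1 g) + 2 * D 0 w + X 1 * D 0 (D 1 w),
      - 2 * k * D 1 u + 2 * X 0 * D 0 (D 1 u), ?_, ?_, ?_⟩ <;>
    simp [bessel, sfCoords, Algebra.smul_def, two_alg, ← hk, h, h0, h1, hX, der_two, hDk, ← hg] <;> ring

lemma bessel_one (hX : ∀ i j, D i (X j) = if i = j then 1 else 0)
    {α : ℝ} (hα : α ≠ 0) {f : SF R 2}
    (hf : IsNormal X (algebraMap ℂ R α) (X 0) f) (i : Fin 4) :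
    IsNormal X (algebraMap ℂ R α) (X 0)
      (bessel (sfCoords X D (id : Fin 2 → Fin 2)) α 1 i f) := by
  obtain ⟨u, v, w, h, h0, h1⟩ := hf
  set k := algebraMap ℂ R (α : ℂ) with hk
  set k' := algebraMap ℂ R ((α : ℂ)⁻¹) with hk'
  have hkk : k * k' = 1 := by
    rw [hk, hk', ← map_mul, mul_inv_cancel₀ (by exact_mod_cast hα), map_one]
  have hDk : ∀ i, D i k = 0 := fun i => by rw [hk]; simp
  set g := f {0, 1} with hg
  clear_value k k'
  fin_cases i
  · refine ⟨2 * D 0 u + X 0 * D 0 (D 0 u), 2 * D 0 v + X 0 * D 0 (D 0 v),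
      3 * D 0 w + X 0 * D 0 (D 0 w), ?_, ?_, ?_⟩ <;>
    simp [bessel, sfCoords, Algebra.smul_def, two_alg, ← hk, ← hk', h, h0, h1, hX, der_two, hDk, ← hg] <;>
    ring
  · refine ⟨(1 - k') * D 1 u + X 1 * D 1 (D 1 u), (1 - k') * D 1 v + X 1 * D 1 (D 1 v),
      - k' * D 1 w + X 1 * D 1 (D 1 w), ?_, ?_, ?_⟩
    · simp [bessel, sfCoords, Algebra.smul_def, two_alg, ← hk, ← hk', h, h0, h1, hX, der_two, hDk, ← hg]
      linear_combination (- 2 * X 0 * g) * hkk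
    · simp [bessel, sfCoords, Algebra.smul_def, two_alg, ← hk, ← hk', h, h0, h1, hX, der_two, hDk, ← hg]
      ring
    · simp [bessel, sfCoords, Algebra.smul_def, two_alg, ← hk, ← hk', h, h0, h1, hX, der_two, hDk, ← hg]
      ring
  · refine ⟨- 2 * D 0 g + 2 * k * D 0 g + 2 * k * X 1 * D 0 (D 1 g) + 2 * D 1 w + X 0 * D 0 (D 1 w),
      0, 2 * D 0 v - 2 * k * X 1 * D 0 (D 1 v), ?_, ?_, ?_⟩ <;>
    simp [bessel, sfCoords, Algebra.smul_def, two_alg, ← hk, h, h0, h1, hX, der_two, hDk, ← hg] <;> ring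
  · refine ⟨0,
      - 2 * D 0 g + 2 * k * D 0 g + 2 * k * X 1 * D 0 (D 1 g) + 2 * D 1 w + X 0 * D 0 (D 1 w),
      - 2 * D 0 u + 2 * k * X 1 * D 0 (D 1 u), ?_, ?_, ?_⟩ <;>
    simp [bessel, sfCoords, Algebra.smul_def, two_alg, ← hk, h, h0, h1, hX, der_two, hDk, ← hg] <;> ring

end Invariance

/-! ### The matrices of the structure algebra -/

section StrMatrix

variable {α : ℝ}

lemma jmul_apply (a b : Jor) : jmul α a b =
    ![a 0 * b 0 + (a 2 * b 3 - a 3 * b 2),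
      a 1 * b 1 + α * (a 2 * b 3 - a 3 * b 2),
      ((a 0 + a 1) * b 2 + a 2 * (b 0 + b 1)) / 2,
      ((a 0 + a 1) * b 3 + a 3 * (b 0 + b 1)) / 2] := rfl

lemma jpar_apply (a : Jor) : jpar a = ![a 0, a 1, -a 2, -a 3] := by
  ext i; fin_cases i <;> simp [jpar, Matrix.mulVec_diagonal]

/-- The basis vectors of `D_α`. -/
abbrev jb (i : Fin 4) : Jor := Pi.single i 1

lemma jone_eq : jone = jb 0 + jb 1 := by
  ext i; fin_cases i <;> simp [jone]

lemma jmul_jone (a : Jor) : jmul α a jone = a := by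
  ext i; fin_cases i <;> simp [jmul_apply, jone] <;> ring

lemma jone_jmul (a : Jor) : jmul α jone a = a := by
  ext i; fin_cases i <;> simp [jmul_apply, jone] <;> ring

lemma derEven_form {D : Module.End ℂ Jor} (h : D ∈ derEven α) :
    D (jb 0) = 0 ∧ D (jb 1) = 0 ∧ (D (jb 2) 0 = 0 ∧ D (jb 2) 1 = 0) ∧
      (D (jb 3) 0 = 0 ∧ D (jb 3) 1 = 0) ∧ D (jb 3) 3 = - D (jb 2) 2 := by
  obtain ⟨hp, hl⟩ := h
  have p0 : jpar (jb 0) = jb 0 := by ext i; fin_cases i <;> simp [jpar_apply]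
  have p1 : jpar (jb 1) = jb 1 := by ext i; fin_cases i <;> simp [jpar_apply]
  have p2 : jpar (jb 2) = - jb 2 := by ext i; fin_cases i <;> simp [jpar_apply]
  have p3 : jpar (jb 3) = - jb 3 := by ext i; fin_cases i <;> simp [jpar_apply]
  have m00 : jmul α (jb 0) (jb 0) = jb 0 := by ext i; fin_cases i <;> simp [jmul_apply]
  have m11 : jmul α (jb 1) (jb 1) = jb 1 := by ext i; fin_cases i <;> simp [jmul_apply]
  have m23 : jmul α (jb 2) (jb 3) = jb 0 + (α : ℂ) • jb 1 := by
    ext i; fin_cases i <;> simp [jmul_apply]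
  have q0 := hp (jb 0)
  have q1 := hp (jb 1)
  have q2 := hp (jb 2)
  have q3 := hp (jb 3)
  rw [p0] at q0
  rw [p1] at q1
  rw [p2, map_neg, map_neg] at q2
  rw [p3, map_neg, map_neg] at q3
  have l0 := hl (jb 0) (jb 0)
  have l1 := hl (jb 1) (jb 1)
  have l2 := hl (jb 2) (jb 3)
  rw [m00] at l0
  rw [m11] at l1
  rw [m23, map_add, map_smul] at l2
  have e0 : D (jb 0) = 0 := by
    have c0 := congrFun l0 0
    have c1 := congrFun l0 1
    have c2 := congrFun q0 2
    have c3 := congrFun q0 3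
    simp [jmul_apply, jpar_apply] at c0 c1 c2 c3
    ext i
    fin_cases i
    · simpa using c0
    · simpa using c1
    · exact self_eq_neg.mp c2.symm
    · exact self_eq_neg.mp c3.symm
  have e1 : D (jb 1) = 0 := by
    have c0 := congrFun l1 0
    have c1 := congrFun l1 1
    have c2 := congrFun q1 2
    have c3 := congrFun q1 3
    simp [jmul_apply, jpar_apply] at c0 c1 c2 c3
    ext i
    fin_cases i
    · simpa using c0
    · simpa using c1
    · exact self_eq_neg.mp c2.symm
    · exact self_eq_neg.mp c3.symm
  rw [e0, e1] at l2
  refine ⟨e0, e1, ⟨?_, ?_⟩, ⟨?_, ?_⟩, ?_⟩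
  · have c := congrFun q2 0
    simp [jpar_apply] at c
    exact self_eq_neg.mp c.symm
  · have c := congrFun q2 1
    simp [jpar_apply] at c
    exact self_eq_neg.mp c.symm
  · have c := congrFun q3 0
    simp [jpar_apply] at c
    exact self_eq_neg.mp c.symm
  · have c := congrFun q3 1
    simp [jpar_apply] at c
    exact self_eq_neg.mp c.symm
  · have c := congrFun l2 0
    simp [jmul_apply] at c
    linear_combination -c

lemma derOdd_form {D : Module.End ℂ Jor} (h : D ∈ derOdd α) :
    (D (jb 0) 0 = 0 ∧ D (jb 0) 1 = 0) ∧ D (jb 1) = - D (jb 0) ∧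
      D (jb 2) = ![2 * D (jb 0) 3, - 2 * α * D (jb 0) 3, 0, 0] ∧
      D (jb 3) = ![- 2 * D (jb 0) 2, 2 * α * D (jb 0) 2, 0, 0] := by
  obtain ⟨hp, hl⟩ := h
  have p0 : jpar (jb 0) = jb 0 := by ext i; fin_cases i <;> simp [jpar_apply]
  have p1 : jpar (jb 1) = jb 1 := by ext i; fin_cases i <;> simp [jpar_apply]
  have p2 : jpar (jb 2) = - jb 2 := by ext i; fin_cases i <;> simp [jpar_apply]
  have p3 : jpar (jb 3) = - jb 3 := by ext i; fin_cases i <;> simp [jpar_apply]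
  have m01 : jmul α (jb 0) (jb 1) = 0 := by ext i; fin_cases i <;> simp [jmul_apply]
  have m02 : jmul α (jb 0) (jb 2) = (2⁻¹ : ℂ) • jb 2 := by
    ext i; fin_cases i <;> simp [jmul_apply]
  have m03 : jmul α (jb 0) (jb 3) = (2⁻¹ : ℂ) • jb 3 := by
    ext i; fin_cases i <;> simp [jmul_apply]
  have q0 := hp (jb 0)
  have q1 := hp (jb 1)
  have q2 := hp (jb 2)
  have q3 := hp (jb 3)
  rw [p0] at q0
  rw [p1] at q1
  rw [p2, map_neg, map_neg] at q2
  rw [p3, map_neg, map_neg] at q3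
  have l1 := hl (jb 0) (jb 1)
  have l2 := hl (jb 0) (jb 2)
  have l3 := hl (jb 0) (jb 3)
  rw [m01, p0, map_zero] at l1
  rw [m02, p0, map_smul] at l2
  rw [m03, p0, map_smul] at l3
  have a0 := congrFun q0 0
  have a1 := congrFun q0 1
  have b0 := congrFun q1 0
  have b1 := congrFun q1 1
  have b2 := congrFun l1 2
  have b3 := congrFun l1 3
  have c0 := congrFun l2 0
  have c1 := congrFun l2 1
  have c2 := congrFun q2 2
  have c3 := congrFun q2 3
  have d0 := congrFun l3 0
  have d1 := congrFun l3 1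
  have d2 := congrFun q3 2
  have d3 := congrFun q3 3
  simp [jmul_apply, jpar_apply] at a0 a1 b0 b1 b2 b3 c0 c1 c2 c3 d0 d1 d2 d3
  have a0' := self_eq_neg.mp a0
  have a1' := self_eq_neg.mp a1
  have b0' := self_eq_neg.mp b0
  have b1' := self_eq_neg.mp b1
  refine ⟨⟨a0', a1'⟩, ?_, ?_, ?_⟩
  · ext i
    fin_cases i
    · simp [a0', b0']
    · simp [a1', b1']
    · simp; linear_combination -2 * b2
    · simp; linear_combination -2 * b3
  · ext i
    fin_cases i
    · simp; linear_combination -2 * c0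
    · simp; linear_combination 2 * c1
    · simp; exact self_eq_neg.mp c2
    · simp; exact self_eq_neg.mp c3
  · ext i
    fin_cases i
    · simp; linear_combination -2 * d0
    · simp; linear_combination 2 * d1
    · simp; exact self_eq_neg.mp d2
    · simp; exact self_eq_neg.mp d3

lemma str_form {T : Module.End ℂ Jor} (h : T ∈ str α) :
    ∃ (a : Fin 4 → ℂ) (p q r s t : ℂ),
      (fun i j => lowerAct α T (Pi.single j 1) i) = strMatrix α a p q r s t := by
  obtain ⟨_, ⟨a, rfl⟩, D, hD, rfl⟩ := Submodule.mem_sup.mp h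
  obtain ⟨D0, h0, D1, h1, rfl⟩ := Submodule.mem_sup.mp hD
  obtain ⟨e0, e1, ⟨e20, e21⟩, ⟨e30, e31⟩, e33⟩ := derEven_form h0
  obtain ⟨⟨o0, o0'⟩, o1, o2, o3⟩ := derOdd_form h1
  have hT : (jmul α a + (D0 + D1)) jone = a := by
    simp only [LinearMap.add_apply, jmul_jone]
    rw [jone_eq, map_add, map_add, e0, e1, o1]
    simp
  obtain ⟨r, s, f2⟩ : ∃ r s : ℂ, D0 (jb 2) = ![0, 0, r, s] :=
    ⟨D0 (jb 2) 2, D0 (jb 2) 3, by ext i; fin_cases i; exacts [e20, e21, rfl, rfl]⟩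
  obtain ⟨t, f3⟩ : ∃ t : ℂ, D0 (jb 3) = ![0, 0, t, -r] :=
    ⟨D0 (jb 3) 2, by
      ext i
      fin_cases i
      exacts [e30, e31, rfl, by rw [f2] at e33; exact e33]⟩
  refine ⟨a, D1 (jb 0) 2, D1 (jb 0) 3, r, s, t, ?_⟩
  have key : ∀ j, lowerAct α (jmul α a + (D0 + D1)) (Pi.single j 1)
      = - jmul α a (jb j) + D0 (jb j) + D1 (jb j) := by
    intro j
    rw [lowerAct, hT]
    simp only [LinearMap.sub_apply, LinearMap.add_apply, LinearMap.smul_apply]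
    module
  funext i j
  rw [key]
  fin_cases j
  · fin_cases i <;> simp [strMatrix, e0, o0, o0', jmul_apply]
  · fin_cases i <;> simp [strMatrix, e1, o1, o0, o0', jmul_apply] <;> ring
  · fin_cases i <;> simp [strMatrix, f2, o2, jmul_apply] <;> ring
  · fin_cases i <;> simp [strMatrix, f3, o3, jmul_apply] <;> ring

lemma jmul_mem_str (a : Jor) : jmul α a ∈ str α :=
  Submodule.mem_sup_left ⟨a, rfl⟩

lemma mem_tkk {X : Triple} : X ∈ tkk α ↔ X.2.1 ∈ str α := by
  simp [tkk, Submodule.mem_prod]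

end StrMatrix

/-! ### Invariant subspaces -/

section Stab

variable {A : Type} [AddCommGroup A] [Module ℂ A]

/-- The algebra of operators that map `N` into itself. -/
def stab (N : Submodule ℂ A) : Subalgebra ℂ (Module.End ℂ A) where
  carrier := {T | ∀ f ∈ N, T f ∈ N}
  mul_mem' hS hT := fun f hf => hS _ (hT f hf)
  add_mem' hS hT := fun f hf => N.add_mem (hS f hf) (hT f hf)
  algebraMap_mem' t := fun f hf => N.smul_mem t hf

lemma schrPi_mem_stab {N : Submodule ℂ A} {c : Coords A} {α lam : ℝ} {X : Triple}
    (hx : ∀ i, c.x i ∈ stab N)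
    (hv : vectorField c (fun i j => lowerAct α X.2.1 (Pi.single j 1) i) ∈ stab N)
    (hb : ∀ i, bessel c α lam i ∈ stab N) : schrPi c α lam X ∈ stab N := by
  refine add_mem (add_mem ?_ (add_mem ?_ hv)) ?_
  · exact sum_mem fun i _ => (stab N).smul_mem (hx i) _
  · exact (stab N).smul_mem (one_mem _) _
  · exact sum_mem fun i _ => (stab N).smul_mem (hb i) _

lemma schrPi_mem_stab' {N : Submodule ℂ A} {c : Coords A} {α lam : ℝ} (X : Triple)
    (hx : ∀ i, c.x i ∈ stab N) (hd : ∀ i, c.d i ∈ stab N) : schrPi c α lam X ∈ stab N := by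
  apply schrPi_mem_stab hx
  · exact sum_mem fun j _ => sum_mem fun i _ => (stab N).smul_mem (mul_mem (hx i) (hd j)) _
  · intro i
    have h1 := one_mem (stab N)
    have hxd : ∀ i j, c.x i * c.d j ∈ stab N := fun i j => mul_mem (hx i) (hd j)
    fin_cases i
    · exact sub_mem (mul_mem (add_mem (add_mem (add_mem ((stab N).smul_mem h1 _) (hxd _ _))
        (hxd _ _)) (hxd _ _)) (hd _)) ((stab N).smul_mem (mul_mem (hxd _ _) (hd _)) _)
    · exact sub_mem (mul_mem (add_mem (add_mem (add_mem ((stab N).smul_mem h1 _) (hxd _ _))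
        (hxd _ _)) (hxd _ _)) (hd _)) ((stab N).smul_mem (mul_mem (hxd _ _) (hd _)) _)
    · exact add_mem (mul_mem (add_mem (add_mem (add_mem ((stab N).smul_mem h1 _)
        ((stab N).smul_mem (hxd _ _) _)) ((stab N).smul_mem (hxd _ _) _))
        ((stab N).smul_mem (hxd _ _) _)) (hd _)) (mul_mem (hxd _ _) (hd _))
    · exact add_mem (mul_mem (sub_mem (sub_mem (sub_mem ((stab N).smul_mem h1 _)
        ((stab N).smul_mem (hxd _ _) _)) ((stab N).smul_mem (hxd _ _) _))
        ((stab N).smul_mem (hxd _ _) _)) (hd _)) (mul_mem (hxd _ _) (hd _))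

end Stab

section IdealStab

variable {R : Type} [CommRing R] [Algebra ℂ R] {X : Fin 2 → R} {D : Fin 2 → Derivation ℂ R R}

lemma IsNormal.coord {κ y z : R} (hyz : X 0 * X 1 = y * z) {f : SF R 2} (hf : IsNormal X κ y f)
    (i : Fin 4) : IsNormal X κ y ((sfCoords X D (id : Fin 2 → Fin 2)).x i f) := by
  obtain ⟨a, b, c, h, h0, h1⟩ := hf
  fin_cases i
  · refine ⟨X 0 * a, X 0 * b, X 0 * c, ?_, ?_, ?_⟩ <;> simp [sfCoords, h, h0, h1] <;> ring
  · refine ⟨X 1 * a, X 1 * b, X 1 * c, ?_, ?_, ?_⟩ <;> simp [sfCoords, h, h0, h1] <;> ring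
  · refine ⟨2 * κ * z * f {0, 1} + y * c, 0, - 2 * κ * z * b, ?_, ?_, ?_⟩
    · simp [sfCoords, h1]
      linear_combination (-2 * κ * y * b) * hyz
    · simp [sfCoords, h]
      linear_combination (2 * κ * f {0, 1}) * hyz
    · simp [sfCoords]
  · refine ⟨0, 2 * κ * z * f {0, 1} + y * c, 2 * κ * z * a, ?_, ?_, ?_⟩
    · simp [sfCoords, h0]
      linear_combination (2 * κ * y * a) * hyz
    · simp [sfCoords]
    · simp [sfCoords, h]
      linear_combination (2 * κ * f {0, 1}) * hyz

lemma schrPi_mem_stab_idealI (hX : ∀ i j, D i (X j) = if i = j then 1 else 0) {α lam : ℝ}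
    (hα : α ≠ 0) (hl : lam = α ∨ lam = 1) {Z : Triple} (hZ : Z ∈ tkk α) :
    schrPi (sfCoords X D (id : Fin 2 → Fin 2)) α lam Z
      ∈ stab (idealI (sfCoords X D (id : Fin 2 → Fin 2)) α lam) := by
  obtain ⟨a, p, q, r, s, t, hM⟩ := str_form (mem_tkk.mp hZ)
  by_cases h : lam = α
  · subst h
    rw [idealI_alpha]
    apply schrPi_mem_stab
    · exact fun i _ hf => IsNormal.coord (z := X 0) (mul_comm _ _) hf i
    · rw [hM]
      exact fun _ hf => vectorField_alpha hX hf
    · exact fun i _ hf => bessel_alpha hX hα hf i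
  · obtain rfl : lam = 1 := hl.resolve_left h
    rw [idealI_one X D h]
    apply schrPi_mem_stab
    · exact fun i _ hf => IsNormal.coord (z := X 1) rfl hf i
    · rw [hM]
      exact fun _ hf => vectorField_one hX hf
    · exact fun i _ hf => bessel_one hX hα hf i

end IdealStab

lemma polyCoords_hX (i j : Fin 2) :
    MvPolynomial.pderiv (R := ℂ) i (MvPolynomial.X j) = if i = j then 1 else 0 := by
  rw [MvPolynomial.pderiv_X, Pi.single_apply]
  simp [eq_comm]

lemma hasFDerivAt_coord (j : Fin 2) (x : Fin 2 → ℝ) :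
    HasFDerivAt (fun x : Fin 2 → ℝ => ((x j : ℝ) : ℂ))
      (Complex.ofRealCLM.comp (ContinuousLinearMap.proj (R := ℝ) (φ := fun _ : Fin 2 => ℝ) j)) x :=
  (Complex.ofRealCLM.comp
    (ContinuousLinearMap.proj (R := ℝ) (φ := fun _ : Fin 2 => ℝ) j)).hasFDerivAt

lemma smoothCoords_hX (i j : Fin 2) : smoothD i (smoothX j) = if i = j then 1 else 0 := by
  ext x
  have h := hasFDerivAt_coord j x
  change fderiv ℝ (fun x : Fin 2 → ℝ => ((x j : ℝ) : ℂ)) x (Pi.single i 1) = _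
  rw [h.fderiv]
  by_cases hij : i = j
  · subst hij; simp
  · simp [hij, Pi.single_apply, Ne.symm hij]

lemma evenPart_add_oddPart (X : Triple) : evenPart X + oddPart X = X := by
  simp only [evenPart, oddPart]; module

lemma expAd_mem {α : ℝ} {t : ℂ} {Z : Triple} (hZ : ∀ X ∈ tkk α, bracket α Z X ∈ tkk α)
    {X : Triple} (hX : X ∈ tkk α) : expAd α t Z X ∈ tkk α := by
  have h : ∀ k, (bracket α Z)^[k] X ∈ tkk α := fun k => by
    induction k with
    | zero => exact hX
    | succ k ih => rw [Function.iterate_succ_apply']; exact hZ _ ih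
  exact sum_mem fun k _ => (tkk α).smul_mem _ (h k)

lemma tpar_eElt : tpar eElt = eElt := by
  have h : jpar jone = jone := by ext i; fin_cases i <;> simp [jpar_apply, jone]
  simp [tpar, eElt, h]

lemma tpar_fElt : tpar fElt = fElt := by
  have h : jpar jone = jone := by ext i; fin_cases i <;> simp [jpar_apply, jone]
  simp [tpar, fElt, h]

lemma jmul_jone_eq {α : ℝ} : jmul α jone = 1 := by
  exact LinearMap.ext fun a => jone_jmul a

lemma bracketAux_eElt {α : ℝ} (X : Triple) :
    bracketAux α 1 eElt X = ⟨0, (2 : ℂ) • jmul α X.1, - X.2.1 jone⟩ := by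
  simp [bracketAux, eElt, jmul_jone_eq, jone_jmul, lowerAct]

lemma bracketAux_fElt {α : ℝ} (X : Triple) :
    bracketAux α 1 fElt X = ⟨X.2.1 jone, - (2 : ℂ) • jmul α X.2.2, 0⟩ := by
  simp [bracketAux, fElt, jmul_jone_eq, jmul_jone, lowerAct]
  exact ⟨by module, by module⟩

lemma bracket_eElt {α : ℝ} (X : Triple) :
    bracket α eElt X = ⟨0, (2 : ℂ) • jmul α X.1, - X.2.1 jone⟩ := by
  have h0 : evenPart eElt = eElt := by rw [evenPart, tpar_eElt]; module
  have h1 : oddPart eElt = 0 := by rw [oddPart, tpar_eElt]; simp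
  have h2 : ∀ s Y, bracketAux α s 0 Y = 0 := fun s Y => by simp [bracketAux, lowerAct]
  rw [bracket, h0, h1, h2, h2, bracketAux_eElt, bracketAux_eElt]
  conv_rhs => rw [← evenPart_add_oddPart X]
  simp [add_comm]

lemma bracket_fElt {α : ℝ} (X : Triple) :
    bracket α fElt X = ⟨X.2.1 jone, - (2 : ℂ) • jmul α X.2.2, 0⟩ := by
  have h0 : evenPart fElt = fElt := by rw [evenPart, tpar_fElt]; module
  have h1 : oddPart fElt = 0 := by rw [oddPart, tpar_fElt]; simp
  have h2 : ∀ s Y, bracketAux α s 0 Y = 0 := fun s Y => by simp [bracketAux, lowerAct]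
  rw [bracket, h0, h1, h2, h2, bracketAux_fElt, bracketAux_fElt]
  conv_rhs => rw [← evenPart_add_oddPart X]
  simp
  module

lemma cayley_mem {α : ℝ} {X : Triple} (hX : X ∈ tkk α) : cayley α X ∈ tkk α := by
  apply expAd_mem
  · intro Y _
    rw [bracket_fElt, mem_tkk]
    exact (str α).smul_mem _ (jmul_mem_str _)
  · apply expAd_mem _ hX
    intro Y _
    rw [bracket_eElt, mem_tkk]
    exact (str α).smul_mem _ (jmul_mem_str _)

/-! ### The Schrödinger model -/

/-- The function `exp (-2 (x₁ + x₂))`. -/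
def expo : smoothAlg :=
  ⟨fun x => Complex.exp (-2 * ((x 0 : ℂ) + (x 1 : ℂ))), by
    have h : ContDiff ℝ (⊤ : ℕ∞) (fun x : Fin 2 → ℝ => -2 * ((x 0 : ℂ) + (x 1 : ℂ))) :=
      contDiff_const.mul (ContDiff.add (n := ((⊤ : ℕ∞) : WithTop ℕ∞)) (smoothX 0).2 (smoothX 1).2)
    exact h.cexp⟩

/-- A polynomial as a smooth function on `ℝ²`. -/
def toSmooth : MvPolynomial (Fin 2) ℂ →ₐ[ℂ] smoothAlg := MvPolynomial.aeval smoothX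

/-- The space `P(ℝ^{2|2}) exp (-2 (x₁ + x₂))` of smooth superfunctions. -/
def polyExp : Submodule ℂ Smooth where
  carrier := {f | ∃ p : Poly 2 2, ∀ S, f S = toSmooth (p S) * expo}
  add_mem' := by
    rintro f g ⟨p, hp⟩ ⟨q, hq⟩
    exact ⟨p + q, fun S => by simp [hp, hq, add_mul]⟩
  zero_mem' := ⟨0, fun S => by simp⟩
  smul_mem' := by
    rintro t f ⟨p, hp⟩
    exact ⟨t • p, fun S => by simp [hp]⟩

lemma smoothD_expo (i : Fin 2) : smoothD i expo = (-2 : ℂ) • expo := by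
  ext x
  have h : HasFDerivAt (fun x : Fin 2 → ℝ => -2 * ((x 0 : ℂ) + (x 1 : ℂ)))
      ((-2 : ℂ) • (Complex.ofRealCLM.comp
        (ContinuousLinearMap.proj (R := ℝ) (φ := fun _ : Fin 2 => ℝ) 0)
        + Complex.ofRealCLM.comp
        (ContinuousLinearMap.proj (R := ℝ) (φ := fun _ : Fin 2 => ℝ) 1))) x := by
    apply HasFDerivAt.const_mul
    exact (hasFDerivAt_coord 0 x).add (hasFDerivAt_coord 1 x)
  change fderiv ℝ (fun x : Fin 2 → ℝ => Complex.exp (-2 * ((x 0 : ℂ) + (x 1 : ℂ)))) x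
    (Pi.single i 1) = (-2 : ℂ) • Complex.exp (-2 * ((x 0 : ℂ) + (x 1 : ℂ)))
  rw [h.cexp.fderiv]
  fin_cases i <;> simp <;> ring

lemma smoothD_toSmooth (i : Fin 2) (p : MvPolynomial (Fin 2) ℂ) :
    smoothD i (toSmooth p) = toSmooth (MvPolynomial.pderiv i p) := by
  induction p using MvPolynomial.induction_on with
  | C a =>
    have : toSmooth (MvPolynomial.C a) = algebraMap ℂ smoothAlg a := by
      simp [toSmooth]
    rw [this]; simp
  | add p q hp hq => simp [hp, hq]
  | mul_X p j hp =>
    have : toSmooth (MvPolynomial.X j) = smoothX j := by simp [toSmooth]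
    rw [map_mul, Derivation.leibniz, hp, Derivation.leibniz, this, smoothCoords_hX,
      polyCoords_hX]
    by_cases hij : i = j <;> simp [hij, this]

lemma schrPi_mem_stab_polyExp (α lam : ℝ) (X : Triple) :
    schrPi smoothCoords α lam X ∈ stab polyExp := by
  have hX : ∀ j, toSmooth (MvPolynomial.X j) = smoothX j := fun j => by simp [toSmooth]
  have ex : ∀ k : Fin 2, (evenOp (LinearMap.mulLeft ℂ (smoothX k)) : Module.End ℂ Smooth)
      ∈ stab polyExp := by
    rintro k f ⟨p, hp⟩
    exact ⟨fun S => MvPolynomial.X k * p S, fun S => by simp [hp, hX, mul_assoc]⟩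
  have ed : ∀ k : Fin 2, (evenOp (smoothD k).toLinearMap : Module.End ℂ Smooth)
      ∈ stab polyExp := by
    rintro k f ⟨p, hp⟩
    refine ⟨fun S => MvPolynomial.pderiv k (p S) + (-2 : ℂ) • p S, fun S => ?_⟩
    simp only [evenOp_apply, hp, Derivation.coeFn_coe, Derivation.leibniz, smoothD_toSmooth,
      smoothD_expo, map_add, map_smul, smul_eq_mul]
    rw [mul_smul_comm, add_mul, smul_mul_assoc, add_comm, mul_comm expo]
  have tx : ∀ k : Fin 2, (thetaMul k : Module.End ℂ Smooth) ∈ stab polyExp := by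
    rintro k f ⟨p, hp⟩
    refine ⟨thetaMul k p, fun S => ?_⟩
    by_cases h : k ∈ S <;> simp [thetaMul, h, hp]
  have td : ∀ k : Fin 2, (thetaDer k : Module.End ℂ Smooth) ∈ stab polyExp := by
    rintro k f ⟨p, hp⟩
    refine ⟨thetaDer k p, fun S => ?_⟩
    by_cases h : k ∈ S <;> simp [thetaDer, h, hp]
  apply schrPi_mem_stab'
  · intro i
    fin_cases i
    exacts [ex 0, ex 1, tx 0, tx 1]
  · intro i
    fin_cases i
    exacts [ed 0, ed 1, td 0, td 1]

/-- The Schrödinger model `W_λ`: the image of `P(ℝ^{2|2}) exp (-2 (x₁ + x₂))` in the smooth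
superfunctions modulo `I_λ`. -/
def W (α lam : ℝ) : Submodule ℂ (Smooth ⧸ idealI smoothCoords α lam) :=
  polyExp.map (idealI smoothCoords α lam).mkQ

/-- The class in `W_λ` of an element of `P(ℝ^{2|2}) exp (-2 (x₁ + x₂))`. -/
def toW (α lam : ℝ) (f : polyExp) : W α lam :=
  ⟨(idealI smoothCoords α lam).mkQ f, Submodule.mem_map_of_mem f.2⟩

/-- The action `π_λ` of `𝔤` on `W_λ`. -/
def piW (α lam : ℝ) (hα : α ≠ 0) (hl : lam = α ∨ lam = 1) (X : tkk α) :
    Module.End ℂ (W α lam) :=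
  ((idealI smoothCoords α lam).mapQ (idealI smoothCoords α lam) (schrPi smoothCoords α lam X)
    (schrPi_mem_stab_idealI smoothCoords_hX hα hl X.2)).restrict (by
      rintro _ ⟨f, hf, rfl⟩
      exact ⟨schrPi smoothCoords α lam X f, schrPi_mem_stab_polyExp α lam X f hf, rfl⟩)

/-! ### The Fock model -/

/-- The polynomial Fock space `P(ℂ^{2|2}) / I_λ`. -/
abbrev FockSpace (α lam : ℝ) : Type := Poly 2 2 ⧸ idealI polyCoords α lam

/-- The constant superfunction `1`. -/
def one {m n : ℕ} : Poly m n := Pi.single ∅ 1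

/-- The Fock representation `ρ_λ = π_λ ∘ c` on `P(ℂ^{2|2}) / I_λ`. -/
def rho (α lam : ℝ) (hα : α ≠ 0) (hl : lam = α ∨ lam = 1) (X : tkk α) :
    Module.End ℂ (FockSpace α lam) :=
  (idealI polyCoords α lam).mapQ (idealI polyCoords α lam)
    (schrPi polyCoords α lam (cayley α X))
    (schrPi_mem_stab_idealI polyCoords_hX hα hl (cayley_mem X.2))

/-- The Fock model `F_λ = U(𝔤) 1 mod I_λ`. -/
def F (α lam : ℝ) (hα : α ≠ 0) (hl : lam = α ∨ lam = 1) : Submodule ℂ (FockSpace α lam) :=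
  Submodule.span ℂ {v | ∃ l : List (tkk α),
    v = (l.map (rho α lam hα hl)).prod ((idealI polyCoords α lam).mkQ one)}

/-- The action `ρ_λ` of `𝔤` on `F_λ`. -/
def rhoF (α lam : ℝ) (hα : α ≠ 0) (hl : lam = α ∨ lam = 1) (X : tkk α) :
    Module.End ℂ (F α lam hα hl) :=
  (rho α lam hα hl X).restrict (fun v hv => by
    induction hv using Submodule.span_induction with
    | mem v h =>
      obtain ⟨l, rfl⟩ := h
      exact Submodule.subset_span ⟨X :: l, by simp⟩
    | zero => simp
    | add v w _ _ h h' => rw [map_add]; exact add_mem h h'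
    | smul t v _ h => rw [map_smul]; exact Submodule.smul_mem _ t h)

/-! ### The Bessel–Fischer product with the reproducing kernel -/

/-- The operator `p(B_λ)` on superpolynomials in `(x, z)`, obtained from the superpolynomial `p`
by replacing its coordinates by the Bessel operators in the block `x`. -/
def besselSubst (α lam : ℝ) (p : Poly 2 2) : Module.End ℂ (Poly 4 4) :=
  let B := bessel jointX α lam
  ∑ S : Finset (Fin 2), ∑ m ∈ (p S).support, MvPolynomial.coeff m (p S) •
    (B 0 ^ m 0 * B 1 ^ m 1 * (if 0 ∈ S then B 2 else 1) * (if 1 ∈ S then B 3 else 1))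

/-- Restriction of a superpolynomial in `(x, z)` to `x = 0`. -/
def atXZero (q : Poly 4 4) : Poly 2 2 := fun T =>
  MvPolynomial.aeval
    (Fin.append (fun _ : Fin 2 => (0 : MvPolynomial (Fin 2) ℂ)) MvPolynomial.X)
    (q (T.map (Fin.natAddEmb 2)))

/-- Complex conjugation of the coefficients. -/
def conjCoeff {m n : ℕ} (q : Poly m n) : Poly m n := fun S =>
  MvPolynomial.map (starRingEnd ℂ) (q S)

/-- The Bessel–Fischer product `⟨p, q⟩ = p(B_λ) q̄ |_{x = 0}` in the variable `x`, where `q` is a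
superpolynomial in `x` and the conjugate variable `z̄`; the result is a superpolynomial in `z`. -/
def besselFischer (α lam : ℝ) (p : Poly 2 2) (q : Poly 4 4) : Poly 2 2 :=
  atXZero (besselSubst α lam p (conjCoeff q))

/-- Multiplication by `x|w = x₁ w₁ + α x₂ w₂ - x₃ w₄ / 2 + x₄ w₃ / 2`. -/
def pairing (α : ℝ) : Module.End ℂ (Poly 4 4) :=
  jointX.x 0 * jointZ.x 0 + (α : ℂ) • (jointX.x 1 * jointZ.x 1)
    - (2⁻¹ : ℂ) • (jointX.x 2 * jointZ.x 3) + (2⁻¹ : ℂ) • (jointX.x 3 * jointZ.x 2)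

open Classical in
/-- The part of degree `k` of the reproducing kernel `𝕀_λ(x, z)` as a superpolynomial in `x` and
`w = z̄`. With `μ = λ = α`, `β = 1` or `λ = 1`, `μ = β = α⁻¹`, the kernel is
`Γ(-μ) Ĩ_{-1-μ}(2 √(β (x|w))) = ∑ₖ Γ(-μ) / (k! Γ(k - μ)) (β (x|w))^k`. -/
def kernelPart (α lam : ℝ) (k : ℕ) : Poly 4 4 :=
  let mu : ℝ := if lam = α then α else α⁻¹
  let beta : ℝ := if lam = α then 1 else α⁻¹
  ((Real.Gamma (-mu) / (k.factorial * Real.Gamma (k - mu)) * beta ^ k : ℝ) : ℂ) •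
    (pairing α ^ k) one

/-- `p ↦ ⟨p, 𝕀_λ(x, z)⟩ = ∑ₖ ⟨p, 𝕀_{λ,k}(x, z)⟩` in the variable `x`, modulo `I_λ`; only finitely
many terms of the sum do not vanish. -/
def kernelTransform (α lam : ℝ) (p : Poly 2 2) : FockSpace α lam :=
  (idealI polyCoords α lam).mkQ (∑ᶠ k, besselFischer α lam p (kernelPart α lam k))

/-! ### The Segal–Bargmann transform -/

/-- `g` is the polynomial superfunction
`π_λ(C) f = exp (x₁ + x₂) exp (½ (B_λ(x₁) + B_λ(x₂))) f`. The exponential of the differential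
operator is the exponential series at `t = ½`, evaluated pointwise and in the sense of Abel: the
series `∑ₖ (t ^ k / k!) (B_λ(x₁) + B_λ(x₂))^k f` converges for `0 < t < ½` and its sum has a
limit as `t → ½`. -/
def IsPiC (α lam : ℝ) (f : Smooth) (g : Poly 2 2) : Prop :=
  let term : Finset (Fin 2) → (Fin 2 → ℝ) → ℝ → ℕ → ℂ := fun S x t k =>
    ((t ^ k / k.factorial : ℝ) : ℂ) *
      ((((bessel smoothCoords α lam 0 + bessel smoothCoords α lam 1) ^ k) f S : smoothAlg) :
        (Fin 2 → ℝ) → ℂ) x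
  ∀ S x, (∀ t ∈ Set.Ioo (0 : ℝ) (1 / 2), Summable (term S x t)) ∧
    Tendsto (fun t => Complex.exp ((x 0 : ℂ) + (x 1 : ℂ)) * ∑' k, term S x t k)
      (𝓝[<] (1 / 2)) (𝓝 (MvPolynomial.eval (fun i => (x i : ℂ)) (g S)))

/-- `v` is the Segal–Bargmann transform of `f`, that is the Bessel–Fischer product of
`π_λ(C) f` with the reproducing kernel. -/
def IsSegalBargmann (α lam : ℝ) (f : Smooth) (v : FockSpace α lam) : Prop :=
  ∃ g : Poly 2 2, IsPiC α lam f g ∧ v = kernelTransform α lam g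

end D21

end

noncomputable section

namespace D21

set_option linter.unusedSimpArgs false

/-! ### Commutation relations of the representation -/

/-! Write `B = B_λ(x₁) + B_λ(x₂)` and `κ = λ + λ/α`. Since `π_λ` sends the unit of `D_α⁻` to `-2i(x₁
+ x₂)` and the unit of `D_α⁺` to `-(i/2) B`, the operator `π_λ(C) = exp(x₁ + x₂) exp(B/2)` is
formally the exponentiated Cayley transform. Formally it therefore intertwines `π_λ` with `π_λ ∘ c`.
The work lies in giving it a meaning on `p exp(-2(x₁ + x₂))`, and in showing that pairing with the
kernel changes nothing modulo `I_λ`.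

The two units and `L_1` span a copy of `sl₂`, in which `L_1` acts as `κ/2` minus the Euler operator.
The Gauss factorisation of the corresponding group elements suggests that `exp(tB)(p exp(-2(x₁ +
x₂)))` equals `(1+2t)^κ exp(-2(x₁ + x₂)/(1+2t))` times the superpolynomial `exp((t/(1+2t)) B) p`
with all coordinates scaled by `(1+2t)⁻²`. On superpolynomials `B` is locally nilpotent, so its
exponential there is a finite sum. `hasDerivAt_flow` verifies the differential equation. The closed
form is holomorphic for `|t| < 1/2`, its Taylor series at `0` is the exponential series
(`hasSum_flow`), and it is continuous at `t = 1/2`, where the remaining exponential cancels against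
`exp(x₁ + x₂)`. What is left is `piC p`: the superpolynomial `2^κ exp(B/4) p`, evaluated at `x/4`
(`isPiC_mulExpo_iff`).

Each of the three factors, namely the exponential function, `exp(B/4)` and the scaling, conjugates
`π_λ` by an explicit automorphism of the Lie superalgebra. Their composite is `c`, which is the
intertwining relation `piC_schrPi`.

Modulo `I_λ` in the second variable, `B_λ(xᵢ)` maps the part of degree `k + 1` of the kernel to `zᵢ`
times the part of degree `k` (`mkQ_bessel_kernelPart`); the excluded values of `α` are those for
which the recursion of the coefficients breaks down. Hence `p(B_λ)` acts on the kernel as `p(z)`,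
and at `x = 0` only the constant part of the kernel contributes. So `⟨p, 𝕀_λ⟩ = p` modulo `I_λ`
(`kernelTransform_eq`).

The transform is thus `p exp(-2(x₁ + x₂)) ↦ piC p` modulo `I_λ`. A function `p exp(-2(x₁ + x₂))`
lies in the smooth ideal exactly when `p` lies in the polynomial one (`mulExpo_mem_idealI_iff`). The
operator `piC` is invertible and both it and its inverse preserve `I_λ`. Finally `F_λ` is the whole
quotient, because `ρ_λ` contains multiplication by every coordinate (`F_eq_top`). Bijectivity
follows by comparing kernels of two surjections from the superpolynomials. -/

/-- The operator `B_λ(x₁) + B_λ(x₂)`. -/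
def besselSum {A : Type} [AddCommGroup A] [Module ℂ A] (c : Coords A) (α lam : ℝ) :
    Module.End ℂ A := bessel c α lam 0 + bessel c α lam 1

/-- The relations that characterize the matrices of the structure algebra on `D_α⁻`. -/
structure IsStrMatrix (α : ℝ) (M : Fin 4 → Fin 4 → ℂ) : Prop where
  h01 : M 0 1 = 0
  h10 : M 1 0 = 0
  h02 : M 0 2 = -2 * M 3 1
  h03 : M 0 3 = 2 * M 2 1
  h12 : M 1 2 = -2 * α * M 3 0
  h13 : M 1 3 = 2 * α * M 2 0
  h33 : M 3 3 = M 0 0 + M 1 1 - M 2 2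

lemma isStrMatrix_strMatrix (α : ℝ) (a : Fin 4 → ℂ) (p q r s t : ℂ) :
    IsStrMatrix α (strMatrix α a p q r s t) := by
  constructor <;> simp [strMatrix] <;> ring

section Commutation

variable {R : Type} [CommRing R] [Algebra ℂ R] {X : Fin 2 → R} {D : Fin 2 → Derivation ℂ R R}

@[simp] lemma singleton_zero_ne_one : ({0} : Finset (Fin 2)) ≠ {1} := by decide
@[simp] lemma singleton_one_ne_zero : ({1} : Finset (Fin 2)) ≠ {0} := by decide
@[simp] lemma pair_ne_zero : ({0, 1} : Finset (Fin 2)) ≠ {0} := by decide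
@[simp] lemma pair_ne_one : ({0, 1} : Finset (Fin 2)) ≠ {1} := by decide
@[simp] lemma zero_ne_pair : ({0} : Finset (Fin 2)) ≠ {0, 1} := by decide
@[simp] lemma one_ne_pair : ({1} : Finset (Fin 2)) ≠ {0, 1} := by decide
@[simp] lemma pair_ne_empty : ({0, 1} : Finset (Fin 2)) ≠ ∅ := by decide
@[simp] lemma zero_ne_empty : ({0} : Finset (Fin 2)) ≠ ∅ := by decide
@[simp] lemma empty_ne_zero : (∅ : Finset (Fin 2)) ≠ {0} := by decide
@[simp] lemma empty_ne_one : (∅ : Finset (Fin 2)) ≠ {1} := by decide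
@[simp] lemma empty_ne_pair : (∅ : Finset (Fin 2)) ≠ {0, 1} := by decide
@[simp] lemma one_ne_empty : ({1} : Finset (Fin 2)) ≠ ∅ := by decide

lemma sf_smul_apply (t : ℂ) (f : SF R 2) (S : Finset (Fin 2)) :
    (t • f) S = algebraMap ℂ R t * f S := Algebra.smul_def _ _

section Components

variable (X D) {α lam : ℝ} {k l : R} (hk : algebraMap ℂ R α = k)
  (hl : algebraMap ℂ R (lam / α) = l) (hkl : algebraMap ℂ R lam = k * l) (f : SF R 2)

-- Written out on the four components, the operators are ordinary differential operators in `R`.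
-- Every commutation relation below then becomes a Leibniz expansion followed by `ring`.
include hkl hk in
lemma bessel_zero_apply : bessel (sfCoords X D (id : Fin 2 → Fin 2)) α lam 0 f =
    fun S => if S = ∅ then X 0 * D 0 (D 0 (f ∅)) - k * l * D 0 (f ∅) + 2 * k * X 1 * f {0, 1}
      else if S = {0, 1} then X 0 * D 0 (D 0 (f S)) + (2 - k * l) * D 0 (f S)
      else X 0 * D 0 (D 0 (f S)) + (1 - k * l) * D 0 (f S) := by
  apply sf_ext <;> simp [bessel, sfCoords, Algebra.smul_def, two_alg, hk, hkl] <;> ring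

include hl in
lemma bessel_one_apply : bessel (sfCoords X D (id : Fin 2 → Fin 2)) α lam 1 f =
    fun S => if S = ∅ then X 1 * D 1 (D 1 (f ∅)) - l * D 1 (f ∅) + 2 * X 0 * f {0, 1}
      else if S = {0, 1} then X 1 * D 1 (D 1 (f S)) + (2 - l) * D 1 (f S)
      else X 1 * D 1 (D 1 (f S)) + (1 - l) * D 1 (f S) := by
  apply sf_ext <;>
    simp [bessel, sfCoords, Algebra.smul_def, two_alg, hl, -map_div₀] <;> ring

include hkl hk in
lemma bessel_two_apply : bessel (sfCoords X D (id : Fin 2 → Fin 2)) α lam 2 f =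
    fun S => if S = ∅ then 2 * X 0 * D 0 (f {1}) + 2 * k * X 1 * D 1 (f {1}) - 2 * k * l * f {1}
      else if S = {0} then D 0 (D 1 (f ∅)) - 2 * X 0 * D 0 (f {0, 1})
        - 2 * k * X 1 * D 1 (f {0, 1}) - (2 + 2 * k - 2 * k * l) * f {0, 1}
      else if S = {0, 1} then D 0 (D 1 (f {1})) else 0 := by
  apply sf_ext <;> simp [bessel, sfCoords, Algebra.smul_def, two_alg, hk, hkl] <;> ring

include hkl hk in
lemma bessel_three_apply : bessel (sfCoords X D (id : Fin 2 → Fin 2)) α lam 3 f =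
    fun S => if S = ∅ then 2 * k * l * f {0} - 2 * X 0 * D 0 (f {0}) - 2 * k * X 1 * D 1 (f {0})
      else if S = {1} then D 0 (D 1 (f ∅)) - 2 * X 0 * D 0 (f {0, 1})
        - 2 * k * X 1 * D 1 (f {0, 1}) - (2 + 2 * k - 2 * k * l) * f {0, 1}
      else if S = {0, 1} then - D 0 (D 1 (f {0})) else 0 := by
  apply sf_ext <;> simp [bessel, sfCoords, Algebra.smul_def, two_alg, hk, hkl] <;> ring

lemma coord_zero_apply : (sfCoords X D (id : Fin 2 → Fin 2)).x 0 f = fun S => X 0 * f S := rfl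

lemma coord_one_apply : (sfCoords X D (id : Fin 2 → Fin 2)).x 1 f = fun S => X 1 * f S := rfl

lemma coord_two_apply : (sfCoords X D (id : Fin 2 → Fin 2)).x 2 f =
    fun S => if S = {0} then f ∅ else if S = {0, 1} then f {1} else 0 := by
  apply sf_ext <;> simp [sfCoords]

lemma coord_three_apply : (sfCoords X D (id : Fin 2 → Fin 2)).x 3 f =
    fun S => if S = {1} then f ∅ else if S = {0, 1} then - f {0} else 0 := by
  apply sf_ext <;> simp [sfCoords]

lemma der_zero_apply : (sfCoords X D (id : Fin 2 → Fin 2)).d 0 f = fun S => D 0 (f S) := rfl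

lemma der_one_apply : (sfCoords X D (id : Fin 2 → Fin 2)).d 1 f = fun S => D 1 (f S) := rfl

lemma der_two_apply : (sfCoords X D (id : Fin 2 → Fin 2)).d 2 f =
    fun S => if S = ∅ then f {0} else if S = {1} then f {0, 1} else 0 := by
  apply sf_ext <;> simp [sfCoords]

lemma der_three_apply : (sfCoords X D (id : Fin 2 → Fin 2)).d 3 f =
    fun S => if S = ∅ then f {1} else if S = {0} then - f {0, 1} else 0 := by
  apply sf_ext <;> simp [sfCoords]

lemma vectorField_apply {M : Fin 4 → Fin 4 → ℂ} {m : Fin 4 → Fin 4 → R}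
    (hm : ∀ i j, algebraMap ℂ R (M i j) = m i j) :
    vectorField (sfCoords X D (id : Fin 2 → Fin 2)) M f =
    fun S => (m 0 0 * X 0 + m 1 0 * X 1) * D 0 (f S) + (m 0 1 * X 0 + m 1 1 * X 1) * D 1 (f S)
      + (if S = ∅ then (m 0 2 * X 0 + m 1 2 * X 1) * f {0} + (m 0 3 * X 0 + m 1 3 * X 1) * f {1}
      else if S = {0} then m 2 0 * D 0 (f ∅) + m 2 1 * D 1 (f ∅) + m 2 2 * f {0} + m 2 3 * f {1}
        - (m 0 3 * X 0 + m 1 3 * X 1) * f {0, 1}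
      else if S = {1} then m 3 0 * D 0 (f ∅) + m 3 1 * D 1 (f ∅) + m 3 2 * f {0} + m 3 3 * f {1}
        + (m 0 2 * X 0 + m 1 2 * X 1) * f {0, 1}
      else m 2 0 * D 0 (f {1}) + m 2 1 * D 1 (f {1}) - m 3 0 * D 0 (f {0}) - m 3 1 * D 1 (f {0})
        + (m 2 2 + m 3 3) * f {0, 1}) := by
  simp only [vectorField, Fin.sum_univ_four, LinearMap.add_apply, LinearMap.smul_apply,
    Module.End.mul_apply, coord_zero_apply, coord_one_apply, coord_two_apply, coord_three_apply,
    der_zero_apply, der_one_apply, der_two_apply, der_three_apply]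
  apply sf_ext <;>
  simp only [Pi.add_apply, sf_smul_apply, hm,
    singleton_zero_ne_one, singleton_one_ne_zero, pair_ne_zero, pair_ne_one, zero_ne_pair,
    one_ne_pair, pair_ne_empty, zero_ne_empty, one_ne_empty, empty_ne_zero, empty_ne_one,
    empty_ne_pair, if_true, if_false] <;> ring

end Components

/-- Encoding `α` as `k` and `λ/α` as `l` makes `λ = k l` a polynomial expression, so no division is
needed in the commutative ring `R`. -/
lemma exists_consts {α : ℝ} (hα : α ≠ 0) (lam : ℝ) (D : Fin 2 → Derivation ℂ R R) :
    ∃ k l : R, algebraMap ℂ R α = k ∧ algebraMap ℂ R (lam / α) = l ∧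
      algebraMap ℂ R lam = k * l ∧ (∀ i, D i k = 0) ∧ ∀ i, D i l = 0 := by
  refine ⟨_, _, rfl, rfl, ?_, fun i => by simp, fun i => (D i).map_algebraMap _⟩
  rw [← map_mul, mul_div_cancel₀ _ (by exact_mod_cast hα)]

lemma der_one (E : Derivation ℂ R R) : E 1 = 0 := E.map_one_eq_zero

/-- This reflects `[D_α⁺, D_α⁺] = 0`, with one factor the unit. -/
lemma besselSum_comm_bessel (hX : ∀ i j, D i (X j) = if i = j then 1 else 0)
    (hD : ∀ a, D 0 (D 1 a) = D 1 (D 0 a)) {α : ℝ} (hα : α ≠ 0) (lam : ℝ) (i : Fin 4)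
    (f : SF R 2) :
    besselSum (sfCoords X D (id : Fin 2 → Fin 2)) α lam
        (bessel (sfCoords X D (id : Fin 2 → Fin 2)) α lam i f)
      = bessel (sfCoords X D (id : Fin 2 → Fin 2)) α lam i
        (besselSum (sfCoords X D (id : Fin 2 → Fin 2)) α lam f) := by
  obtain ⟨k, l, hk, hl, hkl, hDk, hDl⟩ := exists_consts hα lam D
  have hX00 : D 0 (X 0) = 1 := hX 0 0
  have hX11 : D 1 (X 1) = 1 := hX 1 1
  have hX01 : D 0 (X 1) = 0 := hX 0 1
  have hX10 : D 1 (X 0) = 0 := hX 1 0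
  fin_cases i <;> apply sf_ext <;>
  simp only [besselSum, LinearMap.add_apply, Pi.add_apply, bessel_zero_apply X D hk hkl,
    bessel_one_apply X D hl, bessel_two_apply X D hk hkl, bessel_three_apply X D hk hkl,
    singleton_zero_ne_one, singleton_one_ne_zero, pair_ne_zero, pair_ne_one, zero_ne_pair,
    one_ne_pair, pair_ne_empty, zero_ne_empty, one_ne_empty, if_true, if_false, Fin.zero_eta,
    Fin.mk_one, Fin.reduceFinMk,
    map_add, map_sub, map_neg, Derivation.leibniz, smul_eq_mul, hX00, hX01, hX10, hX11, hDk, hDl,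
    der_one, der_two, map_zero, hD, mul_zero, add_zero] <;> ring


/-- The operator by which `-2 L_{uᵢ}` acts, for the basis elements `u₀, …, u₃` of `D_α`. -/
def mulOp {A : Type} [AddCommGroup A] [Module ℂ A] (c : Coords A) (α lam : ℝ) (i : Fin 4) :
    Module.End ℂ A :=
  vectorField c (fun j l => 2 * jmul α (Pi.single i 1) (Pi.single l 1) j)
    - (![(lam : ℂ), lam / α, 0, 0] i) • 1

section MulOp

variable (X D) {α lam : ℝ} {k l : R} (hk : algebraMap ℂ R α = k)
  (hl : algebraMap ℂ R (lam / α) = l) (hkl : algebraMap ℂ R lam = k * l) (f : SF R 2)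

include hkl in
lemma mulOp_zero_apply : mulOp (sfCoords X D (id : Fin 2 → Fin 2)) α lam 0 f =
    fun S => 2 * X 0 * D 0 (f S) + (if S = ∅ then - k * l else if S = {0, 1} then 2 - k * l
      else 1 - k * l) * f S := by
  have hm : ∀ i j, algebraMap ℂ R (2 * jmul α (Pi.single 0 1) (Pi.single j 1) i)
      = (![![2, 0, 0, 0], ![0, 0, 0, 0], ![0, 0, 1, 0], ![0, 0, 0, 1]] : Fin 4 → Fin 4 → R) i j := by
    intro i j
    fin_cases i <;> fin_cases j <;> simp [jmul_apply, two_alg]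
  simp only [mulOp, LinearMap.sub_apply, vectorField_apply X D _ hm]
  apply sf_ext <;> simp [Algebra.smul_def, hkl] <;> ring

include hl in
lemma mulOp_one_apply : mulOp (sfCoords X D (id : Fin 2 → Fin 2)) α lam 1 f =
    fun S => 2 * X 1 * D 1 (f S) + (if S = ∅ then - l else if S = {0, 1} then 2 - l
      else 1 - l) * f S := by
  have hm : ∀ i j, algebraMap ℂ R (2 * jmul α (Pi.single 1 1) (Pi.single j 1) i)
      = (![![0, 0, 0, 0], ![0, 2, 0, 0], ![0, 0, 1, 0], ![0, 0, 0, 1]] : Fin 4 → Fin 4 → R) i j := by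
    intro i j
    fin_cases i <;> fin_cases j <;> simp [jmul_apply, two_alg]
  simp only [mulOp, LinearMap.sub_apply, vectorField_apply X D _ hm]
  apply sf_ext <;> simp [Algebra.smul_def, hl, -map_div₀] <;> ring

include hk in
lemma mulOp_two_apply : mulOp (sfCoords X D (id : Fin 2 → Fin 2)) α lam 2 f =
    fun S => if S = ∅ then 2 * (X 0 + k * X 1) * f {1}
      else if S = {0} then D 0 (f ∅) + D 1 (f ∅) - 2 * (X 0 + k * X 1) * f {0, 1}
      else if S = {0, 1} then D 0 (f {1}) + D 1 (f {1}) else 0 := by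
  have hm : ∀ i j, algebraMap ℂ R (2 * jmul α (Pi.single 2 1) (Pi.single j 1) i)
      = (![![0, 0, 0, 2], ![0, 0, 0, 2 * k], ![1, 1, 0, 0], ![0, 0, 0, 0]] : Fin 4 → Fin 4 → R) i j := by
    intro i j
    fin_cases i <;> fin_cases j <;> simp [jmul_apply, two_alg, hk]
  simp only [mulOp, LinearMap.sub_apply, vectorField_apply X D _ hm]
  apply sf_ext <;> simp [Algebra.smul_def] <;> ring

include hk in
lemma mulOp_three_apply : mulOp (sfCoords X D (id : Fin 2 → Fin 2)) α lam 3 f =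
    fun S => if S = ∅ then - 2 * (X 0 + k * X 1) * f {0}
      else if S = {1} then D 0 (f ∅) + D 1 (f ∅) - 2 * (X 0 + k * X 1) * f {0, 1}
      else if S = {0, 1} then - D 0 (f {0}) - D 1 (f {0}) else 0 := by
  have hm : ∀ i j, algebraMap ℂ R (2 * jmul α (Pi.single 3 1) (Pi.single j 1) i)
      = (![![0, 0, -2, 0], ![0, 0, -2 * k, 0], ![0, 0, 0, 0], ![1, 1, 0, 0]] : Fin 4 → Fin 4 → R) i j := by
    intro i j
    fin_cases i <;> fin_cases j <;> simp [jmul_apply, two_alg, hk]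
  simp only [mulOp, LinearMap.sub_apply, vectorField_apply X D _ hm]
  apply sf_ext <;> simp [Algebra.smul_def] <;> ring

end MulOp

/-- This is `[e, u] = 2 L_u` under `π_λ`: the scalars `-i/2` and `-2i` multiply to `-1`, whence the
normalisation of `mulOp` by `-2 L_u`. -/
lemma besselSum_coord (hX : ∀ i j, D i (X j) = if i = j then 1 else 0)
    {α : ℝ} (hα : α ≠ 0) (lam : ℝ) (i : Fin 4) (f : SF R 2) :
    besselSum (sfCoords X D (id : Fin 2 → Fin 2)) α lam
        ((sfCoords X D (id : Fin 2 → Fin 2)).x i f)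
      = (sfCoords X D (id : Fin 2 → Fin 2)).x i
          (besselSum (sfCoords X D (id : Fin 2 → Fin 2)) α lam f)
        + mulOp (sfCoords X D (id : Fin 2 → Fin 2)) α lam i f := by
  obtain ⟨k, l, hk, hl, hkl, hDk, hDl⟩ := exists_consts hα lam D
  have hX00 : D 0 (X 0) = 1 := hX 0 0
  have hX11 : D 1 (X 1) = 1 := hX 1 1
  have hX01 : D 0 (X 1) = 0 := hX 0 1
  have hX10 : D 1 (X 0) = 0 := hX 1 0
  fin_cases i <;> apply sf_ext <;>
  simp only [besselSum, LinearMap.add_apply, Pi.add_apply, bessel_zero_apply X D hk hkl,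
    bessel_one_apply X D hl, mulOp_zero_apply X D hkl, mulOp_one_apply X D hl,
    mulOp_two_apply X D hk, mulOp_three_apply X D hk, coord_zero_apply, coord_one_apply,
    coord_two_apply, coord_three_apply,
    singleton_zero_ne_one, singleton_one_ne_zero, pair_ne_zero, pair_ne_one, zero_ne_pair,
    one_ne_pair, pair_ne_empty, zero_ne_empty, one_ne_empty, empty_ne_zero, empty_ne_one,
    empty_ne_pair, if_true, if_false, Fin.zero_eta,
    Fin.mk_one, Fin.reduceFinMk,
    map_add, map_sub, map_neg, Derivation.leibniz, smul_eq_mul, hX00, hX01, hX10, hX11, hDk, hDl,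
    der_one, der_two, map_zero, mul_zero, add_zero] <;> ring

/-- This is `[T, e] = T(1)` under `π_λ`. The coefficients `M i 0 + M i 1` are the image of the unit
under `M`, and the relations in `IsStrMatrix` are what turns the remaining second-order terms into
Bessel operators. -/
lemma besselSum_vectorField (hX : ∀ i j, D i (X j) = if i = j then 1 else 0)
    (hD : ∀ a, D 0 (D 1 a) = D 1 (D 0 a)) {α : ℝ} (hα : α ≠ 0) (lam : ℝ)
    {M : Fin 4 → Fin 4 → ℂ} (hM : IsStrMatrix α M) (f : SF R 2) :
    besselSum (sfCoords X D (id : Fin 2 → Fin 2)) α lam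
        (vectorField (sfCoords X D (id : Fin 2 → Fin 2)) M f)
      = vectorField (sfCoords X D (id : Fin 2 → Fin 2)) M
          (besselSum (sfCoords X D (id : Fin 2 → Fin 2)) α lam f)
        + ∑ i, (M i 0 + M i 1) • bessel (sfCoords X D (id : Fin 2 → Fin 2)) α lam i f := by
  obtain ⟨k, l, hk, hl, hkl, hDk, hDl⟩ := exists_consts hα lam D
  have hX00 : D 0 (X 0) = 1 := hX 0 0
  have hX11 : D 1 (X 1) = 1 := hX 1 1
  have hX01 : D 0 (X 1) = 0 := hX 0 1
  have hX10 : D 1 (X 0) = 0 := hX 1 0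
  obtain ⟨m, hm⟩ : ∃ m : Fin 4 → Fin 4 → R, ∀ i j, algebraMap ℂ R (M i j) = m i j :=
    ⟨_, fun _ _ => rfl⟩
  have hDm : ∀ a i j, D a (m i j) = 0 := fun a i j => by rw [← hm]; simp
  have h01 : m 0 1 = 0 := by rw [← hm, hM.h01, map_zero]
  have h10 : m 1 0 = 0 := by rw [← hm, hM.h10, map_zero]
  have h02 : m 0 2 = -2 * m 3 1 := by simp [← hm, hM.h02, two_alg]
  have h03 : m 0 3 = 2 * m 2 1 := by simp [← hm, hM.h03, two_alg]
  have h12 : m 1 2 = -2 * k * m 3 0 := by simp [← hm, hM.h12, two_alg, hk]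
  have h13 : m 1 3 = 2 * k * m 2 0 := by simp [← hm, hM.h13, two_alg, hk]
  have h33 : m 3 3 = m 0 0 + m 1 1 - m 2 2 := by simp [← hm, hM.h33]
  simp only [besselSum, Fin.sum_univ_four, vectorField_apply X D _ hm, LinearMap.add_apply]
  apply sf_ext <;>
  simp only [Pi.add_apply, sf_smul_apply, map_add, hm,
    bessel_zero_apply X D hk hkl,
    bessel_one_apply X D hl, bessel_two_apply X D hk hkl, bessel_three_apply X D hk hkl,
    singleton_zero_ne_one, singleton_one_ne_zero, pair_ne_zero, pair_ne_one, zero_ne_pair,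
    one_ne_pair, pair_ne_empty, zero_ne_empty, one_ne_empty, if_true, if_false,
    map_sub, map_neg, Derivation.leibniz, smul_eq_mul, hX00, hX01, hX10, hX11, hDk, hDl, hDm,
    der_one, der_two, map_zero, hD, mul_zero, add_zero, h01, h10, h02, h03, h12, h13, h33] <;> ring

/-- Multiplication by an even function. -/
def evenMul (e : R) : Module.End ℂ (SF R 2) := evenOp (LinearMap.mulLeft ℂ e)

lemma evenMul_apply (e : R) (f : SF R 2) : evenMul e f = fun S => e * f S := rfl

/-- A vector field is a first-order operator, so only its value on the exponent is added. The
function `e` behaves like `exp(-2(x₁ + x₂))`, on whose exponent the field gives the image of the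
unit under `M`. -/
lemma vectorField_evenMul {e : R} (he : ∀ i, D i e = -2 * e) {M : Fin 4 → Fin 4 → ℂ}
    (f : SF R 2) :
    vectorField (sfCoords X D (id : Fin 2 → Fin 2)) M (evenMul e f)
      = evenMul e (vectorField (sfCoords X D (id : Fin 2 → Fin 2)) M f
        - (2 : ℂ) • ∑ i, (M i 0 + M i 1) • (sfCoords X D (id : Fin 2 → Fin 2)).x i f) := by
  obtain ⟨m, hm⟩ : ∃ m : Fin 4 → Fin 4 → R, ∀ i j, algebraMap ℂ R (M i j) = m i j :=
    ⟨_, fun _ _ => rfl⟩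
  simp only [Fin.sum_univ_four, vectorField_apply X D _ hm]
  apply sf_ext <;>
  simp only [evenMul_apply, Pi.add_apply, Pi.sub_apply, sf_smul_apply, map_add,
    hm, coord_zero_apply, coord_one_apply, coord_two_apply, coord_three_apply,
    singleton_zero_ne_one, singleton_one_ne_zero, pair_ne_zero, pair_ne_one, zero_ne_pair,
    one_ne_pair, pair_ne_empty, zero_ne_empty, one_ne_empty, empty_ne_zero, empty_ne_one,
    empty_ne_pair, if_true, if_false,
    Derivation.leibniz, smul_eq_mul, he, two_alg, mul_zero, add_zero] <;> ring

/-- Conjugating an operator of second order by an exponential stops after two commutators. The first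
one is `mulOp`, by the relation with `x₁ + x₂`, and the second is a multiple of the coordinate; the
numbers `-2` and `4` come from the rate `-2`. -/
lemma bessel_evenMul (hX : ∀ i j, D i (X j) = if i = j then 1 else 0) {e : R}
    (he : ∀ i, D i e = -2 * e) {α : ℝ} (hα : α ≠ 0) (lam : ℝ) (i : Fin 4) (f : SF R 2) :
    bessel (sfCoords X D (id : Fin 2 → Fin 2)) α lam i (evenMul e f)
      = evenMul e (bessel (sfCoords X D (id : Fin 2 → Fin 2)) α lam i f
        - (2 : ℂ) • mulOp (sfCoords X D (id : Fin 2 → Fin 2)) α lam i f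
        + (4 : ℂ) • (sfCoords X D (id : Fin 2 → Fin 2)).x i f) := by
  obtain ⟨k, l, hk, hl, hkl, hDk, hDl⟩ := exists_consts hα lam D
  have hX00 : D 0 (X 0) = 1 := hX 0 0
  have hX11 : D 1 (X 1) = 1 := hX 1 1
  have hX01 : D 0 (X 1) = 0 := hX 0 1
  have hX10 : D 1 (X 0) = 0 := hX 1 0
  have h4 : algebraMap ℂ R 4 = 4 := map_ofNat _ 4
  have hne : ∀ i, D i (-2 * e) = 4 * e := fun i => by
    rw [Derivation.leibniz, he]; simp [der_two]; ring
  fin_cases i <;> apply sf_ext <;>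
  simp only [evenMul_apply, Pi.add_apply, Pi.sub_apply, sf_smul_apply,
    bessel_zero_apply X D hk hkl,
    bessel_one_apply X D hl, bessel_two_apply X D hk hkl, bessel_three_apply X D hk hkl,
    mulOp_zero_apply X D hkl, mulOp_one_apply X D hl,
    mulOp_two_apply X D hk, mulOp_three_apply X D hk, coord_zero_apply, coord_one_apply,
    coord_two_apply, coord_three_apply,
    singleton_zero_ne_one, singleton_one_ne_zero, pair_ne_zero, pair_ne_one, zero_ne_pair,
    one_ne_pair, pair_ne_empty, zero_ne_empty, one_ne_empty, empty_ne_zero, empty_ne_one,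
    empty_ne_pair, if_true, if_false, Fin.zero_eta,
    Fin.mk_one, Fin.reduceFinMk,
    map_add, Derivation.leibniz, smul_eq_mul, he, hne, two_alg, h4, mul_zero, add_zero] <;> ring

end Commutation

/-! ### Linearity of the representation and its values on multiplications -/

section Linear

variable {A : Type} [AddCommGroup A] [Module ℂ A]

lemma lowerAct_add (α : ℝ) (S T : Module.End ℂ Jor) :
    lowerAct α (S + T) = lowerAct α S + lowerAct α T := by
  simp only [lowerAct, LinearMap.add_apply, map_add, smul_add]; abel

lemma lowerAct_smul (α : ℝ) (t : ℂ) (T : Module.End ℂ Jor) :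
    lowerAct α (t • T) = t • lowerAct α T := by
  simp only [lowerAct, LinearMap.smul_apply, map_smul, smul_sub]; rw [smul_comm]

/-- The operator by which `T ∈ str(D_α)` acts. -/
def strOp (c : Coords A) (α lam : ℝ) (T : Module.End ℂ Jor) : Module.End ℂ A :=
  character α lam T • 1 + vectorField c (fun i j => lowerAct α T (Pi.single j 1) i)

lemma schrPi_eq (c : Coords A) (α lam : ℝ) (Z : Triple) : schrPi c α lam Z =
    (∑ i, (-2 * Complex.I * Z.1 i) • c.x i) + strOp c α lam Z.2.1
      + ∑ i, (-(Complex.I / 2) * Z.2.2 i) • bessel c α lam i := rfl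

lemma vectorField_add (c : Coords A) (M M' : Fin 4 → Fin 4 → ℂ) :
    vectorField c (fun i j => M i j + M' i j) = vectorField c M + vectorField c M' := by
  simp only [vectorField, add_smul, Finset.sum_add_distrib]

lemma vectorField_smul (c : Coords A) (t : ℂ) (M : Fin 4 → Fin 4 → ℂ) :
    vectorField c (fun i j => t * M i j) = t • vectorField c M := by
  simp only [vectorField, mul_smul, Finset.smul_sum]

lemma strOp_add (c : Coords A) (α lam : ℝ) (S T : Module.End ℂ Jor) :
    strOp c α lam (S + T) = strOp c α lam S + strOp c α lam T := by
  have h : character α lam (S + T) = character α lam S + character α lam T := by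
    simp [character]; ring
  rw [strOp, strOp, strOp, h, lowerAct_add, add_smul, ← add_add_add_comm, ← vectorField_add]
  rfl

lemma strOp_smul (c : Coords A) (α lam : ℝ) (t : ℂ) (T : Module.End ℂ Jor) :
    strOp c α lam (t • T) = t • strOp c α lam T := by
  have h : character α lam (t • T) = t * character α lam T := by
    simp [character]; ring
  rw [strOp, strOp, h, lowerAct_smul, smul_add, mul_smul, ← vectorField_smul]
  rfl

lemma strOp_sub (c : Coords A) (α lam : ℝ) (S T : Module.End ℂ Jor) :
    strOp c α lam (S - T) = strOp c α lam S - strOp c α lam T := by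
  have h : S - T = S + (-1 : ℂ) • T := by module
  rw [h, strOp_add, strOp_smul]; module

lemma schrPi_add (c : Coords A) (α lam : ℝ) (Z Z' : Triple) :
    schrPi c α lam (Z + Z') = schrPi c α lam Z + schrPi c α lam Z' := by
  simp only [schrPi_eq, Prod.fst_add, Prod.snd_add, strOp_add, Pi.add_apply, mul_add, add_smul,
    Finset.sum_add_distrib]
  abel

lemma schrPi_smul (c : Coords A) (α lam : ℝ) (t : ℂ) (Z : Triple) :
    schrPi c α lam (t • Z) = t • schrPi c α lam Z := by
  simp only [schrPi_eq, Prod.smul_fst, Prod.smul_snd, strOp_smul, Pi.smul_apply, smul_eq_mul,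
    smul_add, Finset.smul_sum, smul_smul]
  congr 2
  · congr 1; funext i; congr 1; ring
  · funext i; congr 1; ring

lemma lowerAct_jmul (α : ℝ) (a : Jor) : lowerAct α (jmul α a) = - jmul α a := by
  rw [lowerAct, jmul_jone]; module

lemma strOp_jmul_single (c : Coords A) (α lam : ℝ) (i : Fin 4) :
    strOp c α lam (jmul α (Pi.single i 1)) = (-(1 / 2) : ℂ) • mulOp c α lam i := by
  have h : character α lam (jmul α (Pi.single i 1))
      = (1 / 2) * ![(lam : ℂ), lam / α, 0, 0] i := by
    rw [character, jmul_jone]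
    fin_cases i <;> simp <;> ring
  have h' : (fun j l => lowerAct α (jmul α (Pi.single i 1)) (Pi.single l 1) j)
      = fun j l => (-(1 / 2) : ℂ) * (2 * jmul α (Pi.single i 1) (Pi.single l 1) j) := by
    funext j l
    rw [lowerAct_jmul, LinearMap.neg_apply, Pi.neg_apply]; ring
  rw [strOp, mulOp, h, h', vectorField_smul, mul_smul]
  module

lemma strOp_jmul (c : Coords A) (α lam : ℝ) (a : Jor) :
    strOp c α lam (jmul α a) = ∑ i, (-(1 / 2) * a i : ℂ) • mulOp c α lam i := by
  conv_lhs => rw [← Finset.univ_sum_single a]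
  have h : ∀ i, (Pi.single i (a i) : Jor) = a i • Pi.single i 1 := fun i => by
    rw [← Pi.single_smul]; simp
  simp only [h, map_add, map_smul, Fin.sum_univ_four, strOp_add, strOp_smul, strOp_jmul_single,
    smul_smul]
  module

/-- For `T = L_a + I` a derivation kills the unit, so `T(1) = a` whereas `-L_a + I` sends the unit
to `-a`. -/
lemma lowerAct_jone (α : ℝ) (T : Module.End ℂ Jor) : lowerAct α T jone = - T jone := by
  rw [lowerAct]; simp [jmul_jone]; module

lemma lowerAct_col (α : ℝ) (T : Module.End ℂ Jor) (i : Fin 4) :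
    lowerAct α T (Pi.single 0 1) i + lowerAct α T (Pi.single 1 1) i = - T jone i := by
  rw [← Pi.add_apply, ← map_add, ← jone_eq, lowerAct_jone]; rfl

lemma isStrMatrix_of_mem {α : ℝ} {T : Module.End ℂ Jor} (hT : T ∈ str α) :
    IsStrMatrix α (fun i j => lowerAct α T (Pi.single j 1) i) := by
  obtain ⟨a, p, q, r, s, t, h⟩ := str_form hT
  rw [h]
  exact isStrMatrix_strMatrix ..

end Linear

/-! ### Conjugation of the representation inside the Lie superalgebra -/

section Representation

variable {R : Type} [CommRing R] [Algebra ℂ R] {X : Fin 2 → R} {D : Fin 2 → Derivation ℂ R R}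

/-- The commutator with `B_λ(x₁) + B_λ(x₂)` is given by the bracket with `e`. -/
lemma besselSum_schrPi (hX : ∀ i j, D i (X j) = if i = j then 1 else 0)
    (hD : ∀ a, D 0 (D 1 a) = D 1 (D 0 a)) {α : ℝ} (hα : α ≠ 0) (lam : ℝ) {Z : Triple}
    (hZ : Z ∈ tkk α) :
    besselSum (sfCoords X D (id : Fin 2 → Fin 2)) α lam
        * schrPi (sfCoords X D (id : Fin 2 → Fin 2)) α lam Z
      = schrPi (sfCoords X D (id : Fin 2 → Fin 2)) α lam Z
          * besselSum (sfCoords X D (id : Fin 2 → Fin 2)) α lam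
        + (2 * Complex.I) • schrPi (sfCoords X D (id : Fin 2 → Fin 2)) α lam
            (0, (2 : ℂ) • jmul α Z.1, - Z.2.1 jone) := by
  refine LinearMap.ext fun f => ?_
  have hI : Complex.I * Complex.I = -1 := Complex.I_mul_I
  simp only [schrPi_eq, strOp_smul, strOp_jmul]
  simp only [strOp, Module.End.mul_apply, LinearMap.add_apply, LinearMap.smul_apply,
    LinearMap.sum_apply, map_add, map_sum, map_smul, Module.End.one_apply,
    besselSum_vectorField hX hD hα lam (isStrMatrix_of_mem (mem_tkk.mp hZ)),
    besselSum_comm_bessel hX hD hα, besselSum_coord hX hα, lowerAct_col, Fin.sum_univ_four,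
    Pi.zero_apply, Pi.neg_apply, mul_zero, zero_smul, smul_add, smul_smul, add_zero, zero_add]
  have e1 : ∀ z : ℂ, 2 * Complex.I * (-(Complex.I / 2) * -z) = -z := fun z => by
    linear_combination z * hI
  simp only [e1]
  module

/-- The factor `e` plays the role of `exp(-2(x₁ + x₂)) = exp(-i π_λ(f))`, where `f` is the unit of
`D_α⁻`. Moving it to the left conjugates `π_λ(Z)` into `π_λ(exp(i ad f) Z)`, and the triple on the
right is this three-term exponential. -/
lemma schrPi_evenMul (hX : ∀ i j, D i (X j) = if i = j then 1 else 0) {e : R}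
    (he : ∀ i, D i e = -2 * e) {α : ℝ} (hα : α ≠ 0) (lam : ℝ) (Z : Triple) (f : SF R 2) :
    schrPi (sfCoords X D (id : Fin 2 → Fin 2)) α lam Z (evenMul e f)
      = evenMul e (schrPi (sfCoords X D (id : Fin 2 → Fin 2)) α lam
          (Z.1 + Complex.I • Z.2.1 jone + Z.2.2,
            Z.2.1 - (2 * Complex.I) • jmul α Z.2.2, Z.2.2) f) := by
  have hI : Complex.I * Complex.I = -1 := Complex.I_mul_I
  have hx : ∀ i, (sfCoords X D (id : Fin 2 → Fin 2)).x i (evenMul e f)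
      = evenMul e ((sfCoords X D (id : Fin 2 → Fin 2)).x i f) := by
    intro i
    fin_cases i <;> apply sf_ext <;> simp [evenMul, sfCoords] <;> ring
  have e1 : ∀ z w v : ℂ, -2 * Complex.I * (z + Complex.I * w + v)
      = -2 * Complex.I * z + 2 * w -2 * Complex.I * v := fun z w v => by
    linear_combination -2 * w * hI
  simp only [schrPi_eq, strOp_sub, strOp_smul, strOp_jmul]
  simp only [strOp, LinearMap.add_apply, LinearMap.sub_apply, LinearMap.smul_apply,
    LinearMap.sum_apply, Module.End.one_apply, hx, bessel_evenMul hX he hα,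
    vectorField_evenMul he, lowerAct_col, Fin.sum_univ_four, ← map_smul (evenMul e),
    ← map_add (evenMul e)]
  congr 1
  simp only [Pi.add_apply, Pi.smul_apply, smul_eq_mul, e1]
  module

end Representation

/-! ### Operators that commute up to a factor -/

section QComm

variable {A : Type} [AddCommGroup A] [Module ℂ A]

/-- `z T = c T z`. -/
def QComm (z : Module.End ℂ A) (c : ℂ) (T : Module.End ℂ A) : Prop := z * T = c • (T * z)

namespace QComm

variable {z S T : Module.End ℂ A} {a b : ℂ}

lemma add (hS : QComm z a S) (hT : QComm z a T) : QComm z a (S + T) := by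
  rw [QComm] at *; rw [mul_add, add_mul, hS, hT, smul_add]

lemma sub (hS : QComm z a S) (hT : QComm z a T) : QComm z a (S - T) := by
  rw [QComm] at *; rw [mul_sub, sub_mul, hS, hT, smul_sub]

lemma smul (t : ℂ) (hT : QComm z a T) : QComm z a (t • T) := by
  rw [QComm] at *; rw [mul_smul_comm, smul_mul_assoc, hT, smul_comm]

lemma mul (hS : QComm z a S) (hT : QComm z b T) : QComm z (a * b) (S * T) := by
  rw [QComm] at *
  rw [← mul_assoc, hS, smul_mul_assoc, mul_assoc, hT, mul_smul_comm, smul_smul, mul_assoc]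

lemma one : QComm z 1 (1 : Module.End ℂ A) := by simp [QComm]

lemma sum {ι : Type} {s : Finset ι} {F : ι → Module.End ℂ A} (h : ∀ i ∈ s, QComm z a (F i)) :
    QComm z a (∑ i ∈ s, F i) := by
  rw [QComm, Finset.mul_sum, Finset.sum_mul, Finset.smul_sum]
  exact Finset.sum_congr rfl h

lemma apply (hT : QComm z a T) (v : A) : z (T v) = a • T (z v) := LinearMap.congr_fun hT v

lemma of_eq (h : a = b) (hT : QComm z a T) : QComm z b T := h ▸ hT

end QComm

/-- Each Bessel operator is homogeneous: the terms built on `x ∂` only see the last derivative, and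
the four numerical hypotheses say that the mixed second-order term carries the same factor. Used for
the scaling and for the signs of an odd coordinate of the other block. -/
lemma bessel_qcomm {c : Coords A} {z : Module.End ℂ A} {a b : Fin 4 → ℂ} (α lam : ℝ)
    (hx : ∀ i, QComm z (a i) (c.x i)) (hd : ∀ i, QComm z (b i) (c.d i))
    (hab : ∀ i, a i * b i = 1) (h0 : a 1 * b 2 * b 3 = b 0) (h1 : a 0 * b 2 * b 3 = b 1)
    (h2 : a 2 * b 0 * b 1 = b 3) (h3 : a 3 * b 0 * b 1 = b 2) (i : Fin 4) :
    QComm z (![b 0, b 1, b 3, b 2] i) (bessel c α lam i) := by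
  have hxd : ∀ i, QComm z 1 (c.x i * c.d i) := fun i => ((hx i).mul (hd i)).of_eq (hab i)
  have h1' : ∀ t : ℂ, QComm z 1 (t • (1 : Module.End ℂ A)) := fun t => QComm.one.smul t
  fin_cases i
  · exact ((((((h1' _).add (hxd _)).add (hxd _)).add (hxd _)).mul (hd _)).of_eq (one_mul _)).sub
      ((((hx _).mul (hd _)).mul (hd _)).of_eq h0 |>.smul _)
  · exact ((((((h1' _).add (hxd _)).add (hxd _)).add (hxd _)).mul (hd _)).of_eq (one_mul _)).sub
      ((((hx _).mul (hd _)).mul (hd _)).of_eq h1 |>.smul _)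
  · exact ((((((h1' _).add ((hxd _).smul _)).add ((hxd _).smul _)).add ((hxd _).smul _)).mul
      (hd _)).of_eq (one_mul _)).add ((((hx _).mul (hd _)).mul (hd _)).of_eq h2)
  · exact ((((((h1' _).sub ((hxd _).smul _)).sub ((hxd _).smul _)).sub ((hxd _).smul _)).mul
      (hd _)).of_eq (one_mul _)).add ((((hx _).mul (hd _)).mul (hd _)).of_eq h3)

end QComm

/-! ### The exponential of a locally nilpotent operator -/

section LocallyNilpotent

variable {V : Type} [AddCommGroup V] [Module ℂ V]

/-- Every vector is annihilated by a power of `B`. -/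
def LocallyNilpotent (B : Module.End ℂ V) : Prop := ∀ v, ∃ n, (B ^ n) v = 0

lemma pow_apply_eq_zero {B : Module.End ℂ V} {v : V} {m n : ℕ} (h : (B ^ m) v = 0) (hmn : m ≤ n) :
    (B ^ n) v = 0 := by
  obtain ⟨k, rfl⟩ := Nat.exists_eq_add_of_le' hmn
  rw [pow_add, Module.End.mul_apply, h, map_zero]

lemma expSum_eq {B : Module.End ℂ V} {v : V} {m n : ℕ} (s : ℂ) (h : (B ^ m) v = 0)
    (hmn : m ≤ n) :
    ∑ k ∈ Finset.range n, (s ^ k / (k.factorial : ℂ)) • (B ^ k) v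
      = ∑ k ∈ Finset.range m, (s ^ k / (k.factorial : ℂ)) • (B ^ k) v := by
  symm
  apply Finset.sum_subset (Finset.range_subset_range.mpr hmn)
  intro k _ hk
  rw [pow_apply_eq_zero h (by simpa using hk), smul_zero]

open Classical in
/-- The operator `exp (s B)` for a locally nilpotent operator `B`. -/
def lexp {B : Module.End ℂ V} (hB : LocallyNilpotent B) (s : ℂ) : Module.End ℂ V where
  toFun v := ∑ k ∈ Finset.range (Nat.find (hB v)), (s ^ k / (k.factorial : ℂ)) • (B ^ k) v
  map_add' v w := by
    set N := max (Nat.find (hB v)) (max (Nat.find (hB w)) (Nat.find (hB (v + w))))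
    rw [← expSum_eq s (Nat.find_spec (hB v)) (n := N) (le_max_left _ _),
      ← expSum_eq s (Nat.find_spec (hB w)) (n := N) ((le_max_left _ _).trans (le_max_right _ _)),
      ← expSum_eq s (Nat.find_spec (hB (v + w))) (n := N)
        ((le_max_right _ _).trans (le_max_right _ _)), ← Finset.sum_add_distrib]
    simp only [map_add, smul_add]
  map_smul' t v := by
    set N := max (Nat.find (hB v)) (Nat.find (hB (t • v)))
    rw [← expSum_eq s (Nat.find_spec (hB v)) (n := N) (le_max_left _ _),
      ← expSum_eq s (Nat.find_spec (hB (t • v))) (n := N) (le_max_right _ _), Finset.smul_sum]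
    simp only [map_smul, RingHom.id_apply, smul_comm t]

variable {B : Module.End ℂ V} (hB : LocallyNilpotent B)

/-- The truncation may be placed at any index of nilpotency, so several vectors can share one
length. -/
lemma lexp_apply {v : V} {n : ℕ} (h : (B ^ n) v = 0) (s : ℂ) :
    lexp hB s v = ∑ k ∈ Finset.range n, (s ^ k / (k.factorial : ℂ)) • (B ^ k) v := by
  classical
  exact (expSum_eq s (Nat.find_spec (hB v)) (Nat.find_min' (hB v) h)).symm

lemma lexp_zero (v : V) : lexp hB 0 v = v := by
  obtain ⟨n, hn⟩ := hB v
  rw [lexp_apply hB (pow_apply_eq_zero hn n.le_succ), Finset.sum_range_succ']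
  simp

lemma lexp_mem {N : Submodule ℂ V} (hN : ∀ v ∈ N, B v ∈ N) (s : ℂ) {v : V} (hv : v ∈ N) :
    lexp hB s v ∈ N := by
  obtain ⟨n, hn⟩ := hB v
  have h : ∀ k, (B ^ k) v ∈ N := fun k => by
    induction k with
    | zero => simpa using hv
    | succ k ih => rw [pow_succ', Module.End.mul_apply]; exact hN _ ih
  rw [lexp_apply hB hn]
  exact sum_mem fun k _ => N.smul_mem _ (h k)

/-- The binomial expansion of `Bᵐ T` in iterated commutators, which stops after the second. The
exponent is `n + 2` so that all three powers of `B` are written without subtraction. -/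
lemma pow_mul_eq {T T1 T2 : Module.End ℂ V} (h0 : B * T = T * B + T1) (h1 : B * T1 = T1 * B + T2)
    (h2 : B * T2 = T2 * B) (n : ℕ) :
    B ^ (n + 2) * T = T * B ^ (n + 2) + (n + 2 : ℂ) • (T1 * B ^ (n + 1))
      + ((n + 2) * (n + 1) / 2 : ℂ) • (T2 * B ^ n) := by
  induction n with
  | zero =>
    rw [zero_add, pow_two, mul_assoc, h0, mul_add, ← mul_assoc, h0, h1, add_mul, mul_assoc]
    simp only [pow_zero, pow_one, mul_one, zero_add, Nat.cast_zero]
    module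
  | succ n ih =>
    change B ^ (n + 2 + 1) * T = _
    rw [pow_succ' B (n + 2), mul_assoc, ih]
    simp only [pow_succ', mul_add, mul_smul_comm, ← mul_assoc, h0, h1, h2, add_mul]
    push_cast
    module

lemma LocallyNilpotent.apply {T T1 T2 : Module.End ℂ V} (h0 : B * T = T * B + T1)
    (h1 : B * T1 = T1 * B + T2) (h2 : B * T2 = T2 * B) {v : V} {n : ℕ} (h : (B ^ n) v = 0) :
    (B ^ (n + 2)) (T v) = 0 := by
  have e := LinearMap.congr_fun (pow_mul_eq h0 h1 h2 n) v
  simp only [Module.End.mul_apply, LinearMap.add_apply, LinearMap.smul_apply] at e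
  rw [e, h, pow_apply_eq_zero h (by omega : n ≤ n + 1), pow_apply_eq_zero h (by omega : n ≤ n + 2)]
  simp

/-- This is `exp(sB) T exp(-sB) = exp(s ad B) T` for an operator `T` with `(ad B)³ T = 0`. -/
lemma lexp_comm {T T1 T2 : Module.End ℂ V} (h0 : B * T = T * B + T1) (h1 : B * T1 = T1 * B + T2)
    (h2 : B * T2 = T2 * B) (s : ℂ) (v : V) :
    lexp hB s (T v) = T (lexp hB s v) + s • T1 (lexp hB s v)
      + (s ^ 2 / 2) • T2 (lexp hB s v) := by
  obtain ⟨n, hn⟩ := hB v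
  have e : ∀ k : ℕ, (B ^ (k + 2)) (T v) = T ((B ^ (k + 2)) v) + (k + 2 : ℂ) • T1 ((B ^ (k + 1)) v)
      + ((k + 2) * (k + 1) / 2 : ℂ) • T2 ((B ^ k) v) :=
    fun k => LinearMap.congr_fun (pow_mul_eq h0 h1 h2 k) v
  have e0 : B (T v) = T (B v) + T1 v := LinearMap.congr_fun h0 v
  rw [lexp_apply hB (LocallyNilpotent.apply h0 h1 h2 hn)]
  -- The three sums on the right are cut at `n + 2`, `n + 1` and `n`, so that after shifting indices
  -- they match the expansion of `B^(k+2) T v` term by term.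
  conv_rhs =>
    enter [1, 1]
    rw [lexp_apply hB (pow_apply_eq_zero hn (by omega : n ≤ n + 2))]
  conv_rhs =>
    enter [1, 2]
    rw [lexp_apply hB (pow_apply_eq_zero hn (by omega : n ≤ n + 1))]
  rw [lexp_apply hB hn, Finset.sum_range_succ', Finset.sum_range_succ', Finset.sum_range_succ',
    Finset.sum_range_succ', Finset.sum_range_succ']
  simp only [e, map_add, map_sum, map_smul, smul_add, Finset.sum_add_distrib, Finset.smul_sum,
    smul_smul]
  have c1 : ∀ k : ℕ, s ^ (k + 1 + 1) / ((k + 1 + 1).factorial : ℂ) * (k + 2)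
      = s * (s ^ (k + 1) / ((k + 1).factorial : ℂ)) := fun k => by
    have h1 : ((k + 1).factorial : ℂ) ≠ 0 := by exact_mod_cast (k + 1).factorial_ne_zero
    have h2 : (k + 1 + 1 : ℂ) ≠ 0 := by exact_mod_cast (k + 1).succ_ne_zero
    rw [Nat.factorial_succ (k + 1)]
    push_cast
    field_simp
    ring
  have c2 : ∀ k : ℕ, s ^ (k + 1 + 1) / ((k + 1 + 1).factorial : ℂ) * ((k + 2) * (k + 1) / 2)
      = s ^ 2 / 2 * (s ^ k / (k.factorial : ℂ)) := fun k => by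
    have h1 : (k.factorial : ℂ) ≠ 0 := by exact_mod_cast k.factorial_ne_zero
    have h2 : (k + 1 + 1 : ℂ) ≠ 0 := by exact_mod_cast (k + 1).succ_ne_zero
    have h3 : (k + 1 : ℂ) ≠ 0 := by exact_mod_cast k.succ_ne_zero
    rw [Nat.factorial_succ (k + 1), Nat.factorial_succ k]
    push_cast
    field_simp
    ring
  simp only [c1, c2, zero_add, pow_one, pow_zero, Nat.factorial_one, Nat.factorial_zero,
    Nat.cast_one, div_one, Module.End.one_apply, e0, smul_add, one_smul, mul_one]
  abel

-- On `v` both exponentials are truncated exponential series evaluated at `B`. Their product is `1`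
-- modulo `X^(n+1)`, and `B^(n+1)` kills `v`.
open PowerSeries in
lemma lexp_lexp_neg (s : ℂ) (v : V) : lexp hB s (lexp hB (-s) v) = v := by
  obtain ⟨n, hn⟩ := hB v
  have hn' := pow_apply_eq_zero hn n.le_succ
  let φ : ℂ → PowerSeries ℂ := fun s => rescale s (exp ℂ)
  have key : ∀ (s : ℂ) (w : V), (B ^ (n + 1)) w = 0 →
      lexp hB s w = Polynomial.aeval B (trunc (n + 1) (φ s)) w := by
    intro s w hw
    rw [lexp_apply hB hw, Polynomial.aeval_eq_sum_range' (natDegree_trunc_lt _ _),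
      LinearMap.sum_apply]
    refine Finset.sum_congr rfl fun k hk => ?_
    rw [coeff_trunc, if_pos (Finset.mem_range.mp hk), LinearMap.smul_apply]
    simp [φ, coeff_exp, div_eq_mul_inv]
  have hw : (B ^ (n + 1)) (lexp hB (-s) v) = 0 := by
    rw [key _ _ hn', ← Module.End.mul_apply, ← Polynomial.aeval_X (R := ℂ) B, ← map_pow,
      Polynomial.aeval_X, ← map_mul, mul_comm, map_mul, Module.End.mul_apply, map_pow,
      Polynomial.aeval_X, hn', map_zero]
  rw [key _ _ hw, key _ _ hn', ← Module.End.mul_apply, ← map_mul]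
  have hmul : φ s * φ (-s) = 1 := by
    simp only [φ, exp_mul_exp_eq_exp_add, add_neg_cancel]
    simp
  have hdvd : Polynomial.X ^ (n + 1) ∣ trunc (n + 1) (φ s) * trunc (n + 1) (φ (-s)) - 1 := by
    rw [Polynomial.X_pow_dvd_iff]
    intro d hd
    have := coeff_mul_eq_coeff_trunc_mul_trunc (φ s) (φ (-s)) hd
    rw [hmul, ← Polynomial.coe_mul, Polynomial.coeff_coe] at this
    rw [Polynomial.coeff_sub, ← this, coeff_one, Polynomial.coeff_one, sub_self]
  obtain ⟨q, hq⟩ := hdvd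
  rw [sub_eq_iff_eq_add.mp hq, mul_comm, map_add, map_mul, map_pow, Polynomial.aeval_X, map_one,
    LinearMap.add_apply, Module.End.mul_apply, hn', map_zero, zero_add, Module.End.one_apply]

end LocallyNilpotent

/-! ### Operators on superpolynomials -/

/-- A subspace that contains `1` and is stable under the coordinates contains all
superpolynomials. -/
lemma poly_induction {N : Submodule ℂ (Poly 2 2)} (h1 : one ∈ N)
    (hx : ∀ i, ∀ f ∈ N, polyCoords.x i f ∈ N) (f : Poly 2 2) : f ∈ N := by
  have hm : ∀ (a : MvPolynomial (Fin 2) ℂ), ∀ g ∈ N, evenMul a g ∈ N := by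
    intro a
    induction a using MvPolynomial.induction_on with
    | C t =>
      intro g hg
      have : evenMul (MvPolynomial.C t) g = t • g := by
        funext S
        simp [evenMul_apply, MvPolynomial.smul_eq_C_mul]
      rw [this]
      exact N.smul_mem t hg
    | add p q hp hq =>
      intro g hg
      have : evenMul (p + q) g = evenMul p g + evenMul q g := by
        funext S
        simp [evenMul_apply, add_mul]
      rw [this]
      exact N.add_mem (hp g hg) (hq g hg)
    | mul_X p i hp =>
      intro g hg
      have : evenMul (p * MvPolynomial.X i) g = evenMul p (evenMul (MvPolynomial.X i) g) := by
        funext S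
        simp [evenMul_apply, mul_assoc]
      rw [this]
      apply hp
      fin_cases i
      · exact hx 0 g hg
      · exact hx 1 g hg
  have key : f = evenMul (f ∅) one + evenMul (f {0}) (polyCoords.x 2 one)
      + evenMul (f {1}) (polyCoords.x 3 one)
      + evenMul (f {0, 1}) (polyCoords.x 2 (polyCoords.x 3 one)) := by
    apply sf_ext <;> simp [evenMul_apply, polyCoords, sfCoords, one]
  rw [key]
  exact N.add_mem (N.add_mem (N.add_mem (hm _ _ h1) (hm _ _ (hx _ _ h1))) (hm _ _ (hx _ _ h1)))
    (hm _ _ (hx _ _ (hx _ _ h1)))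

/-- The commutator of two derivations is a derivation, and this one vanishes on the variables. -/
lemma pderiv_comm {σ : Type} (i j : σ) (a : MvPolynomial σ ℂ) :
    MvPolynomial.pderiv i (MvPolynomial.pderiv j a)
      = MvPolynomial.pderiv j (MvPolynomial.pderiv i a) := by
  classical
  have h : ⁅MvPolynomial.pderiv (R := ℂ) i, MvPolynomial.pderiv (R := ℂ) j⁆ = 0 := by
    apply MvPolynomial.derivation_ext
    intro k
    simp only [Derivation.commutator_apply, MvPolynomial.pderiv_X, Pi.single_apply]
    split_ifs <;> simp
  have := Derivation.congr_fun h a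
  rw [Derivation.commutator_apply] at this
  exact sub_eq_zero.mp this

section Poly

variable {α : ℝ} (hα : α ≠ 0) (lam : ℝ)

include hα

lemma besselSum_schrPi_poly {Z : Triple} (hZ : Z ∈ tkk α) :
    besselSum polyCoords α lam * schrPi polyCoords α lam Z
      = schrPi polyCoords α lam Z * besselSum polyCoords α lam
        + (2 * Complex.I) • schrPi polyCoords α lam (0, (2 : ℂ) • jmul α Z.1, - Z.2.1 jone) :=
  besselSum_schrPi polyCoords_hX (pderiv_comm 0 1) hα lam hZ

omit hα in
lemma mem_tkk_smul_jmul (t : ℂ) (u a x : Jor) : ((u, t • jmul α a, x) : Triple) ∈ tkk α :=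
  mem_tkk.mpr ((str α).smul_mem _ (jmul_mem_str a))

omit hα in
lemma schrPi_zero (c : Coords (Poly 2 2)) : schrPi c α lam 0 = 0 := by
  simpa using schrPi_smul c α lam 0 0

/-- The second commutator with `B` lands in `D_α⁺`, where the third one vanishes. This is the
hypothesis needed to exponentiate. -/
lemma besselSum_schrPi_poly₁ (u x : Jor) :
    besselSum polyCoords α lam * schrPi polyCoords α lam (0, (2 : ℂ) • jmul α u, x)
      = schrPi polyCoords α lam (0, (2 : ℂ) • jmul α u, x) * besselSum polyCoords α lam
        + (2 * Complex.I) • schrPi polyCoords α lam (0, 0, - (2 : ℂ) • u) := by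
  rw [besselSum_schrPi_poly hα lam (mem_tkk_smul_jmul _ _ _ _)]
  simp [jmul_jone]

lemma besselSum_schrPi_poly₂ (x : Jor) :
    besselSum polyCoords α lam * schrPi polyCoords α lam (0, 0, x)
      = schrPi polyCoords α lam (0, 0, x) * besselSum polyCoords α lam := by
  have h : ((0, 0, x) : Triple) ∈ tkk α := mem_tkk.mpr (zero_mem _)
  rw [besselSum_schrPi_poly hα lam h]
  simp [schrPi_zero, ← Prod.zero_eq_mk]

/-- The vectors killed by a power of `B` contain `1` and are stable under each coordinate, because
the third iterated commutator of `B` with a coordinate is zero. Such a subspace contains every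
superpolynomial. -/
lemma locallyNilpotent_besselSum : LocallyNilpotent (besselSum polyCoords α lam) := by
  intro f
  let N : Submodule ℂ (Poly 2 2) :=
    { carrier := {f | ∃ n, (besselSum polyCoords α lam ^ n) f = 0}
      add_mem' := by
        rintro f g ⟨m, hm⟩ ⟨n, hn⟩
        exact ⟨max m n, by rw [map_add, pow_apply_eq_zero hm (le_max_left _ _),
          pow_apply_eq_zero hn (le_max_right _ _), add_zero]⟩
      zero_mem' := ⟨0, by simp⟩
      smul_mem' := by
        rintro t f ⟨n, hn⟩
        exact ⟨n, by rw [map_smul, hn, smul_zero]⟩ }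
  refine poly_induction (N := N) ⟨1, ?_⟩ ?_ f
  · apply sf_ext <;> simp [besselSum, bessel, polyCoords, sfCoords, one]
  · rintro i f ⟨n, hn⟩
    have hZ : (((-2 * Complex.I)⁻¹ • Pi.single i 1, 0, 0) : Triple) ∈ tkk α :=
      mem_tkk.mpr (zero_mem _)
    have hx : polyCoords.x i
        = schrPi polyCoords α lam ((-2 * Complex.I)⁻¹ • Pi.single i 1, 0, 0) := by
      have h0 : strOp polyCoords α lam 0 = 0 := by
        simpa using strOp_smul polyCoords α lam 0 0
      rw [schrPi_eq, h0]
      have h1 : -(2 * Complex.I * (Complex.I * 2⁻¹)) = 1 := by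
        linear_combination -Complex.I_mul_I
      fin_cases i <;> simp [Fin.sum_univ_four, h1]
    have h0 := besselSum_schrPi_poly hα lam hZ
    refine ⟨n + 2, ?_⟩
    rw [hx]
    refine LocallyNilpotent.apply h0 (T2 := (2 * Complex.I) • (2 * Complex.I) •
      schrPi polyCoords α lam (0, 0, - (2 : ℂ) • ((-2 * Complex.I)⁻¹ • Pi.single i 1))) ?_ ?_ hn
    · rw [mul_smul_comm, besselSum_schrPi_poly₁ hα, smul_add, smul_mul_assoc]
    · rw [mul_smul_comm, mul_smul_comm, besselSum_schrPi_poly₂ hα, smul_mul_assoc, smul_mul_assoc]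

/-- The operator `exp (s (B_λ(x₁) + B_λ(x₂)))` on superpolynomials. -/
def besselExp (s : ℂ) : Module.End ℂ (Poly 2 2) := lexp (locallyNilpotent_besselSum hα lam) s

/-- Since `B = 2i π_λ(e)`, conjugation by `exp(sB)` is `exp(2is ad e)`; the triple on the right is
its value on `Z`. -/
lemma besselExp_schrPi (s : ℂ) {Z : Triple} (hZ : Z ∈ tkk α) (f : Poly 2 2) :
    besselExp hα lam s (schrPi polyCoords α lam Z f)
      = schrPi polyCoords α lam (Z.1, Z.2.1 + (4 * Complex.I * s) • jmul α Z.1,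
          Z.2.2 - (2 * Complex.I * s) • Z.2.1 jone + (4 * s ^ 2) • Z.1) (besselExp hα lam s f) := by
  have hI : Complex.I * Complex.I = -1 := Complex.I_mul_I
  rw [besselExp, lexp_comm _ (besselSum_schrPi_poly hα lam hZ)
    (T2 := (2 * Complex.I) • (2 * Complex.I) • schrPi polyCoords α lam (0, 0, - (2 : ℂ) • Z.1))
    (by rw [mul_smul_comm, besselSum_schrPi_poly₁ hα, smul_add, smul_mul_assoc])
    (by rw [mul_smul_comm, mul_smul_comm, besselSum_schrPi_poly₂ hα, smul_mul_assoc,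
      smul_mul_assoc])]
  have e : ((Z.1, Z.2.1 + (4 * Complex.I * s) • jmul α Z.1,
      Z.2.2 - (2 * Complex.I * s) • Z.2.1 jone + (4 * s ^ 2) • Z.1) : Triple)
      = Z + (2 * Complex.I * s) • (0, (2 : ℂ) • jmul α Z.1, - Z.2.1 jone)
        + (2 * Complex.I * Complex.I * s ^ 2) • (0, 0, - (2 : ℂ) • Z.1) := by
    refine Prod.ext ?_ (Prod.ext ?_ ?_)
    · simp
    · simp only [Prod.snd_add, Prod.fst_add, Prod.smul_snd, Prod.smul_fst]; module
    · simp only [Prod.snd_add, Prod.smul_snd]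
      rw [mul_assoc 2 Complex.I Complex.I, hI]; module
  rw [e, schrPi_add, schrPi_add, schrPi_smul, schrPi_smul]
  simp only [LinearMap.add_apply, LinearMap.smul_apply]
  module

end Poly

/-! ### Scaling -/

/-- The substitution `x ↦ r x` in all coordinates. -/
def scale (r : ℂ) : Module.End ℂ (Poly 2 2) where
  toFun f S := r ^ S.card • MvPolynomial.bind₁ (fun i => r • MvPolynomial.X i) (f S)
  map_add' f g := by funext S; simp
  map_smul' t f := by funext S; simp [smul_comm t]

lemma scale_apply (r : ℂ) (f : Poly 2 2) (S : Finset (Fin 2)) :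
    scale r f S = r ^ S.card • MvPolynomial.bind₁ (fun i => r • MvPolynomial.X i) (f S) := rfl

lemma scale_one (r : ℂ) : scale r one = one := by
  apply sf_ext <;> simp [scale_apply, one]

lemma scale_coord (r : ℂ) (i : Fin 4) : QComm (scale r) r (polyCoords.x i) := by
  refine LinearMap.ext fun f => ?_
  fin_cases i <;> apply sf_ext <;> simp [polyCoords, sfCoords, scale_apply, smul_smul] <;> module

lemma pderiv_bind₁_smul (r : ℂ) (i : Fin 2) (p : MvPolynomial (Fin 2) ℂ) :
    MvPolynomial.pderiv i (MvPolynomial.bind₁ (fun i => r • MvPolynomial.X i) p)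
      = r • MvPolynomial.bind₁ (fun i => r • (MvPolynomial.X i : MvPolynomial (Fin 2) ℂ))
        (MvPolynomial.pderiv i p) := by
  induction p using MvPolynomial.induction_on with
  | C t => simp
  | add p q hp hq => simp [hp, hq]
  | mul_X p j hp =>
    simp only [map_mul, Derivation.leibniz, hp, MvPolynomial.bind₁_X_right, Derivation.map_smul,
      polyCoords_hX, smul_eq_mul, map_add, smul_add]
    by_cases hij : i = j <;> simp [hij]

lemma scale_der {r : ℂ} (hr : r ≠ 0) (i : Fin 4) : QComm (scale r) r⁻¹ (polyCoords.d i) := by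
  have h2 : r⁻¹ * r ^ 2 = r := by field_simp
  have h3 : r⁻¹ * r ^ 3 = r ^ 2 := by field_simp
  refine LinearMap.ext fun f => ?_
  fin_cases i <;> apply sf_ext <;>
    simp [polyCoords, sfCoords, scale_apply, smul_smul, pderiv_bind₁_smul, hr, h2, h3,
      ← pow_succ]

/-- Scaling is the exponential of the grading: `D_α⁻` has degree `1`, the structure algebra degree
`0` and `D_α⁺` degree `-1`. -/
lemma scale_schrPi {r : ℂ} (hr : r ≠ 0) (α lam : ℝ) (Z : Triple) (f : Poly 2 2) :
    scale r (schrPi polyCoords α lam Z f)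
      = schrPi polyCoords α lam (r • Z.1, Z.2.1, r⁻¹ • Z.2.2) (scale r f) := by
  have hB : ∀ i, QComm (scale r) r⁻¹ (bessel polyCoords α lam i) := fun i =>
    (bessel_qcomm (a := fun _ => r) (b := fun _ => r⁻¹) α lam (scale_coord r) (scale_der hr)
      (fun _ => mul_inv_cancel₀ hr) (by simp [hr]) (by simp [hr]) (by simp [hr])
      (by simp [hr]) i).of_eq (by fin_cases i <;> rfl)
  have hS : QComm (scale r) 1 (strOp polyCoords α lam Z.2.1) :=
    (QComm.one.smul _).add (QComm.sum fun j _ => QComm.sum fun i _ =>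
      (((scale_coord r i).mul (scale_der hr j)).of_eq (mul_inv_cancel₀ hr)).smul _)
  simp only [schrPi_eq, LinearMap.add_apply, LinearMap.sum_apply, LinearMap.smul_apply, map_add,
    map_sum, map_smul, hS.apply, (hB _).apply, (scale_coord r _).apply, one_smul, smul_smul,
    Pi.smul_apply, smul_eq_mul]
  congr 2
  · congr 1; funext i; congr 1; ring
  · funext i; congr 1; ring

lemma scale_scale_inv {r : ℂ} (hr : r ≠ 0) (f : Poly 2 2) : scale r (scale r⁻¹ f) = f := by
  refine poly_induction (N := LinearMap.eqLocus (scale r * scale r⁻¹) 1) ?_ ?_ f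
  · rw [LinearMap.mem_eqLocus]
    simp [scale_one]
  · intro i f hf
    rw [LinearMap.mem_eqLocus, Module.End.mul_apply, Module.End.one_apply] at *
    rw [(scale_coord _ _).apply, map_smul, (scale_coord _ _).apply, hf, smul_smul,
      inv_mul_cancel₀ hr, one_smul]

/-! ### The operators on `P(ℝ^{2|2}) exp (-2 (x₁ + x₂))` -/

lemma bessel_intertwine {A A' : Type} [AddCommGroup A] [Module ℂ A] [AddCommGroup A'] [Module ℂ A']
    {c : Coords A} {c' : Coords A'} {φ : A →ₗ[ℂ] A'} (hx : ∀ i f, φ (c.x i f) = c'.x i (φ f))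
    (hd : ∀ i f, φ (c.d i f) = c'.d i (φ f)) (α lam : ℝ) (i : Fin 4) (f : A) :
    φ (bessel c α lam i f) = bessel c' α lam i (φ f) := by
  fin_cases i <;> simp [bessel, hx, hd]

lemma schrPi_intertwine {A A' : Type} [AddCommGroup A] [Module ℂ A] [AddCommGroup A'] [Module ℂ A']
    {c : Coords A} {c' : Coords A'} {φ : A →ₗ[ℂ] A'} (hx : ∀ i f, φ (c.x i f) = c'.x i (φ f))
    (hd : ∀ i f, φ (c.d i f) = c'.d i (φ f)) (α lam : ℝ) (Z : Triple) (f : A) :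
    φ (schrPi c α lam Z f) = schrPi c' α lam Z (φ f) := by
  simp only [schrPi_eq, strOp, vectorField, LinearMap.add_apply, LinearMap.sum_apply,
    LinearMap.smul_apply, Module.End.mul_apply, Module.End.one_apply, map_add, map_sum, map_smul,
    hx, hd, bessel_intertwine hx hd]

/-- A superpolynomial as a smooth superfunction. -/
def mapSmooth : Poly 2 2 →ₗ[ℂ] Smooth where
  toFun p S := toSmooth (p S)
  map_add' p q := by funext S; simp
  map_smul' t p := by funext S; simp

lemma mapSmooth_coord (i : Fin 4) (f : Poly 2 2) :
    mapSmooth (polyCoords.x i f) = smoothCoords.x i (mapSmooth f) := by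
  have hX : ∀ j, toSmooth (MvPolynomial.X j) = smoothX j := fun j => by simp [toSmooth]
  fin_cases i <;> apply sf_ext <;> simp [mapSmooth, polyCoords, smoothCoords, sfCoords, hX]

lemma mapSmooth_der (i : Fin 4) (f : Poly 2 2) :
    mapSmooth (polyCoords.d i f) = smoothCoords.d i (mapSmooth f) := by
  fin_cases i <;> apply sf_ext <;>
    simp [mapSmooth, polyCoords, smoothCoords, sfCoords, smoothD_toSmooth]

/-- The superfunction `p exp (-2 (x₁ + x₂))`. -/
def mulExpo : Poly 2 2 →ₗ[ℂ] Smooth := evenMul expo ∘ₗ mapSmooth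

lemma mulExpo_apply (p : Poly 2 2) (S : Finset (Fin 2)) :
    mulExpo p S = toSmooth (p S) * expo := mul_comm _ _

lemma schrPi_mulExpo {α : ℝ} (hα : α ≠ 0) (lam : ℝ) (Z : Triple) (p : Poly 2 2) :
    schrPi smoothCoords α lam Z (mulExpo p) = mulExpo (schrPi polyCoords α lam
      (Z.1 + Complex.I • Z.2.1 jone + Z.2.2, Z.2.1 - (2 * Complex.I) • jmul α Z.2.2, Z.2.2) p) := by
  have he : ∀ i, smoothD i expo = -2 * expo := fun i => by
    rw [smoothD_expo, Algebra.smul_def, map_neg, two_alg]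
  rw [mulExpo, LinearMap.comp_apply, LinearMap.comp_apply,
    schrPi_intertwine mapSmooth_coord mapSmooth_der]
  exact schrPi_evenMul smoothCoords_hX he hα lam Z _

/-! ### The Euler operator -/

/-- The Euler operator `∑ xᵢ ∂ᵢ` on superpolynomials. -/
def eulerOp : Module.End ℂ (Poly 2 2) := vectorField polyCoords (fun i j => if i = j then 1 else 0)

lemma eulerOp_coord (i : Fin 4) (f : Poly 2 2) :
    eulerOp (polyCoords.x i f) = polyCoords.x i (eulerOp f) + polyCoords.x i f := by
  have hm : ∀ i j : Fin 4, algebraMap ℂ (MvPolynomial (Fin 2) ℂ) (if i = j then 1 else 0)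
      = (fun i j : Fin 4 => if i = j then (1 : MvPolynomial (Fin 2) ℂ) else 0) i j := fun i j => by
    split_ifs with h <;> simp [h]
  have h00 := polyCoords_hX 0 0
  have h01 := polyCoords_hX 0 1
  have h10 := polyCoords_hX 1 0
  have h11 := polyCoords_hX 1 1
  simp only [eulerOp, polyCoords, vectorField_apply _ _ _ hm]
  fin_cases i <;> apply sf_ext <;> simp [sfCoords, h00, h01, h10, h11] <;> ring

lemma strOp_jone (α lam : ℝ) : strOp polyCoords α lam (jmul α jone)
    = ((lam + lam / α : ℂ) / 2) • 1 - eulerOp := by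
  have hc : character α lam (jmul α jone) = (lam + lam / α : ℂ) / 2 := by
    rw [character, jmul_jone]; simp [jone]
  have hv : (fun i j : Fin 4 => lowerAct α (jmul α jone) (Pi.single j 1) i)
      = fun i j => (-1 : ℂ) * (if i = j then 1 else 0) := by
    funext i j
    rw [lowerAct_jmul, jmul_jone_eq, LinearMap.neg_apply, Module.End.one_apply, Pi.neg_apply,
      Pi.single_apply]
    ring
  rw [strOp, hc, hv, vectorField_smul, eulerOp]
  module

lemma schrPi_jone_right {A : Type} [AddCommGroup A] [Module ℂ A] (c : Coords A) (α lam : ℝ) :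
    schrPi c α lam (0, 0, jone) = (-(Complex.I / 2)) • besselSum c α lam := by
  have h0 : strOp c α lam 0 = 0 := by simpa using strOp_smul c α lam 0 0
  rw [schrPi_eq, h0]
  simp [Fin.sum_univ_four, jone, besselSum, add_comm]

/-- On the copy of `sl₂` spanned by the two units and `L_1` the action uses only multiplication by
`x₁ + x₂`, the Euler operator and `B`. The factorisation behind `flow` takes place there. -/
lemma schrPi_jone (α lam : ℝ) (a b d : ℂ) (f : Poly 2 2) :
    schrPi polyCoords α lam (a • jone, b • jmul α jone, d • jone) f
      = (-2 * Complex.I * a) • (polyCoords.x 0 f + polyCoords.x 1 f)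
        + b • (((lam + lam / α : ℂ) / 2) • f - eulerOp f)
        + (-(Complex.I / 2) * d) • besselSum polyCoords α lam f := by
  rw [schrPi_eq, strOp_smul, strOp_jone]
  simp only [Fin.sum_univ_four, jone, besselSum, LinearMap.add_apply, LinearMap.smul_apply,
    LinearMap.sub_apply, Module.End.one_apply]
  simp

/-- The operator `exp (2 (x₁ + x₂)) (B_λ(x₁) + B_λ(x₂)) exp (-2 (x₁ + x₂))` on superpolynomials. -/
def conjBessel (α lam : ℝ) : Module.End ℂ (Poly 2 2) :=
  (2 * Complex.I) • schrPi polyCoords α lam (jone, (-(2 * Complex.I)) • jmul α jone, jone)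

lemma besselSum_mulExpo {α : ℝ} (hα : α ≠ 0) (lam : ℝ) (p : Poly 2 2) :
    besselSum smoothCoords α lam (mulExpo p) = mulExpo (conjBessel α lam p) := by
  have h : besselSum smoothCoords α lam
      = (2 * Complex.I) • schrPi smoothCoords α lam (0, 0, jone) := by
    rw [schrPi_jone_right, smul_smul]
    have : 2 * Complex.I * (-(Complex.I / 2)) = 1 := by linear_combination -Complex.I_mul_I
    rw [this, one_smul]
  rw [h, LinearMap.smul_apply, schrPi_mulExpo hα, conjBessel, LinearMap.smul_apply, map_smul]
  congr 5
  · simp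
  · exact Prod.ext ((zero_sub _).trans (neg_smul _ _).symm) rfl

lemma besselSum_pow_mulExpo {α : ℝ} (hα : α ≠ 0) (lam : ℝ) (p : Poly 2 2) (k : ℕ) :
    (besselSum smoothCoords α lam ^ k) (mulExpo p) = mulExpo ((conjBessel α lam ^ k) p) := by
  induction k generalizing p with
  | zero => simp
  | succ k ih => rw [pow_succ, pow_succ, Module.End.mul_apply, Module.End.mul_apply,
      besselSum_mulExpo hα, ih]

/-! ### The flow of the Bessel operator -/

/-- Evaluation of a component of a superpolynomial at a point. -/
def evalAt (x : Fin 2 → ℝ) (S : Finset (Fin 2)) : Poly 2 2 →ₗ[ℂ] ℂ where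
  toFun f := MvPolynomial.eval (fun i => (x i : ℂ)) (f S)
  map_add' f g := by simp
  map_smul' t f := by simp [MvPolynomial.smul_eval]

lemma evalAt_coord_zero_add_one (x : Fin 2 → ℝ) (S : Finset (Fin 2)) (f : Poly 2 2) :
    evalAt x S (polyCoords.x 0 f + polyCoords.x 1 f) = (x 0 + x 1 : ℂ) * evalAt x S f := by
  simp [evalAt, polyCoords, sfCoords]; ring

/-- Evaluating a component after multiplying by a coordinate is a multiple of evaluating another
component. Statements about all components at once can therefore be proved by induction over
products of coordinates. -/
lemma evalAt_coord (x : Fin 2 → ℝ) (S : Finset (Fin 2)) (i : Fin 4) :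
    ∃ (t : ℂ) (S' : Finset (Fin 2)), ∀ f, evalAt x S (polyCoords.x i f) = t * evalAt x S' f := by
  have hθ : ∀ j : Fin 2, ∃ (t : ℂ) (S' : Finset (Fin 2)),
      ∀ f, evalAt x S (thetaMul j f) = t * evalAt x S' f := by
    intro j
    by_cases h : j ∈ S
    · exact ⟨thetaSign j S, S.erase j, fun f => by
        simp [evalAt, thetaMul, h, MvPolynomial.smul_eval]⟩
    · exact ⟨0, ∅, fun f => by simp [evalAt, thetaMul, h]⟩
  fin_cases i
  · exact ⟨x 0, S, fun f => by simp [evalAt, polyCoords, sfCoords]⟩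
  · exact ⟨x 1, S, fun f => by simp [evalAt, polyCoords, sfCoords]⟩
  · exact hθ 0
  · exact hθ 1

/-- The Euler operator generates the scaling. The component stays quantified in the induction,
because an odd coordinate changes it. -/
lemma hasDerivAt_scale (x : Fin 2 → ℝ) (f : Poly 2 2) :
    ∀ (S : Finset (Fin 2)) {r : ℂ}, r ≠ 0 → HasDerivAt (fun r => evalAt x S (scale r f))
      (r⁻¹ * evalAt x S (scale r (eulerOp f))) r := by
  let N : Submodule ℂ (Poly 2 2) :=
    { carrier := {f | ∀ (S : Finset (Fin 2)) {r : ℂ}, r ≠ 0 →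
        HasDerivAt (fun r => evalAt x S (scale r f))
          (r⁻¹ * evalAt x S (scale r (eulerOp f))) r}
      add_mem' := fun {f g} hf hg S r hr => by
        simpa only [map_add, mul_add] using (hf S hr).fun_add (hg S hr)
      zero_mem' := fun S r hr => by
        simpa only [map_zero, mul_zero] using hasDerivAt_const r (0 : ℂ)
      smul_mem' := fun t f hf S r hr => by
        simpa only [map_smul, smul_eq_mul, mul_left_comm] using (hf S hr).const_mul t }
  refine poly_induction (N := N) ?_ ?_ f
  · intro S r hr
    have h : eulerOp one = 0 := by
      simp only [eulerOp, vectorField, LinearMap.sum_apply, LinearMap.smul_apply,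
        Module.End.mul_apply]
      refine Finset.sum_eq_zero fun j _ => Finset.sum_eq_zero fun i _ => ?_
      have : polyCoords.d j one = 0 := by
        fin_cases j <;> apply sf_ext <;> simp [polyCoords, sfCoords, one]
      rw [this, map_zero, smul_zero]
    simp only [h, scale_one, map_zero, mul_zero]
    exact hasDerivAt_const r _
  · intro i f hf S r hr
    obtain ⟨t, S', h⟩ := evalAt_coord x S i
    have e : ∀ (r : ℂ) (g : Poly 2 2), evalAt x S (scale r (polyCoords.x i g))
        = t * (r * evalAt x S' (scale r g)) := fun r g => by
      rw [(scale_coord r i).apply, map_smul, h, smul_eq_mul]; ring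
    simp only [e, eulerOp_coord, map_add]
    convert! ((hasDerivAt_id r).mul (hf S' hr)).const_mul t using 1
    simp only [id]
    field_simp
    ring

section Flow

variable {α : ℝ} (hα : α ≠ 0) (lam : ℝ)

-- The vector `exp(sB) p` is a polynomial in `s`, so this is the product rule, with `B` generating
-- one factor and the Euler operator the other.
include hα in
lemma hasDerivAt_scale_besselExp (x : Fin 2 → ℝ) (S : Finset (Fin 2)) (p : Poly 2 2)
    {r s : ℂ → ℂ} {r' s' t : ℂ} (hr : HasDerivAt r r' t) (hs : HasDerivAt s s' t)
    (h0 : r t ≠ 0) :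
    HasDerivAt (fun t => evalAt x S (scale (r t) (besselExp hα lam (s t) p)))
      (s' * evalAt x S (scale (r t) (besselSum polyCoords α lam (besselExp hα lam (s t) p)))
        + r' * (r t)⁻¹ * evalAt x S (scale (r t) (eulerOp (besselExp hα lam (s t) p)))) t := by
  obtain ⟨n, hn⟩ := locallyNilpotent_besselSum hα lam p
  set B := besselSum polyCoords α lam
  have e : ∀ s : ℂ, besselExp hα lam s p
      = ∑ k ∈ Finset.range (n + 1), (s ^ k / (k.factorial : ℂ)) • (B ^ k) p := fun s =>
    lexp_apply _ (pow_apply_eq_zero hn n.le_succ) s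
  have e' : B (besselExp hα lam (s t) p)
      = ∑ k ∈ Finset.range (n + 1), (k * s t ^ (k - 1) / (k.factorial : ℂ)) • (B ^ k) p := by
    -- Here `n` terms suffice: applying `B` shifts them to the indices `1, …, n` of the sum with `n
    -- + 1` terms, whose term of index `0` has the factor `k = 0`.
    rw [besselExp, lexp_apply _ hn, Finset.sum_range_succ', map_sum]
    simp only [Nat.cast_zero, zero_mul, zero_div, zero_smul, add_zero, map_smul]
    refine Finset.sum_congr rfl fun k _ => ?_
    have h1 : ((k + 1 : ℕ) : ℂ) ≠ 0 := by exact_mod_cast k.succ_ne_zero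
    rw [Nat.factorial_succ, pow_succ', Module.End.mul_apply, Nat.cast_mul,
      mul_div_mul_left _ _ h1, Nat.add_sub_cancel]
  rw [e']
  simp only [e, map_sum, map_smul, smul_eq_mul, Finset.mul_sum, ← Finset.sum_add_distrib]
  refine HasDerivAt.fun_sum fun k _ => ?_
  have h1 : HasDerivAt (fun t => s t ^ k / (k.factorial : ℂ))
      (k * s t ^ (k - 1) * s' / (k.factorial : ℂ)) t := (hs.pow k).div_const _
  have h2 := (hasDerivAt_scale x ((B ^ k) p) S h0).comp t hr
  convert! h1.mul h2 using 1
  simp only [Function.comp_apply]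
  ring

/-- The function `exp (t (B_λ(x₁) + B_λ(x₂))) (p exp (-2 (x₁ + x₂)))` of `t`. -/
def flow (x : Fin 2 → ℝ) (S : Finset (Fin 2)) (p : Poly 2 2) (t : ℂ) : ℂ :=
  (1 + 2 * t) ^ (lam + lam / α : ℂ) * Complex.exp (-2 * (1 + 2 * t)⁻¹ * (x 0 + x 1)) *
    evalAt x S (scale ((1 + 2 * t)⁻¹ ^ 2) (besselExp hα lam ((1 - (1 + 2 * t)⁻¹) / 2) p))

/-- With `τ = (1+2t)⁻¹`, `flow` is the product of `τ^(-κ)`, `exp(-2τ(x₁ + x₂))`, the scaling by `τ²`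
and `exp(((1-τ)/2) B)`: a Gauss factorisation of `exp(tB)` after multiplication by `exp(-2(x₁ +
x₂))`. Differentiating the factors yields `x₁ + x₂`, the Euler operator and `B`. The same three
terms arise when the last factor is carried past `conjBessel`. -/
lemma hasDerivAt_flow (x : Fin 2 → ℝ) (S : Finset (Fin 2)) (p : Poly 2 2) {t : ℂ}
    (ht : 0 < (1 + 2 * t).re) :
    HasDerivAt (flow hα lam x S p) (flow hα lam x S (conjBessel α lam p) t) t := by
  have hw : 1 + 2 * t ≠ 0 := fun h => by simp [h] at ht
  have hI : Complex.I * Complex.I = -1 := Complex.I_mul_I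
  set κ : ℂ := lam + lam / α with hκ
  have d0 : HasDerivAt (fun t : ℂ => 1 + 2 * t) 2 t := by
    simpa using ((hasDerivAt_id t).const_mul (2 : ℂ)).const_add 1
  have d1 : HasDerivAt (fun t : ℂ => (1 + 2 * t)⁻¹) (-2 * (1 + 2 * t)⁻¹ ^ 2) t := by
    convert! d0.inv hw using 1
    field_simp
  have d2 : HasDerivAt (fun t : ℂ => (1 + 2 * t) ^ κ)
      (2 * κ * (1 + 2 * t)⁻¹ * (1 + 2 * t) ^ κ) t := by
    convert! d0.cpow_const (c := κ) (Or.inl ht) using 1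
    rw [Complex.cpow_sub _ _ hw, Complex.cpow_one]
    field_simp
  have d3 : HasDerivAt (fun t : ℂ => Complex.exp (-2 * (1 + 2 * t)⁻¹ * (x 0 + x 1)))
      (4 * (1 + 2 * t)⁻¹ ^ 2 * (x 0 + x 1)
        * Complex.exp (-2 * (1 + 2 * t)⁻¹ * (x 0 + x 1))) t := by
    convert! ((d1.const_mul (-2)).mul_const (x 0 + x 1 : ℂ)).cexp using 1
    ring
  have d4 : HasDerivAt (fun t : ℂ => (1 + 2 * t)⁻¹ ^ 2) (-4 * (1 + 2 * t)⁻¹ ^ 3) t := by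
    convert! d1.pow 2 using 1
    push_cast
    ring
  have d5 : HasDerivAt (fun t : ℂ => (1 - (1 + 2 * t)⁻¹) / 2) ((1 + 2 * t)⁻¹ ^ 2) t := by
    convert! (d1.const_sub 1).div_const 2 using 1
    ring
  have d6 := hasDerivAt_scale_besselExp hα lam x S p d4 d5 (pow_ne_zero 2 (inv_ne_zero hw))
  have d7 := (d2.mul d3).mul d6
  -- The parameter `s = (1-τ)/2` satisfies `1 - 2s = τ`. Conjugation thus turns the coefficients `1,
  -- -2i, 1` of the three `sl₂` elements into `1, -2iτ, τ²`.
  have e : besselExp hα lam ((1 - (1 + 2 * t)⁻¹) / 2) (conjBessel α lam p)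
      = (2 * Complex.I) • schrPi polyCoords α lam ((1 : ℂ) • jone,
          (-(2 * Complex.I) * (1 + 2 * t)⁻¹) • jmul α jone, ((1 + 2 * t)⁻¹ ^ 2) • jone)
          (besselExp hα lam ((1 - (1 + 2 * t)⁻¹) / 2) p) := by
    rw [conjBessel, LinearMap.smul_apply, map_smul,
      besselExp_schrPi hα lam _ (mem_tkk_smul_jmul _ _ _ _)]
    congr 4
    · rw [one_smul]
    · refine Prod.ext ?_ ?_
      · simp only; module
      · simp only [LinearMap.smul_apply, jmul_jone, smul_smul]
        rw [show 2 * Complex.I * ((1 - (1 + 2 * t)⁻¹) / 2) * -(2 * Complex.I)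
          = 2 * (1 - (1 + 2 * t)⁻¹) by linear_combination (-2 * (1 - (1 + 2 * t)⁻¹)) * hI]
        module
  convert! d7 using 1
  simp only [flow]
  rw [e, schrPi_jone, ← hκ]
  set τ := (1 + 2 * t)⁻¹ with hτ
  have hτ0 : τ ≠ 0 := inv_ne_zero hw
  set g := besselExp hα lam ((1 - τ) / 2) p
  have hsc : evalAt x S (scale (τ ^ 2) (polyCoords.x 0 g + polyCoords.x 1 g))
      = τ ^ 2 * (x 0 + x 1) * evalAt x S (scale (τ ^ 2) g) := by
    rw [map_add, (scale_coord _ _).apply, (scale_coord _ _).apply, ← smul_add, map_smul,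
      evalAt_coord_zero_add_one, smul_eq_mul]
    ring
  simp only [Pi.mul_apply, ← hτ]
  simp only [map_smul, map_add, map_sub, smul_eq_mul] at hsc ⊢
  rw [hsc]
  have h3 : τ ^ 3 * (τ ^ 2)⁻¹ = τ := by field_simp
  clear_value κ τ
  generalize evalAt x S (scale (τ ^ 2) g) = a
  generalize evalAt x S (scale (τ ^ 2) (eulerOp g)) = b
  generalize evalAt x S (scale (τ ^ 2) (besselSum polyCoords α lam g)) = d
  generalize Complex.exp (-2 * τ * (x 0 + x 1)) = E
  generalize (1 + 2 * t) ^ κ = W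
  linear_combination (W * E * (-2 * κ * τ * a + 4 * τ * b - 4 * τ ^ 2 * (x 0 + x 1) * a
    - τ ^ 2 * d)) * hI + 4 * W * E * b * h3

end Flow

lemma toSmooth_eval (x : Fin 2 → ℝ) (q : MvPolynomial (Fin 2) ℂ) :
    ((toSmooth q : smoothAlg) : (Fin 2 → ℝ) → ℂ) x = MvPolynomial.eval (fun i => (x i : ℂ)) q := by
  induction q using MvPolynomial.induction_on with
  | C a => simp [toSmooth]
  | add p q hp hq => simp [hp, hq]
  | mul_X p j hp =>
    rw [map_mul, map_mul, ← hp, MvPolynomial.eval_X]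
    simp [toSmooth, smoothX]

/-! ### Existence and uniqueness of the superpolynomial `π_λ(C) f` -/

section PiC

variable {α : ℝ} (hα : α ≠ 0) (lam : ℝ)

lemma flow_zero (x : Fin 2 → ℝ) (S : Finset (Fin 2)) (p : Poly 2 2) :
    flow hα lam x S p 0 = Complex.exp (-2 * (x 0 + x 1)) * evalAt x S p := by
  have h : scale 1 p = p := by
    apply sf_ext <;> simp [scale_apply]
  simp [flow, besselExp, lexp_zero, h]

/-- Each derivative replaces `p` by `conjBessel p`, so the Taylor coefficients at `0` are those of
the exponential series. -/
lemma iteratedDeriv_flow (x : Fin 2 → ℝ) (S : Finset (Fin 2)) (p : Poly 2 2) (n : ℕ) :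
    iteratedDeriv n (flow hα lam x S p) 0
      = Complex.exp (-2 * (x 0 + x 1)) * evalAt x S ((conjBessel α lam ^ n) p) := by
  induction n generalizing p with
  | zero => simp [flow_zero]
  | succ n ih =>
    have h : deriv (flow hα lam x S p) =ᶠ[𝓝 0] flow hα lam x S (conjBessel α lam p) := by
      -- The derivative is known only on the half-plane where the complex power is holomorphic, so
      -- the functions are compared near `0`.
      have h0 : ∀ᶠ t : ℂ in 𝓝 0, 0 < (1 + 2 * t).re := by
        apply ContinuousAt.eventually_lt (by fun_prop) (by fun_prop)
        simp
      filter_upwards [h0] with t ht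
      exact (hasDerivAt_flow hα lam x S p ht).deriv
    rw [iteratedDeriv_succ', h.iteratedDeriv_eq, ih, pow_succ, Module.End.mul_apply]

lemma re_pos_of_mem_ball {t : ℂ} (ht : t ∈ Metric.ball (0 : ℂ) (1 / 2)) : 0 < (1 + 2 * t).re := by
  rw [mem_ball_zero_iff] at ht
  have := (abs_lt.mp ((Complex.abs_re_le_norm t).trans_lt ht)).1
  simp
  linarith

/-- The closed form is holomorphic on the disc of radius `1/2`, where `1 + 2t` has positive real
part. A holomorphic function is the sum of its Taylor series there. -/
lemma hasSum_flow (x : Fin 2 → ℝ) (S : Finset (Fin 2)) (p : Poly 2 2) {t : ℝ}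
    (ht : t ∈ Set.Ioo (0 : ℝ) (1 / 2)) :
    HasSum (fun k : ℕ => ((t ^ k / k.factorial : ℝ) : ℂ) *
      ((((bessel smoothCoords α lam 0 + bessel smoothCoords α lam 1) ^ k) (mulExpo p) S :
        smoothAlg) : (Fin 2 → ℝ) → ℂ) x) (flow hα lam x S p t) := by
  have hb : (t : ℂ) ∈ Metric.ball (0 : ℂ) (1 / 2) := by
    rw [mem_ball_zero_iff, Complex.norm_real, Real.norm_eq_abs, abs_of_pos ht.1]
    exact ht.2
  have hd : DifferentiableOn ℂ (flow hα lam x S p) (Metric.ball 0 (1 / 2)) := fun z hz =>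
    (hasDerivAt_flow hα lam x S p (re_pos_of_mem_ball hz)).differentiableAt.differentiableWithinAt
  convert! Complex.hasSum_taylorSeries_on_ball hd hb using 1
  funext k
  have h := besselSum_pow_mulExpo hα lam p k
  rw [besselSum] at h
  rw [h, mulExpo_apply, iteratedDeriv_flow, sub_zero, smul_eq_mul, smul_eq_mul]
  change _ * (((toSmooth _ : smoothAlg) : (Fin 2 → ℝ) → ℂ) x * _) = _
  rw [toSmooth_eval]
  simp only [expo, evalAt, LinearMap.coe_mk, AddHom.coe_mk]
  push_cast
  ring

/-- The operator `p ↦ π_λ(C) (p exp (-2 (x₁ + x₂)))` on superpolynomials. -/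
def piC : Module.End ℂ (Poly 2 2) :=
  ((2 : ℂ) ^ (lam + lam / α : ℂ)) • (scale (1 / 4) * besselExp hα lam (1 / 4))

/-- The point `1/2` is on the boundary of the Taylor disc but inside the half-plane where the closed
form is differentiable, so the limit is its value. There `1 + 2t = 2`, the exponential is `exp(-(x₁
+ x₂))` and cancels the prefactor, and both the scaling and the Bessel time become `1/4`. -/
lemma tendsto_flow (x : Fin 2 → ℝ) (S : Finset (Fin 2)) (p : Poly 2 2) :
    Tendsto (fun t : ℝ => Complex.exp ((x 0 : ℂ) + (x 1 : ℂ)) * flow hα lam x S p t)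
      (𝓝[<] (1 / 2)) (𝓝 (evalAt x S (piC hα lam p))) := by
  have hc : ContinuousAt (flow hα lam x S p) ((1 / 2 : ℝ) : ℂ) :=
    (hasDerivAt_flow hα lam x S p (by norm_num)).continuousAt
  have hc' : ContinuousAt (fun t : ℝ => Complex.exp ((x 0 : ℂ) + (x 1 : ℂ))
      * flow hα lam x S p t) (1 / 2) :=
    continuousAt_const.mul (ContinuousAt.comp (f := fun t : ℝ => (t : ℂ)) hc
      Complex.continuous_ofReal.continuousAt)
  have h := hc'.tendsto.mono_left (nhdsWithin_le_nhds (s := Set.Iio (1 / 2)))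
  convert! h using 2
  have e1 : (1 : ℂ) + 2 * ((1 / 2 : ℝ) : ℂ) = 2 := by push_cast; norm_num
  have e2 : (1 - (2 : ℂ)⁻¹) / 2 = 1 / 4 := by norm_num
  have e3 : (2 : ℂ)⁻¹ ^ 2 = 1 / 4 := by norm_num
  have e4 : Complex.exp ((x 0 : ℂ) + x 1) * Complex.exp (-2 * 2⁻¹ * (x 0 + x 1)) = 1 := by
    rw [← Complex.exp_add, ← Complex.exp_zero]; congr 1; ring
  rw [flow, e1, e2, e3, piC, LinearMap.smul_apply, map_smul, smul_eq_mul, Module.End.mul_apply]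
  linear_combination (-(2 : ℂ) ^ (lam + lam / α : ℂ)
    * evalAt x S (scale (1 / 4) (besselExp hα lam (1 / 4) p))) * e4

/-- A complex polynomial is determined by its values on real points, since the reals are an infinite
subset of `ℂ`. -/
lemma poly_ext_evalAt {f g : Poly 2 2} (h : ∀ S x, evalAt x S f = evalAt x S g) : f = g := by
  funext S
  refine MvPolynomial.funext_set (fun _ => Set.range ((↑) : ℝ → ℂ))
    (fun _ => Set.infinite_range_of_injective Complex.ofReal_injective) fun x hx => ?_
  choose y hy using fun i => hx i (Set.mem_univ i)
  obtain rfl : (fun i => ((y i : ℝ) : ℂ)) = x := funext hy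
  exact h S y

/-- The transform `π_λ(C) f` exists and is unique. -/
lemma isPiC_mulExpo_iff (p g : Poly 2 2) :
    IsPiC α lam (mulExpo p) g ↔ g = piC hα lam p := by
  have hev : ∀ (x : Fin 2 → ℝ) (S : Finset (Fin 2)), Tendsto (fun t : ℝ =>
      Complex.exp ((x 0 : ℂ) + (x 1 : ℂ)) * ∑' k : ℕ, ((t ^ k / k.factorial : ℝ) : ℂ) *
      ((((bessel smoothCoords α lam 0 + bessel smoothCoords α lam 1) ^ k) (mulExpo p) S :
        smoothAlg) : (Fin 2 → ℝ) → ℂ) x) (𝓝[<] (1 / 2)) (𝓝 (evalAt x S (piC hα lam p))) := by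
    intro x S
    refine (tendsto_flow hα lam x S p).congr' ?_
    filter_upwards [Ioo_mem_nhdsLT (show (0 : ℝ) < 1 / 2 by norm_num)] with t ht
    rw [(hasSum_flow hα lam x S p ht).tsum_eq]
  constructor
  · intro h
    exact poly_ext_evalAt fun S x => tendsto_nhds_unique (h S x).2 (hev x S)
  · rintro rfl S x
    exact ⟨fun t ht => (hasSum_flow hα lam x S p ht).summable, hev x S⟩

end PiC

/-! ### Canonical relations -/

section Theta

variable {R : Type} [CommRing R] [Algebra ℂ R] {n : ℕ}

lemma thetaSign_insert {i j : Fin n} {S : Finset (Fin n)} (hj : j ∉ S) :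
    thetaSign i (insert j S) = (if j < i then -1 else 1) * thetaSign i S := by
  rw [thetaSign, thetaSign, Finset.filter_insert]
  split_ifs with h
  · rw [Finset.card_insert_of_notMem (by simp [hj]), pow_succ]; ring
  · simp

lemma thetaSign_erase {i j : Fin n} {S : Finset (Fin n)} (hj : j ∈ S) :
    thetaSign i (S.erase j) = (if j < i then -1 else 1) * thetaSign i S := by
  conv_rhs => rw [← Finset.insert_erase hj]
  rw [thetaSign_insert (Finset.notMem_erase j S), ← mul_assoc]
  split_ifs <;> simp

lemma thetaSign_sq (i : Fin n) (S : Finset (Fin n)) : thetaSign i S * thetaSign i S = 1 := by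
  rw [thetaSign, ← pow_add, ← two_mul, pow_mul]; simp

/-- Exactly one of two distinct odd coordinates precedes the other. All anticommutation signs come
from here. -/
lemma ite_lt_neg {i j : Fin n} (h : i ≠ j) :
    (if i < j then (-1 : ℂ) else 1) = - (if j < i then (-1 : ℂ) else 1) := by
  rcases lt_or_gt_of_ne h with h' | h'
  · rw [if_pos h', if_neg h'.not_gt]
  · rw [if_neg h'.not_gt, if_pos h', neg_neg]

lemma thetaMul_thetaMul (i j : Fin n) :
    (thetaMul i * thetaMul j : Module.End ℂ (SF R n)) = (-1 : ℂ) • (thetaMul j * thetaMul i) := by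
  refine LinearMap.ext fun f => funext fun S => ?_
  by_cases h : i = j
  · subst h
    simp [thetaMul]
  simp only [thetaMul, Module.End.mul_apply, LinearMap.coe_mk, AddHom.coe_mk, LinearMap.smul_apply,
    Pi.smul_apply]
  by_cases hi : i ∈ S <;> by_cases hj : j ∈ S <;> simp [hi, hj, h, Ne.symm h]
  rw [thetaSign_erase hi, thetaSign_erase hj, ite_lt_neg h, Finset.erase_right_comm, smul_smul,
    smul_smul, ← neg_smul]
  congr 1
  ring

lemma thetaDer_thetaDer (i j : Fin n) :
    (thetaDer i * thetaDer j : Module.End ℂ (SF R n)) = (-1 : ℂ) • (thetaDer j * thetaDer i) := by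
  refine LinearMap.ext fun f => funext fun S => ?_
  by_cases h : i = j
  · subst h
    simp [thetaDer]
  simp only [thetaDer, Module.End.mul_apply, LinearMap.coe_mk, AddHom.coe_mk, LinearMap.smul_apply,
    Pi.smul_apply]
  by_cases hi : i ∈ S <;> by_cases hj : j ∈ S <;> simp [hi, hj, h, Ne.symm h]
  rw [thetaSign_insert hi, thetaSign_insert hj, ite_lt_neg h, Finset.insert_comm, smul_smul,
    smul_smul, ← neg_smul]
  congr 1
  ring

lemma thetaDer_thetaMul {i j : Fin n} (h : i ≠ j) :
    (thetaDer i * thetaMul j : Module.End ℂ (SF R n)) = (-1 : ℂ) • (thetaMul j * thetaDer i) := by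
  refine LinearMap.ext fun f => funext fun S => ?_
  simp only [thetaMul, thetaDer, Module.End.mul_apply, LinearMap.coe_mk, AddHom.coe_mk,
    LinearMap.smul_apply, Pi.smul_apply]
  by_cases hi : i ∈ S <;> by_cases hj : j ∈ S <;> simp [hi, hj, h, Ne.symm h]
  rw [thetaSign_erase hj, thetaSign_insert hi, ite_lt_neg h, Finset.erase_insert_of_ne h,
    smul_smul, smul_smul, ← neg_smul]
  congr 1
  ring

lemma thetaDer_thetaMul_self (i : Fin n) :
    (thetaDer i * thetaMul i : Module.End ℂ (SF R n)) = 1 + (-1 : ℂ) • (thetaMul i * thetaDer i) := by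
  refine LinearMap.ext fun f => funext fun S => ?_
  simp only [thetaMul, thetaDer, Module.End.mul_apply, LinearMap.coe_mk, AddHom.coe_mk,
    LinearMap.smul_apply, Pi.smul_apply, LinearMap.add_apply, Pi.add_apply, Module.End.one_apply]
  by_cases hi : i ∈ S
  · simp [hi, thetaSign_erase, smul_smul, thetaSign_sq]
  · simp [hi, thetaSign_insert, smul_smul, thetaSign_sq]

lemma evenOp_thetaMul (T : R →ₗ[ℂ] R) (i : Fin n) : evenOp T * thetaMul i = thetaMul i * evenOp T := by
  refine LinearMap.ext fun f => funext fun S => ?_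
  by_cases h : i ∈ S <;> simp [thetaMul, h]

lemma evenOp_thetaDer (T : R →ₗ[ℂ] R) (i : Fin n) : evenOp T * thetaDer i = thetaDer i * evenOp T := by
  refine LinearMap.ext fun f => funext fun S => ?_
  by_cases h : i ∈ S <;> simp [thetaDer, h]

end Theta

/-- The sign in the commutation of two coordinates. -/
def sgn (i j : Fin 4) : ℂ := if 2 ≤ i ∧ 2 ≤ j then -1 else 1

lemma sgn_mul_self (i j : Fin 4) : sgn i j * sgn i j = 1 := by
  rw [sgn]; split_ifs <;> simp

lemma sgn_comm (i j : Fin 4) : sgn i j = sgn j i := by simp only [sgn, and_comm]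

lemma QComm.symm {A : Type} [AddCommGroup A] [Module ℂ A] {S T : Module.End ℂ A} {i j : Fin 4}
    (h : QComm S (sgn i j) T) : QComm T (sgn i j) S := by
  rw [QComm] at *; rw [h, smul_smul, sgn_mul_self, one_smul]

section Blocks

variable {R : Type} [CommRing R] [Algebra ℂ R] {n : ℕ} {X Y : Fin 2 → R}
  {D E : Fin 2 → Derivation ℂ R R} {o u : Fin 2 → Fin n}

lemma evenOp_mul_comm (a b : R) : (evenOp (LinearMap.mulLeft ℂ a) * evenOp (LinearMap.mulLeft ℂ b) :
    Module.End ℂ (SF R n)) = evenOp (LinearMap.mulLeft ℂ b) * evenOp (LinearMap.mulLeft ℂ a) :=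
  LinearMap.ext fun f => funext fun S => mul_left_comm a b (f S)

lemma evenOp_der_comm (a : R) (d : Derivation ℂ R R) :
    (evenOp d.toLinearMap * evenOp (LinearMap.mulLeft ℂ a) : Module.End ℂ (SF R n))
      = evenOp (LinearMap.mulLeft ℂ (d a)) + evenOp (LinearMap.mulLeft ℂ a) * evenOp d.toLinearMap := by
  refine LinearMap.ext fun f => funext fun S => ?_
  simp [mul_comm, add_comm]

lemma evenOp_der_der {d e : Derivation ℂ R R} (h : ∀ a, d (e a) = e (d a)) :
    (evenOp d.toLinearMap * evenOp e.toLinearMap : Module.End ℂ (SF R n))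
      = evenOp e.toLinearMap * evenOp d.toLinearMap :=
  LinearMap.ext fun f => funext fun S => h (f S)

lemma coords_x_x (i j : Fin 4) :
    QComm ((sfCoords X D o).x i) (sgn i j) ((sfCoords Y E u).x j) := by
  fin_cases i <;> fin_cases j <;>
  simp [QComm, sfCoords, sgn, evenOp_thetaMul, evenOp_mul_comm (X _) (Y _)]
  all_goals exact thetaMul_thetaMul _ _

lemma coords_d_d (hD : ∀ i j a, D i (D j a) = D j (D i a)) (i j : Fin 4) :
    QComm ((sfCoords X D o).d i) (sgn i j) ((sfCoords X D o).d j) := by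
  fin_cases i <;> fin_cases j <;>
  simp [QComm, sfCoords, sgn, evenOp_thetaDer, evenOp_der_der (hD 0 1)]
  all_goals exact thetaDer_thetaDer _ _

lemma coords_d_x (hX : ∀ i j, D i (X j) = if i = j then 1 else 0) (ho : o 0 ≠ o 1) (i j : Fin 4) :
    (sfCoords X D o).d i * (sfCoords X D o).x j = (if i = j then 1 else 0)
      + sgn i j • ((sfCoords X D o).x j * (sfCoords X D o).d i) := by
  have h1 : (evenOp LinearMap.id : Module.End ℂ (SF R n)) = 1 := rfl
  have h0 : (evenOp 0 : Module.End ℂ (SF R n)) = 0 := rfl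
  fin_cases i <;> fin_cases j <;>
  simp [sfCoords, sgn, evenOp_thetaDer, evenOp_thetaMul, evenOp_der_comm, hX, h1, h0]
  · exact thetaDer_thetaMul_self _
  · exact thetaDer_thetaMul ho
  · exact thetaDer_thetaMul ho.symm
  · exact thetaDer_thetaMul_self _

lemma coords_x_d (hDY : ∀ i j, D i (Y j) = 0) (ho : ∀ i j, o i ≠ u j) (i j : Fin 4) :
    QComm ((sfCoords X D o).d i) (sgn i j) ((sfCoords Y E u).x j) := by
  have h0 : (evenOp 0 : Module.End ℂ (SF R n)) = 0 := rfl
  fin_cases i <;> fin_cases j <;>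
  simp [QComm, sfCoords, sgn, evenOp_thetaDer, evenOp_thetaMul, evenOp_der_comm, hDY, h0]
  all_goals exact thetaDer_thetaMul (ho _ _)

end Blocks

/-! ### The joint coordinates -/

lemma jointX_x_jointX_x (i j : Fin 4) : QComm (jointX.x i) (sgn i j) (jointX.x j) := coords_x_x i j

lemma jointX_x_jointZ_x (i j : Fin 4) : QComm (jointX.x i) (sgn i j) (jointZ.x j) := coords_x_x i j

lemma jointZ_x_jointX_x (i j : Fin 4) : QComm (jointZ.x i) (sgn i j) (jointX.x j) := coords_x_x i j

lemma jointZ_x_jointZ_x (i j : Fin 4) : QComm (jointZ.x i) (sgn i j) (jointZ.x j) := coords_x_x i j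

lemma jointX_d_jointX_d (i j : Fin 4) : QComm (jointX.d i) (sgn i j) (jointX.d j) :=
  coords_d_d (fun _ _ a => pderiv_comm _ _ a) i j

lemma jointX_d_jointX_x (i j : Fin 4) : jointX.d i * jointX.x j
    = (if i = j then 1 else 0) + sgn i j • (jointX.x j * jointX.d i) :=
  coords_d_x (fun i j => by
    rw [MvPolynomial.pderiv_X, Pi.single_apply]
    fin_cases i <;> fin_cases j <;> simp) (by simp) i j

lemma jointX_d_jointZ_x (i j : Fin 4) : QComm (jointX.d i) (sgn i j) (jointZ.x j) :=
  coords_x_d (fun i j => by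
    rw [MvPolynomial.pderiv_X, Pi.single_apply, if_neg]
    fin_cases i <;> fin_cases j <;> decide) (fun i j => by
    fin_cases i <;> fin_cases j <;> decide) i j

lemma jointZ_x_jointX_d (i j : Fin 4) : QComm (jointZ.x i) (sgn i j) (jointX.d j) := by
  rw [sgn_comm]; exact (jointX_d_jointZ_x j i).symm

lemma jointZ_x_bessel (α lam : ℝ) (i j : Fin 4) :
    QComm (jointZ.x i) (sgn i j) (bessel jointX α lam j) :=
  (bessel_qcomm (a := sgn i) (b := sgn i) α lam (jointZ_x_jointX_x i) (jointZ_x_jointX_d i)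
    (sgn_mul_self i) (by fin_cases i <;> simp [sgn]) (by fin_cases i <;> simp [sgn])
    (by fin_cases i <;> simp [sgn]) (by fin_cases i <;> simp [sgn]) j).of_eq
    (by fin_cases i <;> fin_cases j <;> simp [sgn])

/-! ### The ideal in the second block -/

/-- Each generator is homogeneous for the parity signs: `x₁x₂` and `x₃x₄` are both even, so they
pick up the same factor. -/
lemma exists_qcomm_vGen {T : Module.End ℂ (Poly 4 4)} {i : Fin 4}
    (h : ∀ j, QComm T (sgn i j) (jointZ.x j)) (α lam : ℝ) (j : Fin 4) :
    ∃ t, QComm T t (vGen jointZ α lam j) := by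
  have h2 : ∀ j k, QComm T (sgn i j * sgn i k) (jointZ.x j * jointZ.x k) := fun j k =>
    (h j).mul (h k)
  have hs : sgn i 0 * sgn i 1 = sgn i 2 * sgn i 3 := by fin_cases i <;> simp [sgn]
  by_cases hl : lam = α
  · rw [vGen, if_pos hl]
    fin_cases j
    · exact ⟨_, ((h2 0 1).smul 2).add ((h2 2 3).of_eq hs.symm)⟩
    · exact ⟨_, h2 1 1⟩
    · exact ⟨_, h2 1 2⟩
    · exact ⟨_, h2 1 3⟩
  · rw [vGen, if_neg hl]
    fin_cases j
    · exact ⟨_, ((h2 0 1).smul (2 * α)).add ((h2 2 3).of_eq hs.symm)⟩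
    · exact ⟨_, h2 0 0⟩
    · exact ⟨_, h2 0 2⟩
    · exact ⟨_, h2 0 3⟩

/-- Commuting with the generators up to a scalar is enough to preserve the ideal. This covers the
coordinates of both blocks and the derivatives in `x`, hence the Bessel operators in `x`. -/
lemma mem_stab_idealI_jointZ {T : Module.End ℂ (Poly 4 4)} {i : Fin 4}
    (h : ∀ j, QComm T (sgn i j) (jointZ.x j)) (α lam : ℝ) :
    T ∈ stab (idealI jointZ α lam) := by
  intro f hf
  refine Submodule.iSup_induction _ (motive := fun f => T f ∈ idealI jointZ α lam) hf ?_ ?_ ?_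
  · rintro j _ ⟨g, rfl⟩
    obtain ⟨t, ht⟩ := exists_qcomm_vGen h α lam j
    rw [ht.apply]
    exact Submodule.smul_mem _ _ (Submodule.mem_iSup_of_mem j ⟨_, rfl⟩)
  · rw [map_zero]; exact zero_mem _
  · intro f g hf hg
    rw [map_add]; exact add_mem hf hg

lemma schrPi_single {A : Type} [AddCommGroup A] [Module ℂ A] (c : Coords A) (α lam : ℝ)
    (i : Fin 4) : schrPi c α lam (0, 0, (2 * Complex.I) • (Pi.single i 1 : Jor))
      = bessel c α lam i := by
  have h0 : strOp c α lam 0 = 0 := by simpa using strOp_smul c α lam 0 0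
  have h1 : Complex.I * 2⁻¹ * (2 * Complex.I) = -1 := by
    linear_combination Complex.I_mul_I
  rw [schrPi_eq, h0]
  fin_cases i <;> simp [Fin.sum_univ_four, div_eq_mul_inv, h1]

lemma bessel_mem_stab {A : Type} [AddCommGroup A] [Module ℂ A] {N : Submodule ℂ A} {c : Coords A}
    (α lam : ℝ) (hx : ∀ i, c.x i ∈ stab N) (hd : ∀ i, c.d i ∈ stab N) (i : Fin 4) :
    bessel c α lam i ∈ stab N := by
  rw [← schrPi_single]
  exact schrPi_mem_stab' _ hx hd

lemma jointX_x_mem_stab (α lam : ℝ) (i : Fin 4) : jointX.x i ∈ stab (idealI jointZ α lam) :=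
  mem_stab_idealI_jointZ (jointX_x_jointZ_x i) α lam

lemma jointZ_x_mem_stab (α lam : ℝ) (i : Fin 4) : jointZ.x i ∈ stab (idealI jointZ α lam) :=
  mem_stab_idealI_jointZ (jointZ_x_jointZ_x i) α lam

lemma bessel_jointX_mem_stab (α lam : ℝ) (i : Fin 4) :
    bessel jointX α lam i ∈ stab (idealI jointZ α lam) :=
  bessel_mem_stab α lam (jointX_x_mem_stab α lam)
    (fun i => mem_stab_idealI_jointZ (jointX_d_jointZ_x i) α lam) i

/-! ### Powers of the pairing -/

/-- The commutator of `∂ᵢ` with multiplication by `x|z`. -/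
def pairingDer (α : ℝ) : Fin 4 → Module.End ℂ (Poly 4 4) :=
  ![jointZ.x 0, (α : ℂ) • jointZ.x 1, (-(1 / 2) : ℂ) • jointZ.x 3, (1 / 2 : ℂ) • jointZ.x 2]

lemma jointX_d_pairing (α : ℝ) (i : Fin 4) :
    jointX.d i * pairing α = pairing α * jointX.d i + pairingDer α i := by
  have h : ∀ j k, jointX.d i * (jointX.x j * jointZ.x k) = (if i = j then jointZ.x k else 0)
      + (sgn i j * sgn i k) • (jointX.x j * jointZ.x k * jointX.d i) := by
    intro j k
    rw [← mul_assoc, jointX_d_jointX_x, add_mul, smul_mul_assoc, mul_assoc, jointX_d_jointZ_x,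
      mul_smul_comm, smul_smul, ite_mul, one_mul, zero_mul, mul_assoc]
  simp only [pairing, mul_add, mul_sub, add_mul, sub_mul, mul_smul_comm, smul_mul_assoc, h]
  fin_cases i <;> simp [sgn, pairingDer] <;> module

lemma jointZ_x_pairing (α : ℝ) (i : Fin 4) : QComm (jointZ.x i) 1 (pairing α) := by
  have h : ∀ j k, QComm (jointZ.x i) (sgn i j * sgn i k) (jointX.x j * jointZ.x k) := fun j k =>
    (jointZ_x_jointX_x i j).mul (jointZ_x_jointZ_x i k)
  exact (((((h 0 0).of_eq (sgn_mul_self _ _))).add (((h 1 1).of_eq (sgn_mul_self _ _)).smul _)).sub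
    (((h 2 3).of_eq (by fin_cases i <;> simp [sgn])).smul _)).add
    (((h 3 2).of_eq (by fin_cases i <;> simp [sgn])).smul _)

/-- The power `(x|z)^k`. -/
def pairingPow (α : ℝ) (k : ℕ) : Poly 4 4 := (pairing α ^ k) one

lemma pairingPow_succ (α : ℝ) (k : ℕ) :
    pairingPow α (k + 1) = pairing α (pairingPow α k) := by
  rw [pairingPow, pow_succ', Module.End.mul_apply]; rfl

lemma jointX_d_one (i : Fin 4) : jointX.d i one = 0 := by
  have hT : ∀ i : Fin 4, thetaDer i (one : Poly 4 4) = 0 := by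
    intro i
    funext S
    by_cases h : i ∈ S <;> simp [thetaDer, one, h]
  have hE : ∀ i : Fin 4, evenOp (MvPolynomial.pderiv i).toLinearMap (one : Poly 4 4) = 0 := by
    intro i
    funext S
    by_cases h : S = ∅
    · subst h; simp [one]
    · simp [one, h]
  fin_cases i
  · exact hE _
  · exact hE _
  · exact hT _
  · exact hT _

lemma pairingDer_pairing (α : ℝ) (i : Fin 4) (f : Poly 4 4) :
    pairingDer α i (pairing α f) = pairing α (pairingDer α i f) := by
  have h : ∀ j, jointZ.x j (pairing α f) = pairing α (jointZ.x j f) := fun j => by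
    rw [(jointZ_x_pairing α j).apply, one_smul]
  fin_cases i <;> simp [pairingDer, h]

/-- The pairing is even and commutes with its commutator with `∂ᵢ`, so the usual power rule holds.
-/
lemma jointX_d_pairingPow (α : ℝ) (i : Fin 4) (k : ℕ) :
    jointX.d i (pairingPow α (k + 1)) = (k + 1 : ℂ) • pairingDer α i (pairingPow α k) := by
  induction k with
  | zero =>
    have h := LinearMap.congr_fun (jointX_d_pairing α i) one
    rw [pairingPow_succ]
    simp only [Module.End.mul_apply, LinearMap.add_apply, jointX_d_one, map_zero, zero_add] at h
    simpa [pairingPow] using h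
  | succ k ih =>
    have h := LinearMap.congr_fun (jointX_d_pairing α i) (pairingPow α (k + 1))
    simp only [Module.End.mul_apply, LinearMap.add_apply] at h
    rw [pairingPow_succ, h, ih, map_smul, ← pairingDer_pairing, ← pairingPow_succ]
    push_cast
    module

/-- On a function linear in `x` only the constant in the first-order part of the Bessel operator
survives, so no reduction modulo the ideal is needed. -/
lemma bessel_pairingPow_one {α lam : ℝ} (hα : α ≠ 0) (i : Fin 4) :
    bessel jointX α lam i (pairingPow α 1) = (-lam : ℂ) • jointZ.x i (pairingPow α 0) := by
  have hα' : (α : ℂ) ≠ 0 := by exact_mod_cast hα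
  have hp0 : pairingPow α 0 = one := rfl
  have h1 : ∀ i, jointX.d i (pairingPow α 1) = pairingDer α i one := fun i => by
    simpa [pairingPow] using jointX_d_pairingPow α i 0
  have h2 : ∀ i j, jointX.d i (jointZ.x j one) = 0 := fun i j => by
    rw [(jointX_d_jointZ_x i j).apply, jointX_d_one, map_zero, smul_zero]
  fin_cases i <;>
  simp only [bessel, Fin.zero_eta, Fin.mk_one, Fin.reduceFinMk, Matrix.cons_val_zero,
      Matrix.cons_val_one, Matrix.cons_val, Module.End.mul_apply, LinearMap.add_apply,
      LinearMap.sub_apply, LinearMap.smul_apply, h1, pairingDer, map_smul, h2, map_zero, smul_zero,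
      Module.End.one_apply, hp0, add_zero, sub_zero, smul_smul, zero_add]
  · rw [mul_neg, mul_div_cancel₀ _ hα']
  · congr 1; ring
  · congr 1; ring

/-! ### Expansion of powers of the pairing into monomials in the coordinates -/

section Expand

variable (α : ℝ) (k : ℕ)

lemma jointX_d_pairingPow_two (i : Fin 4) : jointX.d i (pairingPow α (k + 2))
    = (k + 2 : ℂ) • pairingDer α i (pairingPow α (k + 1)) := by
  rw [jointX_d_pairingPow]
  push_cast
  congr 1
  ring

lemma jointX_d_jointZ_x_pairingPow (i j : Fin 4) :
    jointX.d i (jointZ.x j (pairingPow α (k + 1)))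
      = (sgn i j * (k + 1) : ℂ) • jointZ.x j (pairingDer α i (pairingPow α k)) := by
  rw [(jointX_d_jointZ_x i j).apply, jointX_d_pairingPow, map_smul, smul_smul]

/-- One factor of the pairing is opened so that two coordinates `z` stand next to each other, where
the quadratic generators of the ideal can be applied. -/
lemma jointZ_x_pairingPow (i : Fin 4) : jointZ.x i (pairingPow α (k + 1))
    = jointX.x 0 (jointZ.x i (jointZ.x 0 (pairingPow α k)))
      + (α : ℂ) • jointX.x 1 (jointZ.x i (jointZ.x 1 (pairingPow α k)))
      - (sgn i 2 * 2⁻¹ : ℂ) • jointX.x 2 (jointZ.x i (jointZ.x 3 (pairingPow α k)))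
      + (sgn i 3 * 2⁻¹ : ℂ) • jointX.x 3 (jointZ.x i (jointZ.x 2 (pairingPow α k))) := by
  have h : ∀ j f, jointZ.x i (jointX.x j f) = sgn i j • jointX.x j (jointZ.x i f) := fun j f =>
    (jointZ_x_jointX_x i j).apply f
  have s0 : sgn i 0 = 1 := by fin_cases i <;> simp [sgn]
  have s1 : sgn i 1 = 1 := by fin_cases i <;> simp [sgn]
  rw [pairingPow_succ]
  simp only [pairing, LinearMap.add_apply, LinearMap.sub_apply, LinearMap.smul_apply,
    Module.End.mul_apply, map_add, map_sub, map_smul, h, s0, s1, one_smul, smul_smul]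
  module

lemma jointZ_x_swap (f : Poly 4 4) : jointZ.x 1 (jointZ.x 0 f) = jointZ.x 0 (jointZ.x 1 f) ∧
    jointZ.x 2 (jointZ.x 0 f) = jointZ.x 0 (jointZ.x 2 f) ∧
    jointZ.x 3 (jointZ.x 0 f) = jointZ.x 0 (jointZ.x 3 f) ∧
    jointZ.x 2 (jointZ.x 1 f) = jointZ.x 1 (jointZ.x 2 f) ∧
    jointZ.x 3 (jointZ.x 1 f) = jointZ.x 1 (jointZ.x 3 f) ∧
    jointZ.x 3 (jointZ.x 2 f) = (-1 : ℂ) • jointZ.x 2 (jointZ.x 3 f) ∧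
    jointZ.x 2 (jointZ.x 2 f) = 0 ∧ jointZ.x 3 (jointZ.x 3 f) = 0 := by
  have h : ∀ i j, jointZ.x i (jointZ.x j f) = sgn i j • jointZ.x j (jointZ.x i f) := fun i j =>
    (jointZ_x_jointZ_x i j).apply f
  refine ⟨?_, ?_, ?_, ?_, ?_, ?_, ?_, ?_⟩
  · simpa [sgn] using h 1 0
  · simpa [sgn] using h 2 0
  · simpa [sgn] using h 3 0
  · simpa [sgn] using h 2 1
  · simpa [sgn] using h 3 1
  · simpa [sgn] using h 3 2
  · have := h 2 2
    rw [show sgn 2 2 = -1 by simp [sgn], neg_one_smul] at this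
    exact self_eq_neg.mp this
  · have := h 3 3
    rw [show sgn 3 3 = -1 by simp [sgn], neg_one_smul] at this
    exact self_eq_neg.mp this

end Expand

/-- The generators of the ideal annihilate the quotient. -/
lemma mkQ_vGen (α lam : ℝ) (i j : Fin 4) (f : Poly 4 4) :
    (idealI jointZ α lam).mkQ (jointX.x i (vGen jointZ α lam j f)) = 0 := by
  rw [Submodule.mkQ_apply, Submodule.Quotient.mk_eq_zero]
  exact jointX_x_mem_stab α lam i _ (Submodule.mem_iSup_of_mem j ⟨f, rfl⟩)

-- Both sides are expanded into terms `xⱼ zₐ z_b (x|z)^k`, with `zₐ z_b` put in a fixed order. The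
-- ideal kills three kinds of products and replaces `z₃z₄` by a multiple of `z₁z₂`; the surviving
-- scalars are then compared.
set_option maxHeartbeats 1000000 in
lemma mkQ_bessel_pairingPow_alpha {α : ℝ} (hα : α ≠ 0) (i : Fin 4) (k : ℕ) :
    (idealI jointZ α α).mkQ (bessel jointX α α i (pairingPow α (k + 1)))
      = ((k + 1) * (k - α) : ℂ) • (idealI jointZ α α).mkQ (jointZ.x i (pairingPow α k)) := by
  have hα' : (α : ℂ) ≠ 0 := by exact_mod_cast hα
  have hα1 : (α : ℂ) / α = 1 := div_self hα'
  cases k with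
  | zero =>
    rw [bessel_pairingPow_one hα, map_smul]; simp
  | succ k =>
    set u := pairingPow α k with hu
    obtain ⟨s10, s20, s30, s21, s31, s32, s22, s33⟩ := jointZ_x_swap u
    have g0 := fun i => mkQ_vGen α α i 0 u
    have g1 := fun i => mkQ_vGen α α i 1 u
    have g2 := fun i => mkQ_vGen α α i 2 u
    have g3 := fun i => mkQ_vGen α α i 3 u
    simp only [vGen, if_true, Matrix.cons_val_zero, Matrix.cons_val_one, Matrix.cons_val,
      LinearMap.add_apply, LinearMap.smul_apply, Module.End.mul_apply, map_add, map_smul]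
      at g0 g1 g2 g3
    have g0' : ∀ i, (idealI jointZ α α).mkQ (jointX.x i (jointZ.x 2 (jointZ.x 3 u)))
        = (-2 : ℂ) • (idealI jointZ α α).mkQ (jointX.x i (jointZ.x 0 (jointZ.x 1 u))) :=
      fun i => by rw [eq_neg_of_add_eq_zero_right (g0 i)]; module
    fin_cases i <;>
    simp only [bessel, Fin.zero_eta, Fin.mk_one, Fin.reduceFinMk, Matrix.cons_val_zero,
      Matrix.cons_val_one, Matrix.cons_val, Module.End.mul_apply, LinearMap.add_apply,
      LinearMap.sub_apply, LinearMap.smul_apply, Module.End.one_apply,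
      jointX_d_pairingPow_two, pairingDer, map_smul, jointX_d_jointZ_x_pairingPow] <;>
    simp only [jointZ_x_pairingPow, map_add, map_sub, map_smul, ← hu, s10, s20, s30, s21, s31,
      s32, s22, s33, map_zero, g0', g1, g2, g3] <;>
    simp [sgn, hα1] <;> module

-- The same reduction for the other ideal, where `z₃z₄` becomes `-2α z₁z₂`. The factor is `α (k+1)(k
-- - α⁻¹)`, which explains `μ = α⁻¹` in the kernel.
set_option maxHeartbeats 1000000 in
lemma mkQ_bessel_pairingPow_one {α : ℝ} (hα : α ≠ 0) (h : (1 : ℝ) ≠ α) (i : Fin 4) (k : ℕ) :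
    (idealI jointZ α 1).mkQ (bessel jointX α 1 i (pairingPow α (k + 1)))
      = ((k + 1) * (α * k - 1) : ℂ) • (idealI jointZ α 1).mkQ (jointZ.x i (pairingPow α k)) := by
  have hα' : (α : ℂ) ≠ 0 := by exact_mod_cast hα
  have hα1 : (α : ℂ) / α = 1 := div_self hα'
  cases k with
  | zero =>
    rw [bessel_pairingPow_one hα, map_smul]; simp
  | succ k =>
    set u := pairingPow α k with hu
    obtain ⟨s10, s20, s30, s21, s31, s32, s22, s33⟩ := jointZ_x_swap u
    have g0 := fun i => mkQ_vGen α 1 i 0 u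
    have g1 := fun i => mkQ_vGen α 1 i 1 u
    have g2 := fun i => mkQ_vGen α 1 i 2 u
    have g3 := fun i => mkQ_vGen α 1 i 3 u
    simp only [vGen, if_neg h, Matrix.cons_val_zero, Matrix.cons_val_one, Matrix.cons_val,
      LinearMap.add_apply, LinearMap.smul_apply, Module.End.mul_apply, map_add, map_smul]
      at g0 g1 g2 g3
    have g0' : ∀ i, (idealI jointZ α 1).mkQ (jointX.x i (jointZ.x 2 (jointZ.x 3 u)))
        = (-(2 * α) : ℂ) • (idealI jointZ α 1).mkQ (jointX.x i (jointZ.x 0 (jointZ.x 1 u))) :=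
      fun i => by rw [eq_neg_of_add_eq_zero_right (g0 i)]; module
    fin_cases i <;>
    simp only [bessel, Fin.zero_eta, Fin.mk_one, Fin.reduceFinMk, Matrix.cons_val_zero,
      Matrix.cons_val_one, Matrix.cons_val, Module.End.mul_apply, LinearMap.add_apply,
      LinearMap.sub_apply, LinearMap.smul_apply, Module.End.one_apply,
      jointX_d_pairingPow_two, pairingDer, map_smul, jointX_d_jointZ_x_pairingPow] <;>
    simp only [jointZ_x_pairingPow, map_add, map_sub, map_smul, ← hu, s10, s20, s30, s21, s31,
      s32, s22, s33, map_zero, g0', g1, g2, g3] <;>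
    simp [sgn, hα1] <;>
    first
    | module
    | (match_scalars <;> simp only [Complex.coe_algebraMap] <;> field_simp <;> ring)

/-! ### The Bessel operators on the kernel -/

/-- The coefficients of the kernel. -/
def kernelCoeff (μ β : ℝ) (k : ℕ) : ℝ :=
  Real.Gamma (-μ) / (k.factorial * Real.Gamma (k - μ)) * β ^ k

lemma kernelCoeff_zero {μ : ℝ} (hμ : ∀ n : ℕ, μ ≠ n) (β : ℝ) : kernelCoeff μ β 0 = 1 := by
  have h : Real.Gamma (-μ) ≠ 0 := Real.Gamma_ne_zero fun m hm => hμ m (neg_injective hm)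
  simp [kernelCoeff, div_self h]

/-- The recursion is `Γ(z + 1) = z Γ(z)` at `z = k - μ`. That `μ` is not a natural number keeps `z`
away from zero and from the poles of `Γ`. -/
lemma kernelCoeff_succ {μ : ℝ} (hμ : ∀ n : ℕ, μ ≠ n) (β : ℝ) (k : ℕ) :
    kernelCoeff μ β (k + 1) * ((k + 1) * (k - μ)) = β * kernelCoeff μ β k := by
  have h0 : (k : ℝ) - μ ≠ 0 := sub_ne_zero.mpr (hμ k).symm
  have h1 : Real.Gamma (k - μ) ≠ 0 := Real.Gamma_ne_zero fun m hm =>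
    hμ (k + m) (by push_cast; linarith)
  have h2 : ((k + 1 : ℕ) : ℝ) - μ = (k - μ) + 1 := by push_cast; ring
  have h3 : ((k.factorial : ℕ) : ℝ) ≠ 0 := by exact_mod_cast k.factorial_ne_zero
  have h4 : (k : ℝ) + 1 ≠ 0 := by positivity
  rw [kernelCoeff, kernelCoeff, h2, Real.Gamma_add_one h0, Nat.factorial_succ]
  push_cast
  field_simp
  ring

lemma kernelPart_alpha (α : ℝ) (k : ℕ) :
    kernelPart α α k = (kernelCoeff α 1 k : ℂ) • pairingPow α k := by
  simp [kernelPart, kernelCoeff, pairingPow]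

lemma kernelPart_one {α : ℝ} (h : (1 : ℝ) ≠ α) (k : ℕ) :
    kernelPart α 1 k = (kernelCoeff α⁻¹ α⁻¹ k : ℂ) • pairingPow α k := by
  simp only [kernelPart, if_neg h, kernelCoeff, pairingPow]

/-- The two cases are disjoint: `α = 1` would make `α⁻¹` a natural number. Hence the tests `lam = α`
in the definitions select the intended branch. -/
lemma one_ne_of_inv_ne {α : ℝ} (h : ∀ n : ℕ, α⁻¹ ≠ n) : (1 : ℝ) ≠ α := fun h1 =>
  h 1 (by simp [← h1])

lemma kernelPart_zero {α lam : ℝ}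
    (h : (lam = α ∧ ∀ n : ℕ, α ≠ n) ∨ (lam = 1 ∧ ∀ n : ℕ, α⁻¹ ≠ n)) :
    kernelPart α lam 0 = one := by
  have h0 : pairingPow α 0 = one := rfl
  rcases h with ⟨rfl, h⟩ | ⟨rfl, h⟩
  · rw [kernelPart_alpha, kernelCoeff_zero h, h0]; simp
  · rw [kernelPart_one (one_ne_of_inv_ne h), kernelCoeff_zero h, h0]; simp

/-- Modulo the ideal in `z`, the Bessel operators act on the kernel as multiplication by `z`. -/
lemma mkQ_bessel_kernelPart {α lam : ℝ} (hα : α ≠ 0)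
    (h : (lam = α ∧ ∀ n : ℕ, α ≠ n) ∨ (lam = 1 ∧ ∀ n : ℕ, α⁻¹ ≠ n)) (i : Fin 4) (k : ℕ) :
    (idealI jointZ α lam).mkQ (bessel jointX α lam i (kernelPart α lam (k + 1)))
      = (idealI jointZ α lam).mkQ (jointZ.x i (kernelPart α lam k)) := by
  rcases h with ⟨rfl, h⟩ | ⟨rfl, h⟩
  · simp only [kernelPart_alpha, map_smul, mkQ_bessel_pairingPow_alpha hα, smul_smul]
    congr 1
    have := kernelCoeff_succ h 1 k
    rw [one_mul] at this
    exact_mod_cast this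
  · have h1 := one_ne_of_inv_ne h
    simp only [kernelPart_one h1, map_smul, mkQ_bessel_pairingPow_one hα h1, smul_smul]
    congr 1
    have h2 : kernelCoeff α⁻¹ α⁻¹ (k + 1) * ((k + 1) * (α * k - 1)) = kernelCoeff α⁻¹ α⁻¹ k := by
      have h3 := kernelCoeff_succ h α⁻¹ k
      have h4 : α * k - 1 = α * (k - α⁻¹) := by field_simp
      rw [h4, show ∀ a b c : ℝ, a * (b * (α * c)) = α * (a * (b * c)) by intros; ring, h3,
        mul_inv_cancel_left₀ hα]
    exact_mod_cast h2

/-- The innermost Bessel operator is exchanged for `zⱼ`, which is then absorbed into the family `f`.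
The new family satisfies the same hypothesis, since moving `zⱼ` past `B_λ(xᵢ)` and past `zᵢ` costs
the same sign. The order of the letters is therefore preserved. -/
lemma mkQ_bessel_word {α lam : ℝ} (l : List (Fin 4)) (f : ℕ → Poly 4 4)
    (hf : ∀ i k, (idealI jointZ α lam).mkQ (bessel jointX α lam i (f (k + 1)))
      = (idealI jointZ α lam).mkQ (jointZ.x i (f k))) :
    (idealI jointZ α lam).mkQ ((l.map (bessel jointX α lam)).prod (f l.length))
      = (idealI jointZ α lam).mkQ ((l.map jointZ.x).prod (f 0)) := by
  have hs : ∀ T ∈ stab (idealI jointZ α lam), ∀ a b,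
      (idealI jointZ α lam).mkQ a = (idealI jointZ α lam).mkQ b →
      (idealI jointZ α lam).mkQ (T a) = (idealI jointZ α lam).mkQ (T b) := by
    intro T hT a b hab
    rw [← sub_eq_zero, ← map_sub, Submodule.mkQ_apply, Submodule.Quotient.mk_eq_zero] at hab ⊢
    rw [← map_sub]
    exact hT _ hab
  induction l using List.reverseRecOn generalizing f with
  | nil => rfl
  | append_singleton l j ih =>
    have h1 := ih (fun k => jointZ.x j (f k)) fun i k => by
      have e1 : jointZ.x j (bessel jointX α lam i (f (k + 1)))
        = sgn j i • bessel jointX α lam i (jointZ.x j (f (k + 1))) :=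
          (jointZ_x_bessel α lam j i).apply _
      have e2 : jointZ.x j (jointZ.x i (f k)) = sgn j i • jointZ.x i (jointZ.x j (f k)) :=
        (jointZ_x_jointZ_x j i).apply _
      have e3 := hs _ (jointZ_x_mem_stab α lam j) _ _ (hf i k)
      rw [e1, e2, map_smul, map_smul] at e3
      have e4 := congrArg (sgn j i • ·) e3
      simpa [smul_smul, sgn_mul_self] using e4
    simp only [List.map_append, List.prod_append, List.length_append, List.map_cons, List.map_nil,
      List.prod_cons, List.prod_nil, mul_one, Module.End.mul_apply, List.length_singleton]
    rw [← h1]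
    refine hs _ (list_prod_mem fun T hT => ?_) _ _ (hf j l.length)
    obtain ⟨i, _, rfl⟩ := List.mem_map.mp hT
    exact bessel_jointX_mem_stab α lam i

/-! ### Degrees in the first block -/

/-- The Euler operator of the first block. -/
def eulerX : Module.End ℂ (Poly 4 4) := ∑ j, jointX.x j * jointX.d j

/-- The operator `T` is homogeneous of degree `n` in the first block. -/
def HasWeight (n : ℂ) (T : Module.End ℂ (Poly 4 4)) : Prop := eulerX * T = T * eulerX + n • T

namespace HasWeight

variable {m n : ℂ} {S T : Module.End ℂ (Poly 4 4)}

lemma add (hS : HasWeight n S) (hT : HasWeight n T) : HasWeight n (S + T) := by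
  rw [HasWeight] at *; rw [mul_add, add_mul, hS, hT]; module

lemma sub (hS : HasWeight n S) (hT : HasWeight n T) : HasWeight n (S - T) := by
  rw [HasWeight] at *; rw [mul_sub, sub_mul, hS, hT]; module

lemma smul (t : ℂ) (hT : HasWeight n T) : HasWeight n (t • T) := by
  rw [HasWeight] at *; rw [mul_smul_comm, smul_mul_assoc, hT]; module

lemma mul (hS : HasWeight m S) (hT : HasWeight n T) : HasWeight (m + n) (S * T) := by
  rw [HasWeight] at *
  rw [← mul_assoc, hS, add_mul, mul_assoc, hT, mul_add, smul_mul_assoc, mul_smul_comm, mul_assoc]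
  module

lemma one : HasWeight 0 1 := by simp [HasWeight]

lemma of_eq (h : m = n) (hT : HasWeight m T) : HasWeight n T := h ▸ hT

end HasWeight

lemma hasWeight_jointX_x (i : Fin 4) : HasWeight 1 (jointX.x i) := by
  have h : ∀ j, jointX.x j * jointX.d j * jointX.x i
      = (if j = i then jointX.x i else 0) + jointX.x i * (jointX.x j * jointX.d j) := by
    intro j
    have h1 : jointX.x i * jointX.x j = sgn i j • (jointX.x j * jointX.x i) :=
      jointX_x_jointX_x i j
    rw [mul_assoc, jointX_d_jointX_x, mul_add, mul_smul_comm, ← mul_assoc, ← mul_assoc, h1,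
      smul_mul_assoc, sgn_comm]
    congr 1
    split_ifs with h <;> simp [h]
  rw [HasWeight, eulerX, Finset.sum_mul, Finset.mul_sum, Finset.sum_congr rfl fun j _ => h j,
    Finset.sum_add_distrib, add_comm]
  simp

lemma hasWeight_jointX_d (i : Fin 4) : HasWeight (-1) (jointX.d i) := by
  have h : ∀ j, jointX.d i * (jointX.x j * jointX.d j)
      = (if i = j then jointX.d i else 0) + jointX.x j * jointX.d j * jointX.d i := by
    intro j
    have h1 : jointX.d i * jointX.d j = sgn i j • (jointX.d j * jointX.d i) :=
      jointX_d_jointX_d i j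
    rw [← mul_assoc, jointX_d_jointX_x, add_mul, smul_mul_assoc, mul_assoc, h1, mul_smul_comm,
      smul_smul, sgn_mul_self, one_smul, mul_assoc]
    congr 1
    split_ifs with h <;> simp [h]
  rw [HasWeight, eulerX, Finset.sum_mul, Finset.mul_sum, Finset.sum_congr rfl fun j _ => h j,
    Finset.sum_add_distrib, Finset.sum_ite_eq, if_pos (Finset.mem_univ i)]
  module

lemma hasWeight_jointZ_x (i : Fin 4) : HasWeight 0 (jointZ.x i) := by
  have h : ∀ j, QComm (jointZ.x i) 1 (jointX.x j * jointX.d j) := fun j =>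
    ((jointZ_x_jointX_x i j).mul (jointZ_x_jointX_d i j)).of_eq (sgn_mul_self i j)
  have h1 : QComm (jointZ.x i) 1 eulerX := QComm.sum fun j _ => h j
  rw [QComm, one_smul] at h1
  rw [HasWeight, h1]; simp

lemma hasWeight_bessel (α lam : ℝ) (i : Fin 4) : HasWeight (-1) (bessel jointX α lam i) := by
  have x := hasWeight_jointX_x
  have d := hasWeight_jointX_d
  have xd : ∀ i j, HasWeight 0 (jointX.x i * jointX.d j) := fun i j =>
    ((x i).mul (d j)).of_eq (by norm_num)
  have xdd : ∀ i j k, HasWeight (-1) (jointX.x i * jointX.d j * jointX.d k) := fun i j k =>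
    ((xd i j).mul (d k)).of_eq (by norm_num)
  have e : (0 + -1 : ℂ) = -1 := by norm_num
  have o : ∀ t : ℂ, HasWeight 0 (t • 1) := fun t => HasWeight.one.smul t
  fin_cases i
  · exact (((((o _).add (xd _ _)).add (xd _ _)).add (xd _ _)).mul (d _) |>.of_eq e).sub
      ((xdd _ _ _).smul _)
  · exact (((((o _).add (xd _ _)).add (xd _ _)).add (xd _ _)).mul (d _) |>.of_eq e).sub
      ((xdd _ _ _).smul _)
  · exact (((((o _).add ((xd _ _).smul _)).add ((xd _ _).smul _)).add
      ((xd _ _).smul _)).mul (d _) |>.of_eq e).add (xdd _ _ _)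
  · exact (((((o _).sub ((xd _ _).smul _)).sub ((xd _ _).smul _)).sub
      ((xd _ _).smul _)).mul (d _) |>.of_eq e).add (xdd _ _ _)

lemma hasWeight_word (α lam : ℝ) (l : List (Fin 4)) :
    HasWeight (-(l.length : ℂ)) (l.map (bessel jointX α lam)).prod := by
  induction l with
  | nil => simpa using HasWeight.one
  | cons i l ih =>
    simp only [List.map_cons, List.prod_cons, List.length_cons]
    exact ((hasWeight_bessel α lam i).mul ih).of_eq (by push_cast; ring)

lemma eulerX_pairingPow (α : ℝ) (k : ℕ) :
    eulerX (pairingPow α k) = (k : ℂ) • pairingPow α k := by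
  have hxz : ∀ i j, HasWeight 1 (jointX.x i * jointZ.x j) := fun i j =>
    ((hasWeight_jointX_x i).mul (hasWeight_jointZ_x j)).of_eq (by norm_num)
  have hp : HasWeight 1 (pairing α) :=
    (((hxz 0 0).add ((hxz 1 1).smul _)).sub ((hxz 2 3).smul _)).add ((hxz 3 2).smul _)
  induction k with
  | zero => simp [eulerX, pairingPow, jointX_d_one]
  | succ k ih =>
    have h := LinearMap.congr_fun hp (pairingPow α k)
    simp only [Module.End.mul_apply, LinearMap.add_apply, LinearMap.smul_apply, ih, map_smul] at h
    rw [pairingPow_succ, h]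
    push_cast
    module

/-! ### Restriction to `x = 0` -/

/-- Restriction to `x = 0` as a linear map. -/
def restrictX : Poly 4 4 →ₗ[ℂ] Poly 2 2 where
  toFun := atXZero
  map_add' f g := by funext T; simp [atXZero]
  map_smul' t f := by funext T; simp [atXZero]

lemma restrictX_apply (q : Poly 4 4) (T : Finset (Fin 2)) : restrictX q T = MvPolynomial.aeval
    (Fin.append (fun _ : Fin 2 => (0 : MvPolynomial (Fin 2) ℂ)) MvPolynomial.X)
    (q (T.map (Fin.natAddEmb 2))) := rfl

lemma restrictX_jointX_x (i : Fin 4) (q : Poly 4 4) : restrictX (jointX.x i q) = 0 := by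
  have hE : ∀ i : Fin 2, restrictX (evenOp (LinearMap.mulLeft ℂ
      (MvPolynomial.X (Fin.castAdd 2 i))) q) = 0 := fun i => by
    funext T
    rw [restrictX_apply, evenOp_apply, LinearMap.mulLeft_apply, map_mul, MvPolynomial.aeval_X,
      Fin.append_left, zero_mul, Pi.zero_apply]
  have hT : ∀ i : Fin 2, restrictX (thetaMul (Fin.castAdd 2 i) q) = 0 := fun i => by
    funext T
    have h : Fin.castAdd 2 i ∉ T.map (Fin.natAddEmb 2) := by
      rw [Finset.mem_map]
      rintro ⟨j, -, hj⟩
      have : 2 + (j : ℕ) = i := congrArg Fin.val hj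
      omega
    rw [restrictX_apply]
    simp only [thetaMul, LinearMap.coe_mk, AddHom.coe_mk, if_neg h, map_zero, Pi.zero_apply]
  fin_cases i
  exacts [hE 0, hE 1, hT 0, hT 1]

/-- The index sets that survive contain only odd coordinates of the second block, and the embedding
of indices preserves order, so the signs agree. -/
lemma restrictX_jointZ_x (i : Fin 4) (q : Poly 4 4) :
    restrictX (jointZ.x i q) = polyCoords.x i (restrictX q) := by
  have hE : ∀ i : Fin 2, restrictX (evenOp (LinearMap.mulLeft ℂ
      (MvPolynomial.X (Fin.natAdd 2 i))) q)
      = evenOp (LinearMap.mulLeft ℂ (MvPolynomial.X i)) (restrictX q) := fun i => by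
    funext T
    rw [restrictX_apply, evenOp_apply, evenOp_apply, LinearMap.mulLeft_apply,
      LinearMap.mulLeft_apply, map_mul, MvPolynomial.aeval_X, Fin.append_right, restrictX_apply]
  have hT : ∀ i : Fin 2, restrictX (thetaMul (Fin.natAdd 2 i) q) = thetaMul i (restrictX q) :=
      fun i => by
    funext T
    have h : Fin.natAdd 2 i ∈ T.map (Fin.natAddEmb 2) ↔ i ∈ T :=
      Finset.mem_map' (Fin.natAddEmb 2)
    have hs : thetaSign (Fin.natAdd 2 i) (T.map (Fin.natAddEmb 2)) = thetaSign i T := by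
      rw [thetaSign, thetaSign, Finset.filter_map, Finset.card_map]
      congr 2
      refine Finset.filter_congr fun j _ => ?_
      change 2 + (j : ℕ) < 2 + (i : ℕ) ↔ (j : ℕ) < i
      omega
    have he : (T.map (Fin.natAddEmb 2)).erase (Fin.natAdd 2 i)
        = (T.erase i).map (Fin.natAddEmb 2) := (Finset.map_erase (Fin.natAddEmb 2) T i).symm
    rw [restrictX_apply]
    simp only [thetaMul, LinearMap.coe_mk, AddHom.coe_mk, h, hs, he]
    split_ifs
    · rw [map_smul, restrictX_apply]
    · rw [map_zero]
  fin_cases i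
  exacts [hE 0, hE 1, hT 0, hT 1]

lemma restrictX_one : restrictX one = one := by
  funext T
  rw [restrictX_apply]
  by_cases h : T = ∅
  · subst h; simp [one]
  · simp [one, h]

lemma restrictX_idealI {α lam : ℝ} {q : Poly 4 4} (hq : q ∈ idealI jointZ α lam) :
    restrictX q ∈ idealI polyCoords α lam := by
  refine Submodule.iSup_induction _ (motive := fun q => restrictX q ∈ idealI polyCoords α lam)
    hq ?_ ?_ ?_
  · rintro j _ ⟨g, rfl⟩
    refine Submodule.mem_iSup_of_mem j ⟨restrictX g, ?_⟩
    by_cases hl : lam = α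
    · simp only [vGen, if_pos hl]
      fin_cases j <;> simp [restrictX_jointZ_x]
    · simp only [vGen, if_neg hl]
      fin_cases j <;> simp [restrictX_jointZ_x]
  · rw [map_zero]; exact zero_mem _
  · intro f g hf hg
    rw [map_add]; exact add_mem hf hg

lemma restrictX_eulerX (q : Poly 4 4) : restrictX (eulerX q) = 0 := by
  simp [eulerX, restrictX_jointX_x]

/-- The result is an eigenvector of the Euler operator in `x`, with eigenvalue the difference of `k`
and the length of the word. An image of that Euler operator vanishes at `x = 0`. -/
lemma restrictX_word_pairingPow (α lam : ℝ) {l : List (Fin 4)} {k : ℕ} (h : k ≠ l.length) :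
    restrictX ((l.map (bessel jointX α lam)).prod (pairingPow α k)) = 0 := by
  have h1 := LinearMap.congr_fun (hasWeight_word α lam l) (pairingPow α k)
  simp only [Module.End.mul_apply, LinearMap.add_apply, LinearMap.smul_apply, eulerX_pairingPow,
    map_smul] at h1
  have h2 := congrArg restrictX h1
  rw [restrictX_eulerX, map_add, map_smul, map_smul, ← add_smul, eq_comm, smul_eq_zero] at h2
  refine h2.resolve_left fun h3 => h ?_
  have h4 : (k : ℂ) = l.length := by linear_combination h3
  exact_mod_cast h4

/-! ### The product with the kernel -/

lemma conjCoeff_smul_real {m n : ℕ} (r : ℝ) {q : Poly m n} (hq : conjCoeff q = q) :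
    conjCoeff ((r : ℂ) • q) = (r : ℂ) • q := by
  funext S
  have h : MvPolynomial.map (starRingEnd ℂ) (q S) = q S := congrFun hq S
  simp [conjCoeff, MvPolynomial.smul_eq_C_mul, h]

lemma conjCoeff_add {m n : ℕ} {p q : Poly m n} (hp : conjCoeff p = p) (hq : conjCoeff q = q) :
    conjCoeff (p + q) = p + q := by
  funext S
  have h : MvPolynomial.map (starRingEnd ℂ) (p S) = p S := congrFun hp S
  have h' : MvPolynomial.map (starRingEnd ℂ) (q S) = q S := congrFun hq S
  simp [conjCoeff, h, h']

lemma conjCoeff_coord {m n : ℕ} (a : Fin 2 → Fin m) (D) (o : Fin 2 → Fin n) (i : Fin 4)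
    {q : Poly m n} (hq : conjCoeff q = q) :
    conjCoeff ((sfCoords (fun i => MvPolynomial.X (a i)) D o).x i q)
      = (sfCoords (fun i => MvPolynomial.X (a i)) D o).x i q := by
  have h : ∀ S, MvPolynomial.map (starRingEnd ℂ) (q S) = q S := fun S => congrFun hq S
  have hE : ∀ i, conjCoeff (evenOp (LinearMap.mulLeft ℂ (MvPolynomial.X (a i))) q)
      = evenOp (LinearMap.mulLeft ℂ (MvPolynomial.X (a i))) q := fun i => by
    funext S
    simp [conjCoeff, h]
  have hT : ∀ i : Fin n, conjCoeff (thetaMul i q) = thetaMul i q := fun i => by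
    funext S
    by_cases hi : i ∈ S <;>
    simp [conjCoeff, thetaMul, thetaSign, hi, h, MvPolynomial.smul_eq_C_mul]
  fin_cases i
  exacts [hE 0, hE 1, hT _, hT _]

lemma conjCoeff_pairingPow (α : ℝ) (k : ℕ) : conjCoeff (pairingPow α k) = pairingPow α k := by
  induction k with
  | zero =>
    funext S
    by_cases h : S = ∅
    · subst h; simp [conjCoeff, pairingPow, one]
    · simp [conjCoeff, pairingPow, one, h]
  | succ k ih =>
    have h : ∀ i j, conjCoeff (jointX.x i (jointZ.x j (pairingPow α k)))
        = jointX.x i (jointZ.x j (pairingPow α k)) := fun i j =>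
      conjCoeff_coord _ _ _ i (conjCoeff_coord _ _ _ j ih)
    have e : pairing α (pairingPow α k) = jointX.x 0 (jointZ.x 0 (pairingPow α k))
        + (α : ℂ) • jointX.x 1 (jointZ.x 1 (pairingPow α k))
        + ((-2⁻¹ : ℝ) : ℂ) • jointX.x 2 (jointZ.x 3 (pairingPow α k))
        + ((2⁻¹ : ℝ) : ℂ) • jointX.x 3 (jointZ.x 2 (pairingPow α k)) := by
      simp only [pairing, LinearMap.add_apply, LinearMap.sub_apply, LinearMap.smul_apply,
        Module.End.mul_apply]
      push_cast
      module
    rw [pairingPow_succ, e]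
    exact conjCoeff_add (conjCoeff_add (conjCoeff_add (h _ _) (conjCoeff_smul_real _ (h _ _)))
      (conjCoeff_smul_real _ (h _ _))) (conjCoeff_smul_real _ (h _ _))

lemma exists_kernelPart (α lam : ℝ) (k : ℕ) :
    ∃ r : ℝ, kernelPart α lam k = (r : ℂ) • pairingPow α k := ⟨_, rfl⟩

/-- All coefficients of the kernel are real, so the conjugation in the product has no effect on it.
-/
lemma conjCoeff_kernelPart (α lam : ℝ) (k : ℕ) :
    conjCoeff (kernelPart α lam k) = kernelPart α lam k := by
  obtain ⟨r, hr⟩ := exists_kernelPart α lam k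
  rw [hr, conjCoeff_smul_real r (conjCoeff_pairingPow α k)]

/-- The word in the coordinates that represents a monomial. -/
def wordOf (S : Finset (Fin 2)) (m : Fin 2 →₀ ℕ) : List (Fin 4) :=
  List.replicate (m 0) 0 ++ List.replicate (m 1) 1 ++ (if 0 ∈ S then [2] else [])
    ++ (if 1 ∈ S then [3] else [])

lemma wordOf_prod {A : Type} [AddCommGroup A] [Module ℂ A] (T : Fin 4 → Module.End ℂ A)
    (S : Finset (Fin 2)) (m : Fin 2 →₀ ℕ) : ((wordOf S m).map T).prod
      = T 0 ^ m 0 * T 1 ^ m 1 * (if 0 ∈ S then T 2 else 1) * (if 1 ∈ S then T 3 else 1) := by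
  rw [wordOf]
  split_ifs <;> simp [mul_assoc]

lemma evenOp_mulLeft_pow {R : Type} [CommRing R] [Algebra ℂ R] {n : ℕ} (a : R) (k : ℕ) :
    (evenOp (LinearMap.mulLeft ℂ a) : Module.End ℂ (SF R n)) ^ k
      = evenOp (LinearMap.mulLeft ℂ (a ^ k)) := by
  induction k with
  | zero => refine LinearMap.ext fun f => funext fun S => ?_; simp
  | succ k ih =>
    refine LinearMap.ext fun f => funext fun S => ?_
    rw [pow_succ', ih]
    simp [pow_succ', mul_assoc]

/-- The odd letters occur in the same order as in `θ_S`, so no sign appears. -/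
lemma wordOf_one (S : Finset (Fin 2)) (m : Fin 2 →₀ ℕ) :
    ((wordOf S m).map polyCoords.x).prod one = Pi.single S (MvPolynomial.monomial m 1) := by
  have hm : MvPolynomial.monomial m (1 : ℂ) = MvPolynomial.X 0 ^ m 0 * MvPolynomial.X 1 ^ m 1 := by
    rw [MvPolynomial.monomial_eq, Finsupp.prod_fintype _ _ (by simp)]
    simp
  rw [wordOf_prod, hm]
  rcases finset_cases S with rfl | rfl | rfl | rfl <;>
  apply sf_ext <;>
  simp [polyCoords, sfCoords, evenOp_mulLeft_pow, one]

lemma poly_eq_sum (p : Poly 2 2) : p = ∑ S : Finset (Fin 2), ∑ m ∈ (p S).support,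
    MvPolynomial.coeff m (p S) • ((wordOf S m).map polyCoords.x).prod one := by
  have h : ∀ S, ∑ m ∈ (p S).support, MvPolynomial.coeff m (p S) •
      ((wordOf S m).map polyCoords.x).prod one = Pi.single S (p S) := by
    intro S
    simp only [wordOf_one]
    conv_rhs => rw [MvPolynomial.as_sum (p S)]
    funext T
    by_cases hT : T = S
    · subst hT
      simp [MvPolynomial.smul_monomial]
    · simp [hT]
  simp only [h]
  exact (Finset.univ_sum_single p).symm

lemma restrictX_zword (l : List (Fin 4)) (q : Poly 4 4) :
    restrictX ((l.map jointZ.x).prod q) = (l.map polyCoords.x).prod (restrictX q) := by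
  induction l with
  | nil => rfl
  | cons i l ih => simp [restrictX_jointZ_x, ih]

/-- The product with the kernel reproduces superpolynomials modulo the ideal. -/
lemma kernelTransform_eq {α lam : ℝ} (hα : α ≠ 0)
    (h : (lam = α ∧ ∀ n : ℕ, α ≠ n) ∨ (lam = 1 ∧ ∀ n : ℕ, α⁻¹ ≠ n)) (p : Poly 2 2) :
    kernelTransform α lam p = (idealI polyCoords α lam).mkQ p := by
  set w : Finset (Fin 2) → (Fin 2 →₀ ℕ) → ℕ → Poly 2 2 := fun S m k => restrictX
    (((wordOf S m).map (bessel jointX α lam)).prod (kernelPart α lam k)) with hw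
  have hw0 : ∀ S m k, k ≠ (wordOf S m).length → w S m k = 0 := fun S m k hk => by
    obtain ⟨r, hr⟩ := exists_kernelPart α lam k
    simp only [hw, hr, map_smul, restrictX_word_pairingPow α lam hk, smul_zero]
  have hfin : ∀ S m (t : ℂ), (Function.support fun k => t • w S m k).Finite := fun S m t =>
    (Set.finite_singleton (wordOf S m).length).subset fun k hk => by
      by_contra hne
      exact hk (by simp [hw0 S m k hne])
  have hB : ∀ k, besselFischer α lam p (kernelPart α lam k) = ∑ S : Finset (Fin 2),
      ∑ m ∈ (p S).support, MvPolynomial.coeff m (p S) • w S m k := fun k => by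
    rw [besselFischer, conjCoeff_kernelPart]
    change restrictX _ = _
    simp only [besselSubst, LinearMap.sum_apply, LinearMap.smul_apply, map_sum, map_smul, hw,
      wordOf_prod]
  have hmk : ∀ S m, (idealI polyCoords α lam).mkQ (w S m (wordOf S m).length)
      = (idealI polyCoords α lam).mkQ (((wordOf S m).map polyCoords.x).prod one) := fun S m => by
    have h1 := mkQ_bessel_word (α := α) (lam := lam) (wordOf S m) (kernelPart α lam)
      (mkQ_bessel_kernelPart hα h)
    rw [← sub_eq_zero, ← map_sub, Submodule.mkQ_apply, Submodule.Quotient.mk_eq_zero] at h1 ⊢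
    have h2 := restrictX_idealI h1
    rwa [map_sub, restrictX_zword, kernelPart_zero h, restrictX_one] at h2
  have hsum : ∑ᶠ k, besselFischer α lam p (kernelPart α lam k) = ∑ S : Finset (Fin 2),
      ∑ m ∈ (p S).support, MvPolynomial.coeff m (p S) • w S m (wordOf S m).length := by
    simp only [hB]
    -- For each monomial at most one degree `k` contributes, namely the length of its word, so the
    -- supports are finite and the sums may be exchanged.
    rw [finsum_sum_comm _ _ fun S _ => ?_]
    · refine Finset.sum_congr rfl fun S _ => ?_
      rw [finsum_sum_comm _ _ fun m _ => hfin S m _]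
      refine Finset.sum_congr rfl fun m _ => ?_
      exact finsum_eq_single _ _ fun k hk => by rw [hw0 S m k hk, smul_zero]
    · refine (Set.Finite.biUnion (p S).support.finite_toSet
        fun m _ => hfin S m (MvPolynomial.coeff m (p S))).subset fun k hk => ?_
      by_contra hne
      simp only [Set.mem_iUnion, not_exists, Function.mem_support, not_not] at hne
      exact hk (Finset.sum_eq_zero fun m hm => hne m hm)
  conv_rhs => rw [poly_eq_sum p]
  rw [kernelTransform, hsum]
  simp only [map_sum, map_smul, hmk]

/-! ### The intertwining property -/

lemma cayley_eq (α : ℝ) (X : Triple) : cayley α X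
    = ((1 / 4 : ℂ) • (X.1 + Complex.I • X.2.1 jone + X.2.2),
      X.2.1 + jmul α (Complex.I • X.1 - X.2.1 jone - Complex.I • X.2.2),
      X.1 - Complex.I • X.2.1 jone + X.2.2) := by
  have hI : Complex.I ^ 2 = -1 := Complex.I_sq
  have he : expAd α Complex.I eElt X = (X.1, X.2.1 + (2 * Complex.I) • jmul α X.1,
      X.1 - Complex.I • X.2.1 jone + X.2.2) := by
    simp only [expAd, Finset.sum_range_succ, Finset.sum_range_zero, Function.iterate_succ,
      Function.iterate_zero, Function.comp_apply, id, bracket_eElt, hI]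
    simp only [Prod.smul_mk, Prod.mk_add_mk, LinearMap.smul_apply, jmul_jone, map_zero,
      LinearMap.zero_apply, Nat.factorial, pow_zero, pow_one]
    ext i <;> simp <;> ring
  have hf : ∀ Y : Triple, expAd α (Complex.I / 2) fElt Y
      = (Y.1 + (Complex.I / 2) • Y.2.1 jone + (1 / 4 : ℂ) • Y.2.2,
        Y.2.1 - Complex.I • jmul α Y.2.2, Y.2.2) := by
    intro Y
    simp only [expAd, Finset.sum_range_succ, Finset.sum_range_zero, Function.iterate_succ,
      Function.iterate_zero, Function.comp_apply, id, bracket_fElt, div_pow, hI]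
    simp only [Prod.smul_mk, Prod.mk_add_mk, LinearMap.smul_apply, jmul_jone, map_zero,
      LinearMap.zero_apply, Nat.factorial, pow_zero, pow_one]
    ext i <;> simp <;> ring
  rw [cayley, he, hf]
  simp only [LinearMap.add_apply, LinearMap.smul_apply, jmul_jone, map_add, map_sub, map_smul]
  refine Prod.ext ?_ (Prod.ext ?_ rfl)
  · match_scalars <;> first | ring1 | linear_combination Complex.I_sq
  · match_scalars <;> first | ring1 | linear_combination Complex.I_sq

/-- This gives a preimage of `D_α⁻` under the Cayley transform, so that multiplication by a
coordinate is an operator of `ρ_λ`. -/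
lemma cayley_lower (α : ℝ) (u : Jor) :
    cayley α (u, (-(2 * Complex.I)) • jmul α u, u) = (u, 0, 0) := by
  rw [cayley_eq]
  simp only [LinearMap.smul_apply, jmul_jone]
  refine Prod.ext ?_ (Prod.ext ?_ ?_)
  · match_scalars; linear_combination (-1 / 2 : ℂ) * Complex.I_sq
  · simp only [map_sub, map_smul]
    module
  · match_scalars; linear_combination (2 : ℂ) * Complex.I_sq

/-- The inner triple is `exp(i ad f) Z`, the effect of the exponential function. Then `exp(B/4)`
contributes `exp((i/2) ad e)` and the scaling by `1/4` the grading automorphism. The composite of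
the three coincides with `exp((i/2) ad f) exp(i ad e)`. -/
lemma piC_schrPi {α : ℝ} (hα : α ≠ 0) (lam : ℝ) {Z : Triple} (hZ : Z ∈ tkk α) (p : Poly 2 2) :
    piC hα lam (schrPi polyCoords α lam
      (Z.1 + Complex.I • Z.2.1 jone + Z.2.2, Z.2.1 - (2 * Complex.I) • jmul α Z.2.2, Z.2.2) p)
      = schrPi polyCoords α lam (cayley α Z) (piC hα lam p) := by
  have hZ' : ((Z.1 + Complex.I • Z.2.1 jone + Z.2.2, Z.2.1 - (2 * Complex.I) • jmul α Z.2.2,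
      Z.2.2) : Triple) ∈ tkk α :=
    mem_tkk.mpr (sub_mem (mem_tkk.mp hZ) ((str α).smul_mem _ (jmul_mem_str _)))
  simp only [piC, LinearMap.smul_apply, Module.End.mul_apply, map_smul,
    besselExp_schrPi hα lam _ hZ', scale_schrPi (show (1 / 4 : ℂ) ≠ 0 by norm_num)]
  rw [cayley_eq]
  congr 4
  simp only [LinearMap.sub_apply, LinearMap.smul_apply, jmul_jone, map_add, map_sub, map_smul]
  refine Prod.ext ?_ ?_
  · match_scalars <;> first | ring1 | linear_combination Complex.I_sq
  · match_scalars <;> first | ring1 | linear_combination (4 : ℂ) * Complex.I_sq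

/-! ### The transform preserves the ideal -/

/-- The generators are homogeneous of degree two, so scaling multiplies them by `r²`. -/
lemma scale_mem_idealI (r : ℂ) (α lam : ℝ) : scale r ∈ stab (idealI polyCoords α lam) := by
  intro f hf
  have h : ∀ j, QComm (scale r) (r * r) (vGen polyCoords α lam j) := by
    have h2 : ∀ i k, QComm (scale r) (r * r) (polyCoords.x i * polyCoords.x k) := fun i k =>
      (scale_coord r i).mul (scale_coord r k)
    intro j
    by_cases hl : lam = α
    · rw [vGen, if_pos hl]
      fin_cases j
      exacts [((h2 0 1).smul 2).add (h2 2 3), h2 1 1, h2 1 2, h2 1 3]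
    · rw [vGen, if_neg hl]
      fin_cases j
      exacts [((h2 0 1).smul (2 * α)).add (h2 2 3), h2 0 0, h2 0 2, h2 0 3]
  refine Submodule.iSup_induction _ (motive := fun f => scale r f ∈ idealI polyCoords α lam)
    hf ?_ ?_ ?_
  · rintro j _ ⟨g, rfl⟩
    rw [(h j).apply]
    exact Submodule.smul_mem _ _ (Submodule.mem_iSup_of_mem j ⟨_, rfl⟩)
  · rw [map_zero]; exact zero_mem _
  · intro f g hf hg
    rw [map_add]; exact add_mem hf hg

lemma besselSum_mem_idealI {α lam : ℝ} (hα : α ≠ 0) (hl : lam = α ∨ lam = 1) :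
    besselSum polyCoords α lam ∈ stab (idealI polyCoords α lam) := by
  have h : ∀ i, bessel polyCoords α lam i ∈ stab (idealI polyCoords α lam) := fun i => by
    rw [← schrPi_single]
    exact schrPi_mem_stab_idealI polyCoords_hX hα hl (mem_tkk.mpr (zero_mem _))
  exact add_mem (h 0) (h 1)

lemma besselExp_mem_idealI {α lam : ℝ} (hα : α ≠ 0) (hl : lam = α ∨ lam = 1) (s : ℂ) :
    besselExp hα lam s ∈ stab (idealI polyCoords α lam) := fun _ hf =>
  lexp_mem _ (besselSum_mem_idealI hα hl) s hf

lemma exists_piC_inverse {α : ℝ} (hα : α ≠ 0) (lam : ℝ) :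
    ∃ T : Module.End ℂ (Poly 2 2), (∀ f, piC hα lam (T f) = f) ∧ (∀ f, T (piC hα lam f) = f) ∧
      (lam = α ∨ lam = 1 → T ∈ stab (idealI polyCoords α lam)) := by
  have h2 : (2 : ℂ) ^ (lam + lam / α : ℂ) ≠ 0 := by simp [Complex.cpow_eq_zero_iff]
  have h4 : (1 / 4 : ℂ)⁻¹ = 4 := by norm_num
  have h4' : (4 : ℂ)⁻¹ = 1 / 4 := by norm_num
  refine ⟨((2 : ℂ) ^ (lam + lam / α : ℂ))⁻¹ • (besselExp hα lam (-(1 / 4)) * scale 4), ?_, ?_, ?_⟩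
  · intro f
    have e1 := scale_scale_inv (r := 1 / 4) (by norm_num) f
    have e2 := lexp_lexp_neg (locallyNilpotent_besselSum hα lam) (1 / 4) (scale 4 f)
    rw [h4] at e1
    simp only [piC, LinearMap.smul_apply, Module.End.mul_apply, map_smul, smul_smul,
      mul_inv_cancel₀ h2, inv_mul_cancel₀ h2, one_smul]
    rw [besselExp, besselExp, e2, e1]
  · intro f
    have e1 := scale_scale_inv (r := 4) (by norm_num) (besselExp hα lam (1 / 4) f)
    have e2 := lexp_lexp_neg (locallyNilpotent_besselSum hα lam) (-(1 / 4)) f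
    rw [h4'] at e1
    rw [neg_neg] at e2
    simp only [piC, LinearMap.smul_apply, Module.End.mul_apply, map_smul, smul_smul,
      mul_inv_cancel₀ h2, inv_mul_cancel₀ h2, one_smul, e1]
    rw [besselExp, besselExp, e2]
  · intro hl
    exact (stab _).smul_mem (mul_mem (besselExp_mem_idealI hα hl _) (scale_mem_idealI _ _ _)) _

lemma piC_mem_idealI_iff {α lam : ℝ} (hα : α ≠ 0) (hl : lam = α ∨ lam = 1) (p : Poly 2 2) :
    piC hα lam p ∈ idealI polyCoords α lam ↔ p ∈ idealI polyCoords α lam := by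
  obtain ⟨T, -, hT, hTI⟩ := exists_piC_inverse hα lam
  have h : piC hα lam ∈ stab (idealI polyCoords α lam) :=
    (stab _).smul_mem (mul_mem (scale_mem_idealI _ _ _) (besselExp_mem_idealI hα hl _)) _
  exact ⟨fun hp => hT p ▸ hTI hl _ hp, fun hp => h _ hp⟩

/-! ### Ideals of polynomials and of smooth functions -/

lemma expo_mul_injective {a b : smoothAlg} (h : a * expo = b * expo) : a = b := by
  ext x
  have hx := congrFun (congrArg Subtype.val h) x
  exact mul_right_cancel₀ (Complex.exp_ne_zero _) hx

lemma toSmooth_injective : Function.Injective toSmooth := by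
  intro p q h
  refine MvPolynomial.funext_set (fun _ => Set.range ((↑) : ℝ → ℂ))
    (fun _ => Set.infinite_range_of_injective Complex.ofReal_injective) fun x hx => ?_
  choose y hy using fun i => hx i (Set.mem_univ i)
  obtain rfl : (fun i => ((y i : ℝ) : ℂ)) = x := funext hy
  rw [← toSmooth_eval, ← toSmooth_eval, h]

/-- The set where a coordinate does not vanish is dense, so continuous functions may be compared
there. -/
lemma smoothX_mul_injective (j : Fin 2) {a b : smoothAlg} (h : smoothX j * a = smoothX j * b) :
    a = b := by
  have hd : Dense {x : Fin 2 → ℝ | x j ≠ 0} :=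
    (dense_compl_singleton (0 : ℝ)).preimage (isOpenMap_eval j)
  have ha : ContDiff ℝ (⊤ : ℕ∞) (a : (Fin 2 → ℝ) → ℂ) := a.2
  have hb : ContDiff ℝ (⊤ : ℕ∞) (b : (Fin 2 → ℝ) → ℂ) := b.2
  refine Subtype.ext (Continuous.ext_on hd ha.continuous hb.continuous fun x hx => ?_)
  have e := congrFun (congrArg Subtype.val h) x
  have hx' : ((x j : ℝ) : ℂ) ≠ 0 := by exact_mod_cast hx
  exact mul_left_cancel₀ hx' e

/-- A polynomial that vanishes where a coordinate vanishes is divisible by this coordinate. -/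
lemma X_dvd_of_toSmooth (j : Fin 2) {q : MvPolynomial (Fin 2) ℂ} {a : smoothAlg}
    (h : toSmooth q * expo = smoothX j * a) : MvPolynomial.X j ∣ q := by
  classical
  -- `σ` sets the coordinate to zero. The difference `q - σ q` is always divisible by it, and `σ q =
  -- 0` because the right-hand side vanishes on the hyperplane while the exponential has no zeros.
  set σ : MvPolynomial (Fin 2) ℂ →ₐ[ℂ] MvPolynomial (Fin 2) ℂ :=
    MvPolynomial.aeval (fun i => if i = j then 0 else MvPolynomial.X i) with hσ
  have h1 : ∀ p, MvPolynomial.X j ∣ p - σ p := by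
    intro p
    induction p using MvPolynomial.induction_on with
    | C a => simp [hσ, MvPolynomial.algebraMap_eq]
    | add p q hp hq =>
      rw [map_add, add_sub_add_comm]; exact dvd_add hp hq
    | mul_X p i hp =>
      have hX : MvPolynomial.X j ∣ (MvPolynomial.X i - σ (MvPolynomial.X i)) := by
        by_cases hij : i = j
        · subst hij; simp [hσ]
        · simp [hσ, hij]
      rw [map_mul, show p * MvPolynomial.X i - σ p * σ (MvPolynomial.X i)
        = (p - σ p) * MvPolynomial.X i + σ p * (MvPolynomial.X i - σ (MvPolynomial.X i)) by ring]
      exact dvd_add (hp.mul_right _) (hX.mul_left _)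
  have h2 : σ q = 0 := by
    apply toSmooth_injective
    ext x
    set y : Fin 2 → ℝ := fun i => if i = j then 0 else x i with hy
    have e : MvPolynomial.eval (fun i => (x i : ℂ)) (σ q)
        = MvPolynomial.eval (fun i => (y i : ℂ)) q := by
      rw [hσ, MvPolynomial.aeval_def, MvPolynomial.algebraMap_eq, ← MvPolynomial.coe_eval₂Hom,
        MvPolynomial.map_eval₂Hom, MvPolynomial.coe_eval₂Hom, MvPolynomial.eval,
        MvPolynomial.coe_eval₂Hom]
      congr 1
      · ext; simp
      · funext i
        by_cases hij : i = j <;> simp [hy, hij]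
    have e1 := congrFun (congrArg Subtype.val h) y
    have e2 : ((toSmooth q : smoothAlg) : (Fin 2 → ℝ) → ℂ) y * Complex.exp _
        = ((y j : ℝ) : ℂ) * (a : (Fin 2 → ℝ) → ℂ) y := e1
    have hyj : y j = 0 := by simp [hy]
    rw [hyj, Complex.ofReal_zero, zero_mul, mul_eq_zero, toSmooth_eval] at e2
    rw [map_zero, toSmooth_eval, e, e2.resolve_right (Complex.exp_ne_zero _)]
    rfl
  simpa [h2] using h1 q

lemma toSmooth_X (j : Fin 2) : toSmooth (MvPolynomial.X j) = smoothX j := by simp [toSmooth]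

/-- In normal form, membership of the ideal is divisibility by the coordinate: once for the odd
components and twice for the even combination. A smooth quotient can then be replaced by a
polynomial one times the exponential. -/
lemma isNormal_mulExpo_iff (t : ℂ) (j : Fin 2) (p : Poly 2 2) :
    IsNormal smoothX (algebraMap ℂ smoothAlg t) (smoothX j) (mulExpo p)
      ↔ IsNormal MvPolynomial.X (algebraMap ℂ (MvPolynomial (Fin 2) ℂ) t) (MvPolynomial.X j) p := by
  have ht : toSmooth (algebraMap ℂ _ t) = algebraMap ℂ smoothAlg t := AlgHom.commutes _ t
  have h2 : toSmooth (2 : MvPolynomial (Fin 2) ℂ) = 2 := map_ofNat _ 2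
  constructor
  · rintro ⟨a, b, c, h, h0, h1⟩
    rw [mulExpo_apply] at h h0 h1
    rw [mulExpo_apply] at h
    obtain ⟨a', ha⟩ := X_dvd_of_toSmooth j h0
    obtain ⟨b', hb⟩ := X_dvd_of_toSmooth j h1
    set q := p ∅ - 2 * algebraMap ℂ (MvPolynomial (Fin 2) ℂ) t * MvPolynomial.X 0 * MvPolynomial.X 1
      * p {0, 1} with hq
    have e1 : toSmooth q * expo = smoothX j * (smoothX j * c) := by
      rw [hq, map_sub, map_mul, map_mul, map_mul, map_mul, ht, h2, toSmooth_X, toSmooth_X]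
      linear_combination h
    obtain ⟨q', hq'⟩ := X_dvd_of_toSmooth j e1
    -- Cancelling one factor of the coordinate allows divisibility to be used a second time.
    have e2 : toSmooth q' * expo = smoothX j * c := by
      apply smoothX_mul_injective j
      rw [← e1, hq', map_mul, toSmooth_X, mul_assoc]
    obtain ⟨c', hc⟩ := X_dvd_of_toSmooth j e2
    refine ⟨a', b', c', ?_, ha, hb⟩
    rw [hc] at hq'
    linear_combination hq' - hq
  · rintro ⟨a, b, c, h, h0, h1⟩
    refine ⟨toSmooth a * expo, toSmooth b * expo, toSmooth c * expo, ?_, ?_, ?_⟩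
    · rw [mulExpo_apply, mulExpo_apply, h]
      simp only [map_add, map_mul, ht, h2, toSmooth_X]
      ring
    · rw [mulExpo_apply, h0, map_mul, toSmooth_X, mul_assoc]
    · rw [mulExpo_apply, h1, map_mul, toSmooth_X, mul_assoc]

lemma mulExpo_mem_idealI_iff {α lam : ℝ} (hl : lam = α ∨ lam = 1) (p : Poly 2 2) :
    mulExpo p ∈ idealI smoothCoords α lam ↔ p ∈ idealI polyCoords α lam := by
  by_cases h : lam = α
  · subst h
    rw [smoothCoords, polyCoords, idealI_alpha, idealI_alpha]
    have e := isNormal_mulExpo_iff 1 1 p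
    rw [map_one, map_one] at e
    exact e
  · obtain rfl := hl.resolve_left h
    rw [smoothCoords, polyCoords, idealI_one _ _ h, idealI_one _ _ h]
    exact isNormal_mulExpo_iff α 0 p

/-! ### The Fock space is generated by the constants -/

lemma mapQ_schrPi_mkQ {A : Type} [AddCommGroup A] [Module ℂ A] (c : Coords A) (α lam : ℝ)
    (Z : Triple) (h : idealI c α lam ≤ (idealI c α lam).comap (schrPi c α lam Z)) (f : A) :
    (idealI c α lam).mapQ (idealI c α lam) (schrPi c α lam Z) h ((idealI c α lam).mkQ f)
      = (idealI c α lam).mkQ (schrPi c α lam Z f) := rfl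

lemma cayley_mem_stab {α lam : ℝ} (hα : α ≠ 0) (hl : lam = α ∨ lam = 1) (X : tkk α) :
    schrPi polyCoords α lam (cayley α X) ∈ stab (idealI polyCoords α lam) :=
  schrPi_mem_stab_idealI polyCoords_hX hα hl (cayley_mem X.2)

lemma rho_mkQ {α lam : ℝ} (hα : α ≠ 0) (hl : lam = α ∨ lam = 1) (X : tkk α) (f : Poly 2 2) :
    rho α lam hα hl X ((idealI polyCoords α lam).mkQ f)
      = (idealI polyCoords α lam).mkQ (schrPi polyCoords α lam (cayley α X) f) := by
  have h := mapQ_schrPi_mkQ polyCoords α lam (cayley α X) (cayley_mem_stab hα hl X) f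
  unfold rho
  with_reducible exact h

lemma rho_mem_F {α lam : ℝ} (hα : α ≠ 0) (hl : lam = α ∨ lam = 1) (X : tkk α)
    {v : FockSpace α lam} (hv : v ∈ F α lam hα hl) : rho α lam hα hl X v ∈ F α lam hα hl :=
  (rhoF α lam hα hl X ⟨v, hv⟩).2

lemma rhoF_coe {α lam : ℝ} (hα : α ≠ 0) (hl : lam = α ∨ lam = 1) (X : tkk α)
    (v : F α lam hα hl) : (rhoF α lam hα hl X v : FockSpace α lam) = rho α lam hα hl X v := rfl

lemma schrPi_lower {A : Type} [AddCommGroup A] [Module ℂ A] (c : Coords A) (α lam : ℝ)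
    (i : Fin 4) : schrPi c α lam ((Complex.I / 2) • (Pi.single i 1 : Jor), 0, 0) = c.x i := by
  have h0 : strOp c α lam 0 = 0 := by simpa using strOp_smul c α lam 0 0
  have h1 : 2 * Complex.I * (Complex.I / 2) = -1 := by linear_combination Complex.I_mul_I
  rw [schrPi_eq, h0]
  fin_cases i <;> simp [Fin.sum_univ_four, h1]

lemma exists_schrPi_cayley_eq_coord (α lam : ℝ) (i : Fin 4) :
    ∃ X : tkk α, schrPi polyCoords α lam (cayley α X) = polyCoords.x i := by
  have hX : ∀ u : Jor, ((u, (-(2 * Complex.I)) • jmul α u, u) : Triple) ∈ tkk α := fun u =>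
    mem_tkk_smul_jmul _ _ _ _
  refine ⟨⟨_, hX ((Complex.I / 2) • Pi.single i 1)⟩, ?_⟩
  rw [cayley_lower, schrPi_lower]

lemma mkQ_coord_mem_F {α lam : ℝ} (hα : α ≠ 0) (hl : lam = α ∨ lam = 1) (i : Fin 4) {f : Poly 2 2}
    (hf : (idealI polyCoords α lam).mkQ f ∈ F α lam hα hl) :
    (idealI polyCoords α lam).mkQ (polyCoords.x i f) ∈ F α lam hα hl := by
  obtain ⟨X, hX⟩ := exists_schrPi_cayley_eq_coord α lam i
  rw [← hX, ← rho_mkQ hα hl]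
  with_reducible exact rho_mem_F hα hl X hf

/-- The class of `1` generates the whole quotient, since multiplication by every coordinate is some
`ρ_λ(X)`. -/
lemma F_eq_top {α lam : ℝ} (hα : α ≠ 0) (hl : lam = α ∨ lam = 1) : F α lam hα hl = ⊤ := by
  rw [eq_top_iff]
  rintro v -
  obtain ⟨f, rfl⟩ := (idealI polyCoords α lam).mkQ_surjective v
  refine poly_induction (N := (F α lam hα hl).comap (idealI polyCoords α lam).mkQ) ?_ ?_ f
  · exact Submodule.subset_span ⟨[], by simp⟩
  · intro i f hf
    rw [Submodule.mem_comap] at hf ⊢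
    exact mkQ_coord_mem_F hα hl i hf

/-! ### Parity -/

/-- The superpolynomials of a given parity. -/
def parityPart (ε : ℕ) : Submodule ℂ (Poly 2 2) where
  carrier := {q | ∀ S, S.card % 2 ≠ ε → q S = 0}
  add_mem' hf hg S hS := by simp [hf S hS, hg S hS]
  zero_mem' S _ := rfl
  smul_mem' t f hf S hS := by simp [hf S hS]

/-- The operator only mixes components whose numbers of odd factors differ by zero or two. -/
lemma besselSum_mem_parityPart {α : ℝ} (lam : ℝ) (ε : ℕ) {f : Poly 2 2}
    (hf : f ∈ parityPart ε) : besselSum polyCoords α lam f ∈ parityPart ε := by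
  intro S hS
  rcases finset_cases S with rfl | rfl | rfl | rfl
  · have h0 := hf ∅ hS
    have h1 := hf {0, 1} fun e => hS (by rw [← e]; rfl)
    simp [besselSum, bessel, polyCoords, sfCoords, h0, h1]
  · have h0 := hf {0} hS
    simp [besselSum, bessel, polyCoords, sfCoords, h0]
  · have h0 := hf {1} hS
    simp [besselSum, bessel, polyCoords, sfCoords, h0]
  · have h0 := hf ∅ fun e => hS (by rw [← e]; rfl)
    have h1 := hf {0, 1} hS
    simp [besselSum, bessel, polyCoords, sfCoords, h0, h1]

lemma piC_mem_parityPart {α : ℝ} (hα : α ≠ 0) (lam : ℝ) (ε : ℕ) {f : Poly 2 2}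
    (hf : f ∈ parityPart ε) : piC hα lam f ∈ parityPart ε := by
  have h : besselExp hα lam (1 / 4) f ∈ parityPart ε :=
    lexp_mem _ (fun _ => besselSum_mem_parityPart lam ε) _ hf
  refine Submodule.smul_mem _ _ fun S hS => ?_
  rw [Module.End.mul_apply, scale_apply, h S hS, map_zero, smul_zero]

/-! ### The isomorphism -/

/-- The superpolynomial `p` times the exponential function, as an element of the domain. -/
def toPolyExp : Poly 2 2 →ₗ[ℂ] polyExp := mulExpo.codRestrict polyExp fun p => ⟨p, mulExpo_apply p⟩

lemma toPolyExp_surjective : Function.Surjective toPolyExp := by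
  rintro ⟨f, p, hp⟩
  exact ⟨p, Subtype.ext (funext fun S => (mulExpo_apply p S).trans (hp S).symm)⟩

/-- The projection of the superpolynomials onto the Schrödinger model. -/
def polyToW (α lam : ℝ) : Poly 2 2 →ₗ[ℂ] W α lam :=
  ((idealI smoothCoords α lam).mkQ ∘ₗ mulExpo).codRestrict (W α lam)
    fun p => Submodule.mem_map_of_mem ⟨p, mulExpo_apply p⟩

lemma polyToW_eq (α lam : ℝ) (p : Poly 2 2) : polyToW α lam p = toW α lam (toPolyExp p) := rfl

lemma polyToW_surjective (α lam : ℝ) : Function.Surjective (polyToW α lam) := by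
  rintro ⟨_, f, hf, rfl⟩
  obtain ⟨p, hp⟩ := toPolyExp_surjective ⟨f, hf⟩
  refine ⟨p, ?_⟩
  rw [polyToW_eq, hp]
  rfl

/-- Applied with the superpolynomials as common source: both models are quotients of them by the
same subspace. -/
lemma exists_equiv_of_ker_eq {U V V' : Type} [AddCommGroup U] [Module ℂ U] [AddCommGroup V]
    [Module ℂ V] [AddCommGroup V'] [Module ℂ V'] {φ : U →ₗ[ℂ] V} {ψ : U →ₗ[ℂ] V'}
    (hφ : Function.Surjective φ) (hψ : Function.Surjective ψ)
    (h : LinearMap.ker φ = LinearMap.ker ψ) : ∃ e : V ≃ₗ[ℂ] V', ∀ u, e (φ u) = ψ u := by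
  refine ⟨(φ.quotKerEquivOfSurjective hφ).symm ≪≫ₗ Submodule.quotEquivOfEq _ _ h ≪≫ₗ
    ψ.quotKerEquivOfSurjective hψ, fun u => ?_⟩
  have e : (φ.quotKerEquivOfSurjective hφ).symm (φ u) = Submodule.Quotient.mk u := by
    rw [LinearEquiv.symm_apply_eq]; rfl
  rw [LinearEquiv.trans_apply, LinearEquiv.trans_apply, e]
  rfl

/-- The Segal–Bargmann transform as an isomorphism. -/
lemma exists_segalBargmann {α lam : ℝ} (hα : α ≠ 0) (hl : lam = α ∨ lam = 1) :
    ∃ SB : W α lam ≃ₗ[ℂ] F α lam hα hl, ∀ p, (SB (polyToW α lam p) : FockSpace α lam)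
      = (idealI polyCoords α lam).mkQ (piC hα lam p) := by
  have hF := F_eq_top hα hl
  obtain ⟨T, hT, -, -⟩ := exists_piC_inverse hα lam
  obtain ⟨e, he⟩ := exists_equiv_of_ker_eq (φ := polyToW α lam)
    (ψ := (idealI polyCoords α lam).mkQ ∘ₗ piC hα lam) (polyToW_surjective α lam)
    ((Submodule.mkQ_surjective _).comp fun f => ⟨T f, hT f⟩) (by
      ext p
      rw [LinearMap.mem_ker, LinearMap.mem_ker, LinearMap.comp_apply, Submodule.mkQ_apply,
        Submodule.Quotient.mk_eq_zero, piC_mem_idealI_iff hα hl, ← mulExpo_mem_idealI_iff hl,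
        ← Submodule.Quotient.mk_eq_zero]
      exact Subtype.ext_iff)
  exact ⟨e ≪≫ₗ (LinearEquiv.ofTop _ hF).symm, fun p => he p⟩

end D21

end

/-- Because `IsSegalBargmann` is a relation on representatives, the equivalence with `v = SB (toW
f)` contains existence and uniqueness of the transform, independence of the representative and
membership of `F_λ`. -/
theorem mainTheorem2 (α lam : ℝ) (hα : α ≠ 0)
    (h : (lam = α ∧ ∀ n : ℕ, α ≠ n) ∨ (lam = 1 ∧ ∀ n : ℕ, α⁻¹ ≠ n)) :
    ∃ SB : D21.W α lam ≃ₗ[ℂ] D21.F α lam hα (h.imp And.left And.left),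
      (∀ (f : D21.polyExp) (v : D21.FockSpace α lam),
        D21.IsSegalBargmann α lam f v ↔ v = SB (D21.toW α lam f)) ∧
      (∀ (X : D21.tkk α) (w : D21.W α lam),
        SB (D21.piW α lam hα (h.imp And.left And.left) X w)
          = D21.rhoF α lam hα (h.imp And.left And.left) X (SB w)) ∧
      (∀ (ε : ℕ) (f : D21.polyExp), (∀ S, S.card % 2 ≠ ε → (f : D21.Smooth) S = 0) →
        ∃ q : D21.Poly 2 2, (∀ S, S.card % 2 ≠ ε → q S = 0) ∧
          (SB (D21.toW α lam f) : D21.FockSpace α lam)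
            = (D21.idealI D21.polyCoords α lam).mkQ q) := by
  obtain ⟨SB, hSB⟩ := D21.exists_segalBargmann hα (h.imp And.left And.left)
  refine ⟨SB, ?_, ?_, ?_⟩
  · intro f v
    obtain ⟨p, rfl⟩ := D21.toPolyExp_surjective f
    rw [← D21.polyToW_eq, hSB, ← D21.kernelTransform_eq hα h]
    constructor
    · rintro ⟨g, hg, rfl⟩
      rw [(D21.isPiC_mulExpo_iff hα lam p g).mp hg]
    · rintro rfl
      exact ⟨_, (D21.isPiC_mulExpo_iff hα lam p _).mpr rfl, rfl⟩
  · intro X w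
    obtain ⟨p, rfl⟩ := D21.polyToW_surjective α lam w
    have h1 := D21.schrPi_mulExpo hα lam X p
    have h2 : D21.piW α lam hα (h.imp And.left And.left) X (D21.polyToW α lam p)
        = D21.polyToW α lam (D21.schrPi D21.polyCoords α lam (X.1.1 + Complex.I • X.1.2.1 D21.jone
          + X.1.2.2, X.1.2.1 - (2 * Complex.I) • D21.jmul α X.1.2.2, X.1.2.2) p) :=
      Subtype.ext (congrArg (D21.idealI D21.smoothCoords α lam).mkQ h1)
    apply Subtype.ext
    rw [h2, hSB, D21.piC_schrPi hα lam X.2, D21.rhoF_coe, hSB, D21.rho_mkQ]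
  · intro ε f hf
    obtain ⟨p, rfl⟩ := D21.toPolyExp_surjective f
    -- The exponential factor is even and can be cancelled, so `p` has the parity of `f`.
    have hp : p ∈ D21.parityPart ε := fun S hS => by
      have e : D21.toSmooth (p S) * D21.expo = 0 * D21.expo := by
        rw [zero_mul, ← D21.mulExpo_apply]; exact hf S hS
      apply D21.toSmooth_injective
      rw [D21.expo_mul_injective e, map_zero]
    exact ⟨_, D21.piC_mem_parityPart hα lam ε hp, hSB p⟩
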